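/- Let $\varphi=(1+\sqrt5)/2$ and $\zeta=e^{2\pi i/5}$. The Star tileset consists of five polygons in the plane $\mathbb{C}$ with sides of length $1$ and coloured vertices, listed here in cyclic order: - the hexagon $H$: $\zeta^0$ (green), $\zeta^0+\zeta^1$ (red), $\zeta^1$ (green), $\zeta^1+\zeta^3$ (blue), $\zeta^3$ (red), $\zeta^3+\zeta^0$ (blue); - the boat $B$: $\zeta^0$ (green), $\zeta^0+\zeta^1$ (red), $\zeta^1$ (blue), $\zeta^1+\zeta^2$ (green), $\zeta^2$ (blue), $\zeta^2+\zeta^3$ (red), $\zeta^3$ (green), $\zeta^3+\zeta^0$ (blue); - the stars $S_0,S_1,S_2$: the decagon with blue reflex vertices $\zeta^k$ and tips $\zeta^k+\zeta^{k+1}$ ($k=0,\dots,4$), where $S_i$ has exactly $i$ red tips, the other tips being green, and the two red tips of $S_2$ are not consecutive. A Star tiling is a countable family of isometric copies of these tiles that covers the plane, with pairwise disjoint interiors, edge-to-edge (every vertex of a tile that lies in another tile is a vertex of that tile), and such that tiles sharing a vertex give it the same colour. The relative frequency of a class of tiles is the limit, as $r\to\infty$, of the number of tiles of the class contained in the disc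 of radius $r$ about $x$ divided by the number of all tiles contained in this disc; asymptotic ratios of numbers of vertices are defined likewise with the vertices lying in the disc. Then in every Star tiling, for every centre $x$, these limits exist, and the relative frequencies $f_H,f_B,f_2,f_1,f_0$ of $H,B,S_2,S_1,S_0$ are $$f_H=\sqrt5\,\varphi^{-3},\quad f_B=\sqrt5\,\varphi^{-4},\quad f_2=\sqrt5\,\varphi^{-7},\quad f_1=\sqrt5\,\varphi^{-8},\quad f_0=\varphi^{-8}.$$ The three kinds of stars together have relative frequency $f_S=\varphi^{-4}$, and the numbers of blue, green and red vertices are asymptotically in the ratio $\sqrt5\,\varphi:\sqrt5:1$. -/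

import Mathlib

open Filter Topology
open scoped goldenRatio

noncomputable section

namespace StarTileset

/-- The colours carried by the vertices of the Star tiles (their numerical labels are
red = 0, green = 1, blue = 2). -/
inductive Colour
  | red
  | green
  | blue

/-- The five prototiles: the hexagon `H`, the boat `B`, and the stars `S0`, `S1`, `S2`
with 0, 1 and 2 red vertices. -/
inductive Proto
  | H
  | B
  | S0
  | S1
  | S2

/-- The `k`-th fifth root of unity `exp (2 π i k / 5)`, as a point of the Euclidean plane `ℂ`. -/
def ζ (k : ℕ) : ℂ := Complex.exp (2 * Real.pi * Complex.I * k / 5)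

/-- The (closed, filled) rhombus with corners `0`, `u`, `u + v`, `v`. -/
def rhombus (u v : ℂ) : Set ℂ := convexHull ℝ {0, u, u + v, v}

/-- The fat (72°) Penrose rhombus between the directions `ζ k` and `ζ (k + 1)`. -/
def fat (k : ℕ) : Set ℂ := rhombus (ζ k) (ζ (k + 1))

/-- The thin (144°) Penrose rhombus between the directions `ζ k` and `ζ (k + 2)`. -/
def thin (k : ℕ) : Set ℂ := rhombus (ζ k) (ζ (k + 2))

/-- The closed polygonal region of a prototile, with sides of length 1. The hexagon is composed of
one fat and two thin rhombuses, the boat of three fat and one thin, the star of five fat ones,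
arranged around the origin. -/
def Proto.region : Proto → Set ℂ
  | .H => fat 0 ∪ thin 1 ∪ thin 3
  | .B => fat 0 ∪ fat 1 ∪ fat 2 ∪ thin 3
  | .S0 | .S1 | .S2 => fat 0 ∪ fat 1 ∪ fat 2 ∪ fat 3 ∪ fat 4

/-- The coloured vertices of a star whose five tips have the given colours, in cyclic order.
The five reflex vertices are blue. -/
def starVertices (c₀ c₁ c₂ c₃ c₄ : Colour) : Set (ℂ × Colour) :=
  {(ζ 0, .blue), (ζ 0 + ζ 1, c₀), (ζ 1, .blue), (ζ 1 + ζ 2, c₁), (ζ 2, .blue),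
   (ζ 2 + ζ 3, c₂), (ζ 3, .blue), (ζ 3 + ζ 4, c₃), (ζ 4, .blue), (ζ 4 + ζ 0, c₄)}

/-- The vertices of a prototile with their colours, listed in cyclic order along its boundary. -/
def Proto.vertices : Proto → Set (ℂ × Colour)
  | .H => {(ζ 0, .green), (ζ 0 + ζ 1, .red), (ζ 1, .green), (ζ 1 + ζ 3, .blue), (ζ 3, .red),
      (ζ 3 + ζ 0, .blue)}
  | .B => {(ζ 0, .green), (ζ 0 + ζ 1, .red), (ζ 1, .blue), (ζ 1 + ζ 2, .green), (ζ 2, .blue),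
      (ζ 2 + ζ 3, .red), (ζ 3, .green), (ζ 3 + ζ 0, .blue)}
  | .S0 => starVertices .green .green .green .green .green
  | .S1 => starVertices .red .green .green .green .green
  | .S2 => starVertices .red .green .red .green .green

/-- A Star tiling: a family of isometric copies of the five prototiles which covers the plane, with
pairwise disjoint interiors, edge-to-edge, and with matching vertex colours. -/
structure StarTiling (ι : Type*) where
  /-- The prototile of each tile. -/
  proto : ι → Proto
  /-- The isometry of the plane that puts the prototile in place. -/
  place : ι → ℂ ≃ᵢ ℂ
  covers : ⋃ i, place i '' (proto i).region = Set.univ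
  interior_disjoint : Pairwise fun i j =>
    Disjoint (interior (place i '' (proto i).region)) (interior (place j '' (proto j).region))
  /-- A vertex of a tile that lies in another tile is a vertex of that tile, of the same colour. -/
  vertices_match : ∀ (i j : ι) (p q : ℂ) (c : Colour), (p, c) ∈ (proto i).vertices →
    place i p = place j q → q ∈ (proto j).region → (q, c) ∈ (proto j).vertices

namespace StarTiling

variable {ι : Type*} (T : StarTiling ι)

/-- The closed region of the plane occupied by a tile. -/
def tile (i : ι) : Set ℂ := T.place i '' (T.proto i).region

/-- The number of tiles contained in the closed disc of centre `x` and radius `r` whose prototile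
belongs to `K`. -/
def tileCount (K : Set Proto) (x : ℂ) (r : ℝ) : ℕ :=
  {i : ι | T.proto i ∈ K ∧ T.tile i ⊆ Metric.closedBall x r}.ncard

/-- The tiles with prototile in `K` have relative frequency `f` among all tiles: in discs of
radius `r` around any point, their proportion tends to `f` as `r` tends to infinity. -/
def HasFrequency (K : Set Proto) (f : ℝ) : Prop :=
  ∀ x : ℂ, Tendsto (fun r : ℝ => (T.tileCount K x r : ℝ) / T.tileCount Set.univ x r)
    atTop (𝓝 f)

/-- The set of vertices of the tiling of a given colour. -/
def colouredVertices (c : Colour) : Set ℂ :=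
  {z : ℂ | ∃ (i : ι) (p : ℂ), (p, c) ∈ (T.proto i).vertices ∧ T.place i p = z}

/-- The number of vertices of colour `c` in the closed disc of centre `x` and radius `r`. -/
def vertexCount (c : Colour) (x : ℂ) (r : ℝ) : ℕ :=
  (T.colouredVertices c ∩ Metric.closedBall x r).ncard

/-- The asymptotic ratio of the number of vertices of colour `c` to that of colour `d` is `a`. -/
def HasVertexRatio (c d : Colour) (a : ℝ) : Prop :=
  ∀ x : ℂ, Tendsto (fun r : ℝ => (T.vertexCount c x r : ℝ) / T.vertexCount d x r) atTop (𝓝 a)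

end StarTiling

end StarTileset

end

/-! ### Star maps: the combinatorial model of a tiling -/

namespace StarTileset

/-! The argument replaces the geometric inflation of Star tilings by a purely combinatorial
composition and extracts the frequencies from its contracting eigenvalue.

Suppressing the blue vertices, a tiling becomes a `StarMap` on the set of its corners: `next` walks
around a tile, `rot` walks around a vertex, and `rot ∘ next` crosses a side. The matching of colours
and of angles at blue vertices leaves only a short table of possible transitions. At a red vertex
the cyclic pattern is either one star tip, two boats and two hexagons, or two boats and three
hexagons, or five hexagons.

The composition `comp` turns these three patterns into a new hexagon, boat and star. Old stars
become the red vertices of the new map, old boats become its green vertices, and old hexagons and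
boat bases become its bent and straight sides. It is again a `StarMap` on the same set of corners,
with fewer of them labelled and the others marked `out`, so it can be iterated without any geometry.

Let h and b count hexagons and boats in a disc of radius r, with primes for the composition. Up to
O(r), h = b + h' and b = b' + h', because these are bijections of corners moving points by a bounded
distance (`count_Hr2`, `count_Br0`). Hence h - φb = φ⁻²(h' - φb') + O(r). All these deviations are
bounded by the same multiple of r², so n iterations give h - φb = o(r²) (`dev_isLittleO`). Red star
tips are the new hexagons. The middle tips of the S₂ stars are the new red star tips, that is, the
hexagons after two compositions. Gluing convex bent sides to reflex ones counts all stars. This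
gives every class of tiles per boat.

The geometric half builds the star map of a tiling. Every tile is a direct copy of its prototile
because prototiles have coloured mirror symmetries. Near a vertex each tile is a sector whose angle
is a multiple of 2π/5, and the sectors at a vertex fit together without overlap, which defines
`rot`. Packing and covering by discs shows that the number of tiles in a disc is of exact order r²
and the number near its boundary is O(r), so limits exist for every centre. -/

/-- The corners of the Star tiles at vertices which are not blue; `out` marks darts outside the
domain of a star map. -/
inductive Lab
  | Hg0 | Hr1 | Hg1 | Hr2 | Bg0 | Br0 | Bm | Br1 | Bg1 | Sr | Sg | out
  deriving DecidableEq

/-- A combinatorial star tiling, with blue vertices suppressed. -/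
structure StarMap (D : Type*) where
  lab : D → Lab
  next : D → D
  rot : D → D
  next_Hg0 : ∀ d, lab d = .Hg0 → lab (next d) = .Hr1
  next_Hr1 : ∀ d, lab d = .Hr1 → lab (next d) = .Hg1
  next_Hg1 : ∀ d, lab d = .Hg1 → lab (next d) = .Hr2
  next_Hr2 : ∀ d, lab d = .Hr2 → lab (next d) = .Hg0
  next_Bg0 : ∀ d, lab d = .Bg0 → lab (next d) = .Br0
  next_Br0 : ∀ d, lab d = .Br0 → lab (next d) = .Bm
  next_Bm : ∀ d, lab d = .Bm → lab (next d) = .Br1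
  next_Br1 : ∀ d, lab d = .Br1 → lab (next d) = .Bg1
  next_Bg1 : ∀ d, lab d = .Bg1 → lab (next d) = .Bg0
  next_Sr : ∀ d, lab d = .Sr → lab (next d) = .Sg
  next_Sg : ∀ d, lab d = .Sg → lab (next d) = .Sr ∨ lab (next d) = .Sg
  next_H : ∀ d, (lab d = .Hg0 ∨ lab d = .Hr1 ∨ lab d = .Hg1 ∨ lab d = .Hr2) →
    next (next (next (next d))) = d
  next_BS : ∀ d, (lab d = .Bg0 ∨ lab d = .Br0 ∨ lab d = .Bm ∨ lab d = .Br1 ∨ lab d = .Bg1 ∨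
    lab d = .Sr ∨ lab d = .Sg) → next (next (next (next (next d)))) = d
  rot_Hg0 : ∀ d, lab d = .Hg0 →
    lab (rot d) = .Bm ∨ (lab (rot d) = .Sg ∧ lab (next (rot d)) = .Sr)
  rot_Bg0 : ∀ d, lab d = .Bg0 → lab (rot d) = .Sg ∧ lab (next (rot d)) = .Sg
  rot_Bm : ∀ d, lab d = .Bm → lab (rot d) = .Hg1
  rot_next_Sr : ∀ d, lab d = .Sr → lab (rot (next d)) = .Hg1
  rot_next_Sg : ∀ d, lab d = .Sg → lab (next d) = .Sg → lab (rot (next d)) = .Bg1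
  rot_Hg1 : ∀ d, lab d = .Hg1 → lab (rot d) = .Hg0 ∨ lab (rot d) = .Bg0
  rot_Bg1 : ∀ d, lab d = .Bg1 → lab (rot d) = .Hg0 ∨ lab (rot d) = .Bg0
  rot_Hr1 : ∀ d, lab d = .Hr1 → lab (rot d) = .Hr1 ∨ lab (rot d) = .Br1
  rot_Hr2 : ∀ d, lab d = .Hr2 → lab (rot d) = .Br0 ∨ lab (rot d) = .Sr
  rot_Br0 : ∀ d, lab d = .Br0 → lab (rot d) = .Hr1 ∨ lab (rot d) = .Br1
  rot_Br1 : ∀ d, lab d = .Br1 → lab (rot d) = .Hr2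
  rot_Sr : ∀ d, lab d = .Sr → lab (rot d) = .Hr2
  rot_green : ∀ d, (lab d = .Hg0 ∨ lab d = .Hg1 ∨ lab d = .Bg0 ∨ lab d = .Bg1 ∨ lab d = .Bm ∨
    lab d = .Sg) → rot (rot (rot d)) = d
  rot_red : ∀ d, (lab d = .Hr1 ∨ lab d = .Hr2 ∨ lab d = .Br0 ∨ lab d = .Br1 ∨ lab d = .Sr) →
    rot (rot (rot (rot (rot d)))) = d
  opp_opp : ∀ d, lab d ≠ .out → rot (next (rot (next d))) = d

namespace StarMap
variable {D : Type*} (X : StarMap D)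

/-- The preceding corner of the same tile. -/
def prev (d : D) : D := X.next^[19] d

/-- The preceding corner at the same vertex. -/
def unrot (d : D) : D := X.rot^[14] d

theorem next_lab_ne_out {d : D} (h : X.lab d ≠ .out) : X.lab (X.next d) ≠ .out := by
  have := X.next_Hg0 d; have := X.next_Hr1 d; have := X.next_Hg1 d; have := X.next_Hr2 d
  have := X.next_Bg0 d; have := X.next_Br0 d; have := X.next_Bm d; have := X.next_Br1 d
  have := X.next_Bg1 d; have := X.next_Sr d; have := X.next_Sg d
  cases hd : X.lab d <;> grind

/-- Tiles have 4 or 5 corners that are not blue, and 20 is a common multiple, so `next^[19]` inverts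
`next` on the domain. In the same way 15 serves for the vertices, where 3 or 5 corners meet. -/
theorem next_iter20 {d : D} (h : X.lab d ≠ .out) : X.next^[20] d = d := by
  have h4 := X.next_H d
  have h5 := X.next_BS d
  simp only [Function.iterate_succ, Function.iterate_zero, Function.comp, id]
  cases hd : X.lab d <;> simp_all

theorem rot_iter15 {d : D} (h : X.lab d ≠ .out) : X.rot^[15] d = d := by
  have h4 := X.rot_green d
  have h5 := X.rot_red d
  simp only [Function.iterate_succ, Function.iterate_zero, Function.comp, id]
  cases hd : X.lab d <;> simp_all

theorem prev_next {d : D} (h : X.lab d ≠ .out) : X.prev (X.next d) = d := X.next_iter20 h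
theorem next_prev {d : D} (h : X.lab d ≠ .out) : X.next (X.prev d) = d := by
  have := X.next_iter20 h; rwa [Function.iterate_succ_apply'] at this
theorem unrot_rot {d : D} (h : X.lab d ≠ .out) : X.unrot (X.rot d) = d := X.rot_iter15 h
theorem rot_unrot {d : D} (h : X.lab d ≠ .out) : X.rot (X.unrot d) = d := by
  have := X.rot_iter15 h; rwa [Function.iterate_succ_apply'] at this

theorem iterate_next_ne_out (n : ℕ) {d : D} (h : X.lab d ≠ .out) : X.lab (X.next^[n] d) ≠ .out := by
  induction n with
  | zero => exact h
  | succ n ih => rw [Function.iterate_succ_apply']; exact X.next_lab_ne_out ih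

theorem prev_ne_out {d : D} (h : X.lab d ≠ .out) : X.lab (X.prev d) ≠ .out :=
  X.iterate_next_ne_out 19 h

/-- The transition table of `next`, arranged so that it can be read backwards. -/
theorem prev_cases {d : D} (h : X.lab d ≠ .out) :
    (X.lab (X.prev d) = .Hg0 ∧ X.lab d = .Hr1) ∨ (X.lab (X.prev d) = .Hr1 ∧ X.lab d = .Hg1) ∨
    (X.lab (X.prev d) = .Hg1 ∧ X.lab d = .Hr2) ∨ (X.lab (X.prev d) = .Hr2 ∧ X.lab d = .Hg0) ∨
    (X.lab (X.prev d) = .Bg0 ∧ X.lab d = .Br0) ∨ (X.lab (X.prev d) = .Br0 ∧ X.lab d = .Bm) ∨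
    (X.lab (X.prev d) = .Bm ∧ X.lab d = .Br1) ∨ (X.lab (X.prev d) = .Br1 ∧ X.lab d = .Bg1) ∨
    (X.lab (X.prev d) = .Bg1 ∧ X.lab d = .Bg0) ∨ (X.lab (X.prev d) = .Sr ∧ X.lab d = .Sg) ∨
    (X.lab (X.prev d) = .Sg ∧ X.lab d = .Sr) ∨ (X.lab (X.prev d) = .Sg ∧ X.lab d = .Sg) := by
  have hn := X.next_prev h
  have ho := X.prev_ne_out h
  generalize X.prev d = e at *
  subst hn
  have := X.next_Hg0 e; have := X.next_Hr1 e; have := X.next_Hg1 e; have := X.next_Hr2 e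
  have := X.next_Bg0 e; have := X.next_Br0 e; have := X.next_Bm e; have := X.next_Br1 e
  have := X.next_Bg1 e; have := X.next_Sr e; have := X.next_Sg e
  cases hd : X.lab e <;> simp_all

theorem rot_Sg {d : D} (h : X.lab d = .Sg) :
    (X.lab (X.prev d) = .Sr ∧ X.lab (X.rot d) = .Hg1) ∨
    (X.lab (X.prev d) = .Sg ∧ X.lab (X.rot d) = .Bg1) := by
  have h0 : X.lab d ≠ .out := by simp [h]
  have hn := X.next_prev h0
  have h1 := X.rot_next_Sr (X.prev d)
  have h2 := X.rot_next_Sg (X.prev d)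
  have h3 := X.prev_cases h0
  rw [hn] at h1 h2
  simp [h] at h1 h2 h3
  tauto

theorem rot_ne_out {d : D} (h : X.lab d ≠ .out) : X.lab (X.rot d) ≠ .out := by
  have := X.rot_Hg0 d; have := X.rot_Bg0 d; have := X.rot_Bm d; have := X.rot_Hg1 d
  have := X.rot_Bg1 d; have := X.rot_Hr1 d; have := X.rot_Hr2 d; have := X.rot_Br0 d
  have := X.rot_Br1 d; have := X.rot_Sr d; have := X.rot_Sg (d := d)
  cases hd : X.lab d <;> grind

theorem iterate_rot_ne_out (n : ℕ) {d : D} (h : X.lab d ≠ .out) : X.lab (X.rot^[n] d) ≠ .out := by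
  induction n with
  | zero => exact h
  | succ n ih => rw [Function.iterate_succ_apply']; exact X.rot_ne_out ih

theorem unrot_ne_out {d : D} (h : X.lab d ≠ .out) : X.lab (X.unrot d) ≠ .out :=
  X.iterate_rot_ne_out 14 h

/-- The whole transition table of `rot` as one disjunction; applied to `unrot d` it can be read
backwards. -/
theorem rot_cases {d : D} (h : X.lab d ≠ .out) :
    (X.lab d = .Hg0 ∧ X.lab (X.rot d) = .Bm) ∨
    (X.lab d = .Hg0 ∧ X.lab (X.rot d) = .Sg ∧ X.lab (X.next (X.rot d)) = .Sr) ∨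
    (X.lab d = .Bg0 ∧ X.lab (X.rot d) = .Sg ∧ X.lab (X.next (X.rot d)) = .Sg) ∨
    (X.lab d = .Bm ∧ X.lab (X.rot d) = .Hg1) ∨
    (X.lab d = .Sg ∧ X.lab (X.prev d) = .Sr ∧ X.lab (X.rot d) = .Hg1) ∨
    (X.lab d = .Sg ∧ X.lab (X.prev d) = .Sg ∧ X.lab (X.rot d) = .Bg1) ∨
    ((X.lab d = .Hg1 ∨ X.lab d = .Bg1) ∧ (X.lab (X.rot d) = .Hg0 ∨ X.lab (X.rot d) = .Bg0)) ∨
    ((X.lab d = .Hr1 ∨ X.lab d = .Br0) ∧ (X.lab (X.rot d) = .Hr1 ∨ X.lab (X.rot d) = .Br1)) ∨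
    (X.lab d = .Hr2 ∧ (X.lab (X.rot d) = .Br0 ∨ X.lab (X.rot d) = .Sr)) ∨
    ((X.lab d = .Br1 ∨ X.lab d = .Sr) ∧ X.lab (X.rot d) = .Hr2) := by
  have := X.rot_Hg0 d; have := X.rot_Bg0 d; have := X.rot_Bm d; have := X.rot_Hg1 d
  have := X.rot_Bg1 d; have := X.rot_Hr1 d; have := X.rot_Hr2 d; have := X.rot_Br0 d
  have := X.rot_Br1 d; have := X.rot_Sr d; have := X.rot_Sg (d := d)
  cases hd : X.lab d <;> simp_all

theorem unrot_cases {d : D} (h : X.lab d ≠ .out) :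
    (X.lab (X.unrot d) = .Hg0 ∧ X.lab d = .Bm) ∨
    (X.lab (X.unrot d) = .Hg0 ∧ X.lab d = .Sg ∧ X.lab (X.next d) = .Sr) ∨
    (X.lab (X.unrot d) = .Bg0 ∧ X.lab d = .Sg ∧ X.lab (X.next d) = .Sg) ∨
    (X.lab (X.unrot d) = .Bm ∧ X.lab d = .Hg1) ∨
    (X.lab (X.unrot d) = .Sg ∧ X.lab (X.prev (X.unrot d)) = .Sr ∧ X.lab d = .Hg1) ∨
    (X.lab (X.unrot d) = .Sg ∧ X.lab (X.prev (X.unrot d)) = .Sg ∧ X.lab d = .Bg1) ∨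
    ((X.lab (X.unrot d) = .Hg1 ∨ X.lab (X.unrot d) = .Bg1) ∧ (X.lab d = .Hg0 ∨ X.lab d = .Bg0)) ∨
    ((X.lab (X.unrot d) = .Hr1 ∨ X.lab (X.unrot d) = .Br0) ∧ (X.lab d = .Hr1 ∨ X.lab d = .Br1)) ∨
    (X.lab (X.unrot d) = .Hr2 ∧ (X.lab d = .Br0 ∨ X.lab d = .Sr)) ∨
    ((X.lab (X.unrot d) = .Br1 ∨ X.lab (X.unrot d) = .Sr) ∧ X.lab d = .Hr2) := by
  have := X.rot_cases (X.unrot_ne_out h)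
  rwa [X.rot_unrot h] at this

theorem rot_rot_rot_of_tip {d : D} (h : X.lab d = .Sg ∨ X.lab d = .Bm) :
    X.rot (X.rot d) = X.unrot d := by
  have h0 : X.lab d ≠ .out := by rcases h with h | h <;> simp [h]
  have h1 := X.rot_unrot h0
  have h2 := X.rot_green (X.unrot d)
  have h3 := X.unrot_cases h0
  rw [h1] at h2
  apply h2
  rcases h with h | h <;> simp only [h, reduceCtorEq, and_false, false_and, false_or, or_false,
    and_true] at h3 <;> grind

/-- The cyclic sequence of corners at a red vertex, starting at a red tip of a star. -/
theorem red_of_Sr {d : D} (h : X.lab d = .Sr) :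
    X.lab (X.rot d) = .Hr2 ∧ X.lab (X.rot (X.rot d)) = .Br0 ∧
    X.lab (X.rot (X.rot (X.rot d))) = .Br1 ∧
    X.lab (X.rot (X.rot (X.rot (X.rot d)))) = .Hr2 ∧
    X.rot (X.rot (X.rot (X.rot (X.rot d)))) = d := by
  have h5 := X.rot_red d (by simp [h])
  grind [rot_Hr1, rot_Hr2, rot_Br0, rot_Br1, rot_Sr]

/-- The cyclic sequence of corners at a red vertex, starting at a red corner of a boat. -/
theorem red_of_Br0 {d : D} (h : X.lab d = .Br0) :
    (X.lab (X.rot d) = .Br1 ∧ X.lab (X.rot (X.rot d)) = .Hr2 ∧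
      X.lab (X.rot (X.rot (X.rot d))) = .Sr ∧ X.lab (X.rot (X.rot (X.rot (X.rot d)))) = .Hr2 ∧
      X.rot (X.rot (X.rot (X.rot (X.rot d)))) = d) ∨
    (X.lab (X.rot d) = .Hr1 ∧ X.lab (X.rot (X.rot d)) = .Hr1 ∧
      X.lab (X.rot (X.rot (X.rot d))) = .Br1 ∧ X.lab (X.rot (X.rot (X.rot (X.rot d)))) = .Hr2 ∧
      X.rot (X.rot (X.rot (X.rot (X.rot d)))) = d) := by
  have h5 := X.rot_red d (by simp [h])
  grind [rot_Hr1, rot_Hr2, rot_Br0, rot_Br1, rot_Sr]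

theorem red_of_Br1 {d : D} (h : X.lab d = .Br1) :
    (X.lab (X.rot d) = .Hr2 ∧ X.lab (X.rot (X.rot d)) = .Sr ∧
      X.lab (X.rot (X.rot (X.rot d))) = .Hr2 ∧ X.lab (X.rot (X.rot (X.rot (X.rot d)))) = .Br0 ∧
      X.rot (X.rot (X.rot (X.rot (X.rot d)))) = d) ∨
    (X.lab (X.rot d) = .Hr2 ∧ X.lab (X.rot (X.rot d)) = .Br0 ∧
      X.lab (X.rot (X.rot (X.rot d))) = .Hr1 ∧ X.lab (X.rot (X.rot (X.rot (X.rot d)))) = .Hr1 ∧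
      X.rot (X.rot (X.rot (X.rot (X.rot d)))) = d) := by
  have h5 := X.rot_red d (by simp [h])
  grind [rot_Hr1, rot_Hr2, rot_Br0, rot_Br1, rot_Sr]

end StarMap
end StarTileset

/-! ### Composition: corners and labels of the new tiles -/

namespace StarTileset
namespace StarMap
variable {D : Type*} (X : StarMap D)

/-- The successor of a corner in the composed tiling. -/
def compNext (d : D) : D :=
  match X.lab d with
  | .Br0 => X.rot (X.prev d)
  | .Br1 | .Sr => X.rot (X.rot d)
  | _ => if X.lab (X.prev (X.rot d)) = .Br1 then X.prev (X.rot d)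
    else X.rot (X.prev (X.prev (X.rot d)))

/-- The rotation of a corner in the composed tiling. -/
def compRot (d : D) : D :=
  match X.lab d with
  | .Br1 => X.prev (X.prev d)
  | _ => X.next d

/-- The labels of the composed tiling. -/
def compLab (d : D) : Lab :=
  match X.lab d with
  | .Sr => .Hr2
  | .Br0 => if X.lab (X.rot d) = .Br1 then .Hg0 else .Bg0
  | .Br1 => if X.lab (X.unrot d) = .Br0 then .Hg1 else .Bg1
  | .Bm => if X.lab (X.rot (X.prev (X.rot d))) = .Hr1 then .Sg else .Bm
  | .Sg => match X.lab (X.prev d), X.lab (X.next d) with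
    | .Sr, .Sr => .Sr
    | .Sr, _ => .Br0
    | _, .Sr => .Br1
    | _, _ => .Hr1
  | _ => .out

/-- The two corners on both sides of the straight edge that ends at a given tip. -/
theorem tip_edge {d : D} (h : X.lab d = .Sg ∨ X.lab d = .Bm) :
    X.rot (X.next (X.unrot d)) = X.prev (X.rot d) := by
  have h0 : X.lab d ≠ .out := by rcases h with h | h <;> simp [h]
  have h1 := X.rot_rot_rot_of_tip h
  have h2 := X.next_prev (X.rot_ne_out h0)
  have h3 := X.opp_opp (X.prev (X.rot d)) (X.prev_ne_out (X.rot_ne_out h0))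
  rw [h2, h1] at h3
  exact h3

theorem unrot_eq {d : D} (h : X.lab d = .Br1) : X.unrot d = X.rot (X.rot (X.rot (X.rot d))) := by
  have h5 := X.rot_red d (by simp [h])
  have := X.unrot_rot (d := X.rot (X.rot (X.rot (X.rot d))))
    (X.iterate_rot_ne_out 4 (by simp [h] : X.lab d ≠ .out))
  rwa [h5] at this

theorem compLab_Br0 {d : D} (h : X.lab d = .Br0) :
    (X.compLab d = .Hg0 ∧ X.lab (X.rot d) = .Br1) ∨
    (X.compLab d = .Bg0 ∧ X.lab (X.rot d) = .Hr1) := by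
  have := X.red_of_Br0 h
  simp only [compLab, h]
  grind

theorem compLab_Br1 {d : D} (h : X.lab d = .Br1) :
    (X.compLab d = .Hg1 ∧ X.lab (X.unrot d) = .Br0) ∨
    (X.compLab d = .Bg1 ∧ X.lab (X.unrot d) = .Hr1) := by
  have := X.red_of_Br1 h
  simp only [compLab, h, X.unrot_eq h]
  grind

/-- The five corners at the red vertex next to the tip of a boat. -/
theorem compLab_Bm {d : D} (h : X.lab d = .Bm) :
    X.lab (X.unrot d) = .Hg0 ∧ X.lab (X.rot d) = .Hg1 ∧ X.lab (X.prev (X.rot d)) = .Hr1 ∧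
    X.lab (X.next (X.unrot d)) = .Hr1 ∧
    ((X.compLab d = .Sg ∧ X.lab (X.rot (X.prev (X.rot d))) = .Hr1) ∨
    (X.compLab d = .Bm ∧ X.lab (X.rot (X.prev (X.rot d))) = .Br1)) := by
  have h0 : X.lab d ≠ .out := by simp [h]
  have h1 := X.unrot_cases h0
  have h2 := X.rot_Bm d h
  have h3 := X.prev_cases (d := X.rot d) (by simp [h2])
  simp only [h, h2, reduceCtorEq, and_false, false_and, false_or, or_false, and_true] at h1 h3
  have h4 := X.rot_Hr1 _ h3
  have h5 := X.next_Hg0 _ h1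
  simp only [compLab, h]
  grind

/-- Around a red vertex with two adjacent hexagons there are five hexagons, or two. -/
theorem red_of_Hr1_Hr1 {d : D} (h : X.lab d = .Hr1) (h' : X.lab (X.rot d) = .Hr1) :
    (X.lab (X.rot (X.rot d)) = .Hr1 ∧ X.lab (X.rot (X.rot (X.rot d))) = .Hr1 ∧
      X.lab (X.rot (X.rot (X.rot (X.rot d)))) = .Hr1) ∨
    (X.lab (X.rot (X.rot d)) = .Br1 ∧ X.lab (X.rot (X.rot (X.rot d))) = .Hr2 ∧
      X.lab (X.rot (X.rot (X.rot (X.rot d)))) = .Br0) := by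
  have h5 := X.rot_red d (by simp [h])
  grind [rot_Hr1, rot_Hr2, rot_Br0, rot_Br1, rot_Sr]

/-- Crossing a side is an involution, so the corner reached across the side after `d` is also
reached by stepping back from `unrot d`. This rule converts walks around vertices into walks around
tiles. -/
theorem rot_next {d : D} (h : X.lab d ≠ .out) : X.rot (X.next d) = X.prev (X.unrot d) := by
  have h1 := X.opp_opp _ (X.prev_ne_out (X.unrot_ne_out h))
  rwa [X.next_prev (X.unrot_ne_out h), X.rot_unrot h] at h1

theorem rot_eq_prev_unrot_prev {d : D} (h : X.lab d ≠ .out) :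
    X.rot d = X.prev (X.unrot (X.prev d)) := by
  rw [← X.rot_next (X.prev_ne_out h), X.next_prev h]

theorem prev_Hr1 {d : D} (h : X.lab d = .Hr1) : X.lab (X.prev d) = .Hg0 := by
  have := X.prev_cases (d := d) (by simp [h]); simpa [h] using this
theorem prev_Hg1 {d : D} (h : X.lab d = .Hg1) : X.lab (X.prev d) = .Hr1 := by
  have := X.prev_cases (d := d) (by simp [h]); simpa [h] using this
theorem prev_Hr2 {d : D} (h : X.lab d = .Hr2) : X.lab (X.prev d) = .Hg1 := by
  have := X.prev_cases (d := d) (by simp [h]); simpa [h] using this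
theorem prev_Hg0 {d : D} (h : X.lab d = .Hg0) : X.lab (X.prev d) = .Hr2 := by
  have := X.prev_cases (d := d) (by simp [h]); simpa [h] using this
theorem prev_Bg0 {d : D} (h : X.lab d = .Bg0) : X.lab (X.prev d) = .Bg1 := by
  have := X.prev_cases (d := d) (by simp [h]); simpa [h] using this
theorem prev_Br0 {d : D} (h : X.lab d = .Br0) : X.lab (X.prev d) = .Bg0 := by
  have := X.prev_cases (d := d) (by simp [h]); simpa [h] using this
theorem prev_Bm {d : D} (h : X.lab d = .Bm) : X.lab (X.prev d) = .Br0 := by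
  have := X.prev_cases (d := d) (by simp [h]); simpa [h] using this
theorem prev_Br1 {d : D} (h : X.lab d = .Br1) : X.lab (X.prev d) = .Bm := by
  have := X.prev_cases (d := d) (by simp [h]); simpa [h] using this
theorem prev_Bg1 {d : D} (h : X.lab d = .Bg1) : X.lab (X.prev d) = .Br1 := by
  have := X.prev_cases (d := d) (by simp [h]); simpa [h] using this
theorem prev_Sr {d : D} (h : X.lab d = .Sr) : X.lab (X.prev d) = .Sg := by
  have := X.prev_cases (d := d) (by simp [h]); simpa [h] using this
theorem prev_Sg {d : D} (h : X.lab d = .Sg) : X.lab (X.prev d) = .Sr ∨ X.lab (X.prev d) = .Sg := by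
  have := X.prev_cases (d := d) (by simp [h]); simpa [h] using this

theorem prev_prev_prev_H {d : D} (h : X.lab d = .Hr2 ∨ X.lab d = .Hg1) :
    X.prev (X.prev (X.prev d)) = X.next d := by
  have h0 : X.lab d ≠ .out := by rcases h with h | h <;> simp [h]
  have h4 := X.next_H d (by tauto)
  have e1 := X.next_lab_ne_out h0
  have e2 := X.next_lab_ne_out e1
  have e3 := X.next_lab_ne_out e2
  conv_lhs => rw [← h4]
  rw [X.prev_next e3, X.prev_next e2, X.prev_next e1]

theorem prev_prev_prev_B {d : D} (h : X.lab d = .Br1 ∨ X.lab d = .Br0) :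
    X.prev (X.prev (X.prev d)) = X.next (X.next d) := by
  have h0 : X.lab d ≠ .out := by rcases h with h | h <;> simp [h]
  have h4 := X.next_BS d (by tauto)
  have e1 := X.next_lab_ne_out h0
  have e2 := X.next_lab_ne_out e1
  have e3 := X.next_lab_ne_out e2
  have e4 := X.next_lab_ne_out e3
  conv_lhs => rw [← h4]
  rw [X.prev_next e4, X.prev_next e3, X.prev_next e2]

/-- The tip at the far end of the straight edge that follows a red corner. -/
def tipOf (g : D) : D := X.rot (X.prev g)

/-- Tips of stars and boats are parametrized by the corners `Br0` and `Hr1` at the red ends of their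
straight edges. New labels of tips can then be read off at a red vertex. -/
theorem eq_tipOf {d : D} (h : X.lab d = .Sg ∨ X.lab d = .Bm) :
    X.tipOf (X.next (X.unrot d)) = d ∧
    (X.lab (X.next (X.unrot d)) = .Br0 ∨ X.lab (X.next (X.unrot d)) = .Hr1) := by
  have h0 : X.lab d ≠ .out := by rcases h with h | h <;> simp [h]
  refine ⟨?_, ?_⟩
  · rw [tipOf, X.prev_next (X.unrot_ne_out h0), X.rot_unrot h0]
  · have := X.unrot_cases h0
    have := X.next_Hg0 (X.unrot d)
    have := X.next_Bg0 (X.unrot d)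
    grind

theorem tipOf_lab {g : D} (h : X.lab g = .Br0 ∨ X.lab g = .Hr1) :
    X.lab (X.tipOf g) = .Sg ∨ X.lab (X.tipOf g) = .Bm := by
  have h0 : X.lab g ≠ .out := by rcases h with h | h <;> simp [h]
  have := X.prev_cases h0
  have := X.rot_cases (X.prev_ne_out h0)
  rw [tipOf]
  grind

theorem prev_rot_tipOf {g : D} (h : X.lab g = .Br0 ∨ X.lab g = .Hr1) :
    X.prev (X.rot (X.tipOf g)) = X.rot g := by
  have h0 : X.lab g ≠ .out := by rcases h with h | h <;> simp [h]
  rw [← X.tip_edge (X.tipOf_lab h), tipOf, X.unrot_rot (X.prev_ne_out h0), X.next_prev h0]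

/-- In this parametrization the new successor is rotation at the red vertex: a new tile is an old
red vertex. -/
theorem compNext_tipOf {g : D} (h : X.lab g = .Br0 ∨ X.lab g = .Hr1) :
    X.compNext (X.tipOf g) =
      if X.lab (X.rot g) = .Br1 then X.rot g else X.tipOf (X.rot g) := by
  rw [← X.prev_rot_tipOf h]
  rcases X.tipOf_lab h with h1 | h1 <;> simp only [compNext, h1] <;> rfl

theorem compNext_Br0 {d : D} (h : X.lab d = .Br0) : X.compNext d = X.tipOf d := by
  simp only [compNext, h, tipOf]
theorem compNext_Br1 {d : D} (h : X.lab d = .Br1) : X.compNext d = X.rot (X.rot d) := by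
  simp only [compNext, h]
theorem compNext_Sr {d : D} (h : X.lab d = .Sr) : X.compNext d = X.rot (X.rot d) := by
  simp only [compNext, h]

/-- The label in the composed tiling of a tip, read off at the red vertex. -/
theorem tipOf_cases {g : D} (h : X.lab g = .Br0 ∨ X.lab g = .Hr1) :
    (X.lab g = .Br0 ∧ X.lab (X.rot g) = .Br1 ∧ X.compLab (X.tipOf g) = .Hr1 ∧
      X.lab (X.tipOf g) = .Sg) ∨
    (X.lab g = .Br0 ∧ X.lab (X.rot g) = .Hr1 ∧ X.compLab (X.tipOf g) = .Br0 ∧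
      X.lab (X.tipOf g) = .Sg) ∨
    (X.lab g = .Hr1 ∧ X.lab (X.rot g) = .Br1 ∧ X.compLab (X.tipOf g) = .Br1 ∧
      X.lab (X.tipOf g) = .Sg) ∨
    (X.lab g = .Hr1 ∧ X.lab (X.rot g) = .Hr1 ∧ X.lab (X.tipOf g) = .Sg ∧
      X.compLab (X.tipOf g) = .Sr ∧ X.lab (X.prev (X.tipOf g)) = .Sr ∧
      X.lab (X.next (X.tipOf g)) = .Sr) ∨
    (X.lab g = .Hr1 ∧ X.lab (X.rot g) = .Hr1 ∧ X.lab (X.tipOf g) = .Bm ∧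
      X.lab (X.rot (X.rot g)) = .Hr1 ∧ X.compLab (X.tipOf g) = .Sg) ∨
    (X.lab g = .Hr1 ∧ X.lab (X.rot g) = .Hr1 ∧ X.lab (X.tipOf g) = .Bm ∧
      X.lab (X.rot (X.rot g)) = .Br1 ∧ X.compLab (X.tipOf g) = .Bm) := by
  have h0 : X.lab g ≠ .out := by rcases h with h | h <;> simp [h]
  have h1 := X.tipOf_lab h
  have h1' : X.lab (X.tipOf g) ≠ .out := by rcases h1 with h | h <;> simp [h]
  have h2 := X.prev_rot_tipOf h
  have h3 : X.unrot (X.tipOf g) = X.prev g := X.unrot_rot (X.prev_ne_out h0)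
  have h4 := X.unrot_cases h1'
  have h5 := X.rot_cases h1'
  have h6 := X.prev_cases h0
  have h7 := X.prev_cases (X.rot_ne_out h1')
  have h8 := X.rot_cases h0
  have h9 : X.lab (X.rot g) = .Hr1 →
    X.lab (X.rot (X.rot g)) = .Hr1 ∨ X.lab (X.rot (X.rot g)) = .Br1 := X.rot_Hr1 _
  rw [h3] at h4
  rw [h2] at h7
  simp only [compLab, h2]
  generalize X.tipOf g = t at *
  rcases h1 with h1 | h1 <;> simp only [h1] at * <;> grind

end StarMap
end StarTileset

/-! ### Composition: the new labels along a new tile -/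

namespace StarTileset
namespace StarMap
variable {D : Type*} (X : StarMap D)

theorem lab_ne_out_of_eq {d : D} {l : Lab} (h : X.lab d = l) (hl : l ≠ .out) : X.lab d ≠ .out := by
  rwa [h]

/-- The tip that follows a tip in the composed tiling, seen across a hexagon. -/
theorem tipOf_prev_rot {d : D} (h : X.lab d = .Sg ∨ X.lab d = .Bm) (h' : X.lab (X.rot d) = .Hg1) :
    X.lab (X.unrot (X.prev d)) = .Hr2 ∧
    X.tipOf (X.prev (X.rot d)) = X.prev (X.unrot (X.unrot (X.prev d))) := by
  have h0 : X.lab d ≠ .out := by rcases h with h | h <;> simp [h]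
  have e := X.rot_eq_prev_unrot_prev h0
  have hu := X.unrot_ne_out (X.prev_ne_out h0)
  have hk : X.lab (X.unrot (X.prev d)) = .Hr2 := by
    have := X.prev_cases hu
    rw [← e] at this
    simpa [h'] using this
  refine ⟨hk, ?_⟩
  rw [tipOf, e, X.prev_prev_prev_H (.inl hk), X.rot_next hu]

/-- Between two red tips of a star, the adjacent hexagons belong to a vertex with five hexagons. -/
theorem tipOf_of_Sr_Sg_Sr {d : D} (h : X.lab d = .Sg) (hp : X.lab (X.prev d) = .Sr) :
    X.lab (X.tipOf (X.prev (X.rot d))) = .Bm ∧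
    X.unrot (X.unrot (X.unrot (X.prev d))) = X.rot (X.rot (X.prev d)) ∧
    X.next (X.tipOf (X.prev (X.rot d))) = X.unrot (X.unrot (X.prev d)) := by
  have h1 := X.rot_Sg h
  have h2 := X.tipOf_prev_rot (.inl h) (by simpa [hp] using h1)
  have h3 := X.red_of_Sr hp
  have h0 : X.lab (X.prev d) ≠ .out := by simp [hp]
  have e1 := X.rot_ne_out h0
  have e2 := X.rot_ne_out e1
  have e3 := X.rot_ne_out e2
  have e4 := X.rot_ne_out e3
  have u1 : X.unrot (X.prev d) = X.rot (X.rot (X.rot (X.rot (X.prev d)))) := by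
    conv_lhs => rw [← h3.2.2.2.2]
    exact X.unrot_rot e4
  have u2 : X.unrot (X.unrot (X.prev d)) = X.rot (X.rot (X.rot (X.prev d))) := by
    rw [u1, X.unrot_rot e3]
  refine ⟨?_, ?_, ?_⟩
  · rw [h2.2, u2]; exact X.prev_Br1 h3.2.2.1
  · rw [u2, X.unrot_rot e2]
  · rw [h2.2, X.next_prev]
    rw [u2]; exact e3

theorem compLab_Sr {d : D} (h : X.lab d = .Sr) : X.compLab d = .Hr2 := by
  simp only [compLab, h]

theorem compLab_Sg {d : D} (h : X.lab d = .Sg) :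
    (X.lab (X.prev d) = .Sr ∧ X.lab (X.next d) = .Sr ∧ X.compLab d = .Sr) ∨
    (X.lab (X.prev d) = .Sr ∧ X.lab (X.next d) = .Sg ∧ X.compLab d = .Br0) ∨
    (X.lab (X.prev d) = .Sg ∧ X.lab (X.next d) = .Sr ∧ X.compLab d = .Br1) ∨
    (X.lab (X.prev d) = .Sg ∧ X.lab (X.next d) = .Sg ∧ X.compLab d = .Hr1) := by
  have h1 := X.next_Sg d h
  have h2 := X.prev_Sg h
  rcases h1 with h1 | h1 <;> rcases h2 with h2 | h2 <;> simp [compLab, h, h1, h2]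

/-- The tip after `tipOf g` is a boat tip. The last tip before a corner `Br1` is always a star tip,
so a further hexagon must follow. -/
theorem red_of_Sr_Sg_Sr {g : D} (h : X.lab g = .Hr1) (ht : X.lab (X.tipOf g) = .Sg)
    (hp : X.lab (X.prev (X.tipOf g)) = .Sr) :
    X.lab (X.rot g) = .Hr1 ∧ X.lab (X.tipOf (X.rot g)) = .Bm ∧
    X.lab (X.rot (X.rot g)) = .Hr1 := by
  have h1 := X.tipOf_of_Sr_Sg_Sr ht hp
  rw [X.prev_rot_tipOf (.inr h)] at h1
  have h4 := X.rot_Sg ht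
  have h5 : X.lab (X.rot g) = .Hr1 := by
    rw [← X.prev_rot_tipOf (.inr h)]
    exact X.prev_Hg1 (by simpa [hp] using h4)
  have h3 := X.tipOf_cases (.inr h5)
  grind

/-- All the data of the labels of a corner in the composed tiling. -/
theorem compLab_cases (d : D) :
    (X.compLab d = .out) ∨
    (X.lab d = .Sr ∧ X.compLab d = .Hr2) ∨
    (X.lab d = .Br0 ∧ X.compLab d = .Hg0 ∧ X.lab (X.rot d) = .Br1) ∨
    (X.lab d = .Br0 ∧ X.compLab d = .Bg0 ∧ X.lab (X.rot d) = .Hr1) ∨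
    (X.lab d = .Br1 ∧ X.compLab d = .Hg1 ∧ X.lab (X.unrot d) = .Br0) ∨
    (X.lab d = .Br1 ∧ X.compLab d = .Bg1 ∧ X.lab (X.unrot d) = .Hr1) ∨
    (∃ g, X.tipOf g = d ∧ X.lab g = .Br0 ∧ X.lab (X.rot g) = .Br1 ∧ X.lab d = .Sg ∧
      X.compLab d = .Hr1) ∨
    (∃ g, X.tipOf g = d ∧ X.lab g = .Br0 ∧ X.lab (X.rot g) = .Hr1 ∧ X.lab d = .Sg ∧
      X.compLab d = .Br0) ∨
    (∃ g, X.tipOf g = d ∧ X.lab g = .Hr1 ∧ X.lab (X.rot g) = .Br1 ∧ X.lab d = .Sg ∧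
      X.compLab d = .Br1) ∨
    (∃ g, X.tipOf g = d ∧ X.lab g = .Hr1 ∧ X.lab (X.rot g) = .Hr1 ∧ X.lab (X.rot (X.rot g)) = .Hr1 ∧
      X.lab d = .Sg ∧ X.lab (X.prev d) = .Sr ∧ X.lab (X.next d) = .Sr ∧ X.compLab d = .Sr) ∨
    (∃ g, X.tipOf g = d ∧ X.lab g = .Hr1 ∧ X.lab (X.rot g) = .Hr1 ∧ X.lab (X.rot (X.rot g)) = .Hr1 ∧
      X.lab d = .Bm ∧ X.compLab d = .Sg) ∨
    (∃ g, X.tipOf g = d ∧ X.lab g = .Hr1 ∧ X.lab (X.rot g) = .Hr1 ∧ X.lab (X.rot (X.rot g)) = .Br1 ∧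
      X.lab d = .Bm ∧ X.compLab d = .Bm) := by
  by_cases hr : X.lab d = .Sr
  · have := X.compLab_Sr hr; tauto
  by_cases h0 : X.lab d = .Br0
  · have := X.compLab_Br0 h0; tauto
  by_cases h1 : X.lab d = .Br1
  · have := X.compLab_Br1 h1; tauto
  by_cases ht : X.lab d = .Sg ∨ X.lab d = .Bm
  · obtain ⟨hg, hl⟩ := X.eq_tipOf ht
    have hc := X.tipOf_cases hl
    have hS := fun a b c => (X.red_of_Sr_Sg_Sr (g := X.next (X.unrot d)) a b c).2.2
    rw [hg] at hc hS
    generalize X.next (X.unrot d) = g at *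
    rcases hc with hc | hc | hc | hc | hc | hc
    · exact .inr <| .inr <| .inr <| .inr <| .inr <| .inr <| .inl ⟨g, by tauto⟩
    · exact .inr <| .inr <| .inr <| .inr <| .inr <| .inr <| .inr <| .inl ⟨g, by tauto⟩
    · exact .inr <| .inr <| .inr <| .inr <| .inr <| .inr <| .inr <| .inr <| .inl ⟨g, by tauto⟩
    · exact .inr <| .inr <| .inr <| .inr <| .inr <| .inr <| .inr <| .inr <| .inr <| .inl
        ⟨g, by tauto⟩
    · exact .inr <| .inr <| .inr <| .inr <| .inr <| .inr <| .inr <| .inr <| .inr <| .inr <| .inl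
        ⟨g, by tauto⟩
    · exact .inr <| .inr <| .inr <| .inr <| .inr <| .inr <| .inr <| .inr <| .inr <| .inr <| .inr
        ⟨g, by tauto⟩
  · left
    cases h : X.lab d <;> simp_all [compLab]

theorem compNext_lab_of_tip {g : D} (h : X.lab g = .Br0 ∨ X.lab g = .Hr1)
    (h' : X.lab (X.rot g) = .Br1) :
    X.compNext (X.tipOf g) = X.rot g ∧ X.lab (X.unrot (X.rot g)) = X.lab g := by
  have h0 : X.lab g ≠ .out := by rcases h with h | h <;> simp [h]
  rw [X.compNext_tipOf h, if_pos h', X.unrot_rot h0]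
  simp

theorem compNext_tip_of_Hr1 {g : D} (h : X.lab g = .Br0 ∨ X.lab g = .Hr1)
    (h' : X.lab (X.rot g) = .Hr1) : X.compNext (X.tipOf g) = X.tipOf (X.rot g) := by
  rw [X.compNext_tipOf h, if_neg (by simp [h'])]

/-- Each transition is an instance of one of the three cyclic patterns at a red vertex: with a star
tip it spells a new hexagon, with two boats and three hexagons a new boat, with five hexagons a new
star. -/
theorem comp_next_lab (d : D) :
    (X.compLab d = .Hg0 → X.compLab (X.compNext d) = .Hr1) ∧
    (X.compLab d = .Hr1 → X.compLab (X.compNext d) = .Hg1) ∧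
    (X.compLab d = .Hg1 → X.compLab (X.compNext d) = .Hr2) ∧
    (X.compLab d = .Hr2 → X.compLab (X.compNext d) = .Hg0) ∧
    (X.compLab d = .Bg0 → X.compLab (X.compNext d) = .Br0) ∧
    (X.compLab d = .Br0 → X.compLab (X.compNext d) = .Bm) ∧
    (X.compLab d = .Bm → X.compLab (X.compNext d) = .Br1) ∧
    (X.compLab d = .Br1 → X.compLab (X.compNext d) = .Bg1) ∧
    (X.compLab d = .Bg1 → X.compLab (X.compNext d) = .Bg0) ∧
    (X.compLab d = .Sr → X.compLab (X.compNext d) = .Sg) ∧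
    (X.compLab d = .Sg → X.compLab (X.compNext d) = .Sr ∨ X.compLab (X.compNext d) = .Sg) := by
  rcases X.compLab_cases d with h | ⟨hl, h⟩ | ⟨hl, h, h'⟩ | ⟨hl, h, h'⟩ | ⟨hl, h, h'⟩ | ⟨hl, h, h'⟩ |
    ⟨g, rfl, hg, hg', hl, h⟩ | ⟨g, rfl, hg, hg', hl, h⟩ | ⟨g, rfl, hg, hg', hl, h⟩ |
    ⟨g, rfl, hg, hg', hg'', hl, hp, hn, h⟩ | ⟨g, rfl, hg, hg', hg'', hl, h⟩ |
    ⟨g, rfl, hg, hg', hg'', hl, h⟩ <;>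
    simp only [h, reduceCtorEq, false_imp_iff, true_and, and_true, true_imp_iff]
  · rw [X.compNext_Sr hl]
    have h1 := X.red_of_Sr hl
    have := X.compLab_Br0 h1.2.1
    grind
  · rw [X.compNext_Br0 hl]
    have := X.tipOf_cases (.inl hl)
    grind
  · rw [X.compNext_Br0 hl]
    have := X.tipOf_cases (.inl hl)
    grind
  · rw [X.compNext_Br1 hl]
    rw [X.unrot_eq hl] at h'
    have := X.red_of_Br1 hl
    exact X.compLab_Sr (by grind)
  · rw [X.compNext_Br1 hl]
    rw [X.unrot_eq hl] at h'
    have := X.red_of_Br1 hl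
    have := X.compLab_Br0 (d := X.rot (X.rot d)) (by grind)
    grind
  · have h1 := X.compNext_lab_of_tip (.inl hg) hg'
    have h2 := X.compLab_Br1 hg'
    rw [h1.1]; grind
  · rw [X.compNext_tip_of_Hr1 (.inl hg) hg']
    have h1 := X.red_of_Br0 hg
    have h2 := X.tipOf_cases (.inr hg')
    have h3 := X.red_of_Sr_Sg_Sr hg'
    grind
  · have h1 := X.compNext_lab_of_tip (.inr hg) hg'
    have h2 := X.compLab_Br1 hg'
    rw [h1.1]; grind
  · rw [X.compNext_tip_of_Hr1 (.inr hg) hg']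
    have h1 := X.red_of_Hr1_Hr1 hg hg'
    have h2 := X.tipOf_cases (.inr hg')
    have h3 := X.red_of_Sr_Sg_Sr hg hl hp
    grind
  · rw [X.compNext_tip_of_Hr1 (.inr hg) hg']
    have h1 := X.red_of_Hr1_Hr1 hg hg'
    have h2 := X.tipOf_cases (.inr hg')
    grind
  · rw [X.compNext_tip_of_Hr1 (.inr hg) hg']
    have h2 := X.tipOf_cases (.inr hg')
    grind

end StarMap
end StarTileset

/-! ### The composition of a star map is a star map -/

namespace StarTileset
namespace StarMap
variable {D : Type*} (X : StarMap D)

theorem compRot_eq_next {d : D} (h : X.lab d ≠ .Br1) : X.compRot d = X.next d := by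
  cases h' : X.lab d <;> simp_all [compRot]

theorem compRot_Br1 {d : D} (h : X.lab d = .Br1) : X.compRot d = X.prev (X.prev d) := by
  simp only [compRot, h]

/-- The corners of a hexagon of the composed tiling. -/
theorem comp_cycle_H {e : D} (h : X.lab e = .Br0) (h' : X.lab (X.rot e) = .Br1) :
    X.compNext e = X.tipOf e ∧ X.compNext (X.tipOf e) = X.rot e ∧
    X.compNext (X.rot e) = X.rot (X.rot (X.rot e)) ∧
    X.compNext (X.rot (X.rot (X.rot e))) = e := by
  have h1 := X.red_of_Br0 h
  have h2 : X.lab (X.rot (X.rot (X.rot e))) = .Sr := by grind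
  have h3 := X.rot_red e (by simp [h])
  exact ⟨X.compNext_Br0 h, (X.compNext_lab_of_tip (.inl h) h').1, X.compNext_Br1 h',
    (X.compNext_Sr h2).trans h3⟩

/-- The corners of a boat of the composed tiling. -/
theorem comp_cycle_B {e : D} (h : X.lab e = .Br0) (h' : X.lab (X.rot e) = .Hr1) :
    X.compNext e = X.tipOf e ∧ X.compNext (X.tipOf e) = X.tipOf (X.rot e) ∧
    X.compNext (X.tipOf (X.rot e)) = X.tipOf (X.rot (X.rot e)) ∧
    X.compNext (X.tipOf (X.rot (X.rot e))) = X.rot (X.rot (X.rot e)) ∧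
    X.compNext (X.rot (X.rot (X.rot e))) = e := by
  have h1 := X.red_of_Br0 h
  have h2 : X.lab (X.rot (X.rot e)) = .Hr1 := by grind
  have h4 : X.lab (X.rot (X.rot (X.rot e))) = .Br1 := by grind
  have h3 := X.rot_red e (by simp [h])
  exact ⟨X.compNext_Br0 h, X.compNext_tip_of_Hr1 (.inl h) h', X.compNext_tip_of_Hr1 (.inr h') h2,
    (X.compNext_lab_of_tip (.inr h2) h4).1, (X.compNext_Br1 h4).trans h3⟩

theorem comp_next_H {d : D} (h : X.compLab d = .Hg0 ∨ X.compLab d = .Hr1 ∨ X.compLab d = .Hg1 ∨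
    X.compLab d = .Hr2) : X.compNext (X.compNext (X.compNext (X.compNext d))) = d := by
  rcases X.compLab_cases d with hd | ⟨hl, hd⟩ | ⟨hl, hd, h'⟩ | ⟨hl, hd, h'⟩ | ⟨hl, hd, h'⟩ |
    ⟨hl, hd, h'⟩ | ⟨g, rfl, hg, hg', hl, hd⟩ | ⟨g, rfl, hg, hg', hl, hd⟩ |
    ⟨g, rfl, hg, hg', hl, hd⟩ | ⟨g, rfl, hg, hg', hg'', hl, hp, hn, hd⟩ |
    ⟨g, rfl, hg, hg', hg'', hl, hd⟩ | ⟨g, rfl, hg, hg', hg'', hl, hd⟩ <;>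
    simp only [hd, reduceCtorEq, or_self, or_false, or_true] at h
  · have h1 := X.red_of_Sr hl
    have := X.comp_cycle_H h1.2.1 h1.2.2.1
    grind
  · have := X.comp_cycle_H hl h'
    grind
  · have h1 := X.rot_unrot (d := d) (by simp [hl])
    have := X.comp_cycle_H h' (by rw [h1]; exact hl)
    grind
  · have := X.comp_cycle_H hg hg'
    grind

theorem comp_next_BS {d : D} (h : X.compLab d = .Bg0 ∨ X.compLab d = .Br0 ∨ X.compLab d = .Bm ∨
    X.compLab d = .Br1 ∨ X.compLab d = .Bg1 ∨ X.compLab d = .Sr ∨ X.compLab d = .Sg) :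
    X.compNext (X.compNext (X.compNext (X.compNext (X.compNext d)))) = d := by
  rcases X.compLab_cases d with hd | ⟨hl, hd⟩ | ⟨hl, hd, h'⟩ | ⟨hl, hd, h'⟩ | ⟨hl, hd, h'⟩ |
    ⟨hl, hd, h'⟩ | ⟨g, rfl, hg, hg', hl, hd⟩ | ⟨g, rfl, hg, hg', hl, hd⟩ |
    ⟨g, rfl, hg, hg', hl, hd⟩ | ⟨g, rfl, hg, hg', hg'', hl, hp, hn, hd⟩ |
    ⟨g, rfl, hg, hg', hg'', hl, hd⟩ | ⟨g, rfl, hg, hg', hg'', hl, hd⟩ <;>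
    simp only [hd, reduceCtorEq, or_self, or_false, or_true] at h
  · have := X.comp_cycle_B hl h'
    grind
  · rw [X.unrot_eq hl] at h'
    have h1 := X.red_of_Br1 hl
    have := X.comp_cycle_B (e := X.rot (X.rot d)) (by grind) (by grind)
    grind
  · have := X.comp_cycle_B hg hg'
    grind
  -- The third tip of a new boat: three rotations from `g` lead back to the corner `Br0` where the
  -- boat begins.
  · have h5 := X.rot_red g (by simp [hg])
    have h1 : X.lab (X.rot (X.rot (X.rot g))) = .Br0 ∧
        X.lab (X.rot (X.rot (X.rot (X.rot g)))) = .Hr1 := by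
      have := X.red_of_Br1 hg'
      grind
    have := X.comp_cycle_B h1.1 h1.2
    grind
  · have h1 := X.red_of_Hr1_Hr1 hg hg'
    have h5 := X.rot_red g (by simp [hg])
    have := @X.compNext_tip_of_Hr1
    grind
  · have h1 := X.red_of_Hr1_Hr1 hg hg'
    have h5 := X.rot_red g (by simp [hg])
    have := @X.compNext_tip_of_Hr1
    grind
  · have h5 := X.rot_red g (by simp [hg])
    have h1 := X.red_of_Hr1_Hr1 hg hg'
    have := X.comp_cycle_B (e := X.rot (X.rot (X.rot (X.rot g)))) (by grind) (by grind)
    grind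

/-- The new red vertices are the old stars, and the five tips of a star are the five new corners
there. -/
theorem comp_rot_red {d : D} (h : X.compLab d = .Hr1 ∨ X.compLab d = .Hr2 ∨ X.compLab d = .Br0 ∨
    X.compLab d = .Br1 ∨ X.compLab d = .Sr) :
    X.compRot (X.compRot (X.compRot (X.compRot (X.compRot d)))) = d := by
  have hd : X.lab d = .Sr ∨ X.lab d = .Sg := by
    rcases X.compLab_cases d with h | h | h | h | h | h | ⟨g, h⟩ | ⟨g, h⟩ | ⟨g, h⟩ | ⟨g, h⟩ | ⟨g, h⟩ |
      ⟨g, h⟩ <;> grind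
  have h5 := X.next_BS d (by tauto)
  have key : ∀ e, (X.lab e = .Sr ∨ X.lab e = .Sg) →
      X.compRot e = X.next e ∧ (X.lab (X.next e) = .Sr ∨ X.lab (X.next e) = .Sg) := by
    intro e he
    refine ⟨X.compRot_eq_next (by rcases he with h | h <;> simp [h]), ?_⟩
    rcases he with h | h
    · exact .inr (X.next_Sr e h)
    · exact X.next_Sg e h
  grind

/-- The new green vertices are the old boats, whose corners `Br0`, `Bm`, `Br1` are permuted
cyclically by `compRot`. -/
theorem comp_rot_green {d : D} (h : X.compLab d = .Hg0 ∨ X.compLab d = .Hg1 ∨ X.compLab d = .Bg0 ∨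
    X.compLab d = .Bg1 ∨ X.compLab d = .Bm ∨ X.compLab d = .Sg) :
    X.compRot (X.compRot (X.compRot d)) = d := by
  have hd : X.lab d = .Br0 ∨ X.lab d = .Bm ∨ X.lab d = .Br1 := by
    rcases X.compLab_cases d with h | h | h | h | h | h | ⟨g, h⟩ | ⟨g, h⟩ | ⟨g, h⟩ | ⟨g, h⟩ | ⟨g, h⟩ |
      ⟨g, h⟩ <;> grind
  have p1 := X.prev_next (d := d) (by grind)
  have p2 := X.prev_next (X.next_lab_ne_out (d := d) (by grind))
  have p3 := X.next_prev (d := d) (by grind)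
  have p4 := X.next_prev (X.prev_ne_out (d := d) (by grind))
  have := @X.compRot_eq_next
  have := @X.compRot_Br1
  have := X.next_Br0
  have := X.next_Bm
  have := @X.prev_Br1
  have := @X.prev_Bm
  rcases hd with hd | hd | hd <;> grind

/-- The new straight sides cross the bases of old boats, and the new bent sides cross old hexagons.
A side of either kind separates the new tiles around the two red vertices of the boat or hexagon. -/
theorem comp_opp_opp {d : D} (h : X.compLab d ≠ .out) :
    X.compRot (X.compNext (X.compRot (X.compNext d))) = d := by
  have hd : X.lab d = .Br0 ∨ (X.lab d = .Br1 ∨ X.lab d = .Sr) ∨ X.lab d = .Sg ∨ X.lab d = .Bm := by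
    rcases X.compLab_cases d with h | h | h | h | h | h | ⟨g, h⟩ | ⟨g, h⟩ | ⟨g, h⟩ | ⟨g, h⟩ | ⟨g, h⟩ |
      ⟨g, h⟩ <;> grind
  rcases hd with hd | hd | hd
  -- A straight side, seen from the boat: it leads to the star behind the base, and the way back
  -- leaves across the other edge of the base and ends at `Br1` of the same boat.
  · have h0 : X.lab d ≠ .out := by simp [hd]
    have g0 := X.prev_Br0 hd
    have hp := X.prev_ne_out h0
    have ht := X.rot_Bg0 _ g0
    rw [X.compNext_Br0 hd, tipOf, X.compRot_eq_next (d := X.rot (X.prev d)) (by simp [ht.1])]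
    have hr : X.rot (X.next (X.rot (X.prev d))) = X.prev (X.prev d) := by
      rw [X.rot_next (X.rot_ne_out hp), X.unrot_rot hp]
    have hf : X.lab (X.prev (X.prev (X.prev d))) = .Br1 := X.prev_Bg1 (X.prev_Bg0 g0)
    have hc : X.compNext (X.next (X.rot (X.prev d))) = X.prev (X.prev (X.prev d)) := by
      simp only [compNext, ht.2, hr, hf, if_true]
    rw [hc, X.compRot_Br1 hf, X.prev_prev_prev_B (.inr hd),
      X.prev_next (X.next_lab_ne_out h0), X.prev_next h0]
  -- A bent side, seen from the red corner `Hr2` of the hexagon that it crosses; the way back goes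
  -- around the corner `Hr1`.
  · have h0 : X.lab d ≠ .out := by rcases hd with hd | hd <;> simp [hd]
    have hk : X.lab (X.rot d) = .Hr2 := by
      rcases hd with hd | hd
      · exact X.rot_Br1 _ hd
      · exact X.rot_Sr _ hd
    have hc : X.compNext d = X.rot (X.rot d) := by
      rcases hd with hd | hd
      · exact X.compNext_Br1 hd
      · exact X.compNext_Sr hd
    have hm := X.rot_Hr2 _ hk
    have hr1 := X.rot_ne_out h0
    have hr : X.rot (X.next (X.rot (X.rot d))) = X.prev (X.rot d) := by
      rw [X.rot_next (X.rot_ne_out hr1), X.unrot_rot hr1]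
    have hf := X.prev_Hg1 (X.prev_Hr2 hk)
    have hl : X.lab (X.next (X.rot (X.rot d))) = .Bm ∨ X.lab (X.next (X.rot (X.rot d))) = .Sg := by
      rcases hm with hm | hm
      · exact .inl (X.next_Br0 _ hm)
      · exact .inr (X.next_Sr _ hm)
    have hn : X.compNext (X.next (X.rot (X.rot d))) = X.prev d := by
      rcases hl with hl | hl <;>
      simp only [compNext, hl, hr, hf, reduceCtorEq, if_false] <;>
      rw [X.prev_prev_prev_H (.inl hk), X.rot_next hr1, X.unrot_rot h0]
    rw [hc, X.compRot_eq_next (d := X.rot (X.rot d)) (by rcases hm with hm | hm <;> simp [hm]), hn,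
      X.compRot_eq_next, X.next_prev h0]
    rcases hd with hd | hd
    · simp [X.prev_Br1 hd]
    · simp [X.prev_Sr hd]
  · have h0 : X.lab d ≠ .out := by rcases hd with hd | hd <;> simp [hd]
    -- From a tip, the next new side crosses the neighbouring hexagon, or it is a straight side
    -- ending at the neighbouring boat.
    by_cases hg : X.lab (X.rot d) = .Hg1
    · obtain ⟨hk, ht⟩ := X.tipOf_prev_rot hd hg
      have hp := X.prev_ne_out h0
      have hf := X.prev_Hg1 hg
      have hn : X.compNext d = X.prev (X.unrot (X.unrot (X.prev d))) := by
        rw [← ht]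
        rcases hd with hd | hd <;> simp only [compNext, hd, hf, reduceCtorEq, if_false, tipOf]
      have hu := X.unrot_cases (d := X.unrot (X.prev d)) (by simp [hk])
      simp only [hk, reduceCtorEq, and_false, false_and, or_false, false_or, and_true] at hu
      have hu0 := X.unrot_ne_out (X.unrot_ne_out hp)
      rw [hn, X.compRot_eq_next (d := X.prev (X.unrot (X.unrot (X.prev d)))), X.next_prev hu0]
      · have hc : X.compNext (X.unrot (X.unrot (X.prev d))) = X.prev d := by
          rcases hu with hu | hu
          · rw [X.compNext_Br1 hu, X.rot_unrot (X.unrot_ne_out hp), X.rot_unrot hp]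
          · rw [X.compNext_Sr hu, X.rot_unrot (X.unrot_ne_out hp), X.rot_unrot hp]
        rw [hc, X.compRot_eq_next, X.next_prev h0]
        rcases hd with hd | hd
        · rcases X.prev_Sg hd with h | h <;> simp [h]
        · simp [X.prev_Bm hd]
      · rcases hu with hu | hu
        · simp [X.prev_Br1 hu]
        · simp [X.prev_Sr hu]
    · have hS : X.lab d = .Sg := by
        rcases hd with hd | hd
        · exact hd
        · exact absurd (X.rot_Bm _ hd) hg
      have hg1 : X.lab (X.prev d) = .Sg ∧ X.lab (X.rot d) = .Bg1 := by
        have := X.rot_Sg hS; tauto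
      have hf := X.prev_Bg1 hg1.2
      have hr0 := X.rot_ne_out h0
      have hn : X.compNext d = X.prev (X.rot d) := by
        simp only [compNext, hS, hf, if_true]
      have hb := X.prev_Bm (X.prev_Br1 hf)
      rw [hn, X.compRot_Br1 hf, X.compNext_Br0 hb, tipOf, X.prev_prev_prev_B (.inl hf),
        X.next_prev hr0, X.rot_next hr0, X.unrot_rot h0, X.compRot_eq_next (by simp [hg1.1]),
        X.next_prev h0]

/-- The tip after the middle tip of a boat, if the latter lies between two hexagons. -/
theorem comp_Bm_of_Br0 {d : D} (h : X.lab d = .Br0) :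
    X.lab (X.rot (X.next d)) = .Hg1 ∧ X.lab (X.next d) = .Bm ∧
    X.compNext (X.next d) = X.prev (X.rot (X.rot (X.rot d))) ∧
    (∃ g, X.tipOf g = X.next d ∧ X.lab g = .Hr1 ∧ X.lab (X.rot g) = .Hr1 ∧
      X.tipOf (X.rot g) = X.prev (X.rot (X.rot (X.rot d)))) := by
  have h0 : X.lab d ≠ .out := by simp [h]
  have hm := X.next_Br0 d h
  have hg := X.rot_Bm _ hm
  have h1 := X.tipOf_prev_rot (.inr hm) hg
  have hf := X.prev_Hg1 hg
  have h5 := X.rot_red d (by simp [h])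
  have e1 := X.rot_ne_out h0
  have e2 := X.rot_ne_out e1
  have e3 := X.rot_ne_out e2
  have e4 := X.rot_ne_out e3
  have hu : X.unrot (X.unrot d) = X.rot (X.rot (X.rot d)) := by
    conv_lhs => rw [← h5]
    rw [X.unrot_rot e4, X.unrot_rot e3]
  rw [X.prev_next h0, hu] at h1
  have ht := X.eq_tipOf (.inr hm)
  have hf' : X.rot (X.next (X.unrot (X.next d))) = X.prev (X.rot (X.next d)) :=
    X.tip_edge (.inr hm)
  refine ⟨hg, hm, ?_, X.next (X.unrot (X.next d)), ht.1, ?_, by rw [hf', hf], by rw [hf', h1.2]⟩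
  · rw [← h1.2]
    simp only [compNext, hm, hf, reduceCtorEq, if_false, tipOf]
  · have := X.unrot_cases (d := X.next d) (by simp [hm])
    simp only [hm, reduceCtorEq, and_false, false_and, or_false, and_true] at this
    exact X.next_Hg0 _ this

/-- The tips of two boats follow each other at the red vertex of `g`. The last tip before a `Br1` is
a star tip, so this vertex has five hexagons and both tips belong to a new star. -/
theorem comp_rot_Bg0 {d : D} (h : X.lab d = .Br0) (h' : X.lab (X.rot d) = .Hr1) :
    X.compLab (X.next d) = .Sg ∧ X.compLab (X.compNext (X.next d)) = .Sg := by
  obtain ⟨h1, hm, h2, g, hg, hg1, hg2, hg3⟩ := X.comp_Bm_of_Br0 h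
  have h3 : X.lab (X.rot (X.rot (X.rot d))) = .Br1 := by
    have := X.red_of_Br0 h
    grind
  have h4 := X.prev_Br1 h3
  rw [← hg3] at h4 h2
  rw [h2]
  rw [← hg] at hm ⊢
  have c1 := X.tipOf_cases (.inr hg1)
  have c2 := X.tipOf_cases (.inr hg2)
  have c3 := X.red_of_Hr1_Hr1 hg1 hg2
  grind

/-- Here the tip following the boat tip belongs to a star. Both patterns at the red vertex of `g`
remain possible: a new boat, or a new star of which that next tip is red. -/
theorem comp_rot_Hg0 {d : D} (h : X.lab d = .Br0) (h' : X.lab (X.rot d) = .Br1) :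
    X.compLab (X.next d) = .Bm ∨
    (X.compLab (X.next d) = .Sg ∧ X.compLab (X.compNext (X.next d)) = .Sr) := by
  obtain ⟨h1, hm, h2, g, hg, hg1, hg2, hg3⟩ := X.comp_Bm_of_Br0 h
  have h3 : X.lab (X.rot (X.rot (X.rot d))) = .Sr := by
    have := X.red_of_Br0 h
    grind
  have h4 := X.prev_Sr h3
  rw [← hg3] at h4 h2
  rw [h2]
  rw [← hg] at hm ⊢
  have c1 := X.tipOf_cases (.inr hg1)
  have c2 := X.tipOf_cases (.inr hg2)
  have c3 := X.red_of_Hr1_Hr1 hg1 hg2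
  grind

theorem prev_prev_prev_H' {d : D} (h : X.lab d = .Hg0) :
    X.prev (X.prev (X.prev d)) = X.next d := by
  have h0 : X.lab d ≠ .out := by simp [h]
  have h4 := X.next_H d (by tauto)
  have e1 := X.next_lab_ne_out h0
  have e2 := X.next_lab_ne_out e1
  have e3 := X.next_lab_ne_out e2
  conv_lhs => rw [← h4]
  rw [X.prev_next e3, X.prev_next e2, X.prev_next e1]

theorem comp_rot_Bm {d : D} (h : X.lab d = .Bm) (h' : X.compLab d = .Bm) :
    X.compLab (X.next d) = .Hg1 := by
  have hn := X.next_Bm d h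
  have h0 : X.lab d ≠ .out := by simp [h]
  rcases X.compLab_Br1 hn with hc | hc
  · exact hc.1
  -- If the new label of `next d` were `Bg1`, a second boat would face `d` across one hexagon. Its
  -- tip and the tip `d` then have straight edges ending at a common red vertex with three
  -- consecutive corners `Hr1`. Such a vertex has five hexagons, so `d` would be a tip of a new
  -- star.
  exfalso
  have hr := X.rot_next h0
  have h1 := X.red_of_Br1 hn
  rw [X.unrot_eq hn] at hc
  have hb : X.lab (X.rot (X.rot (X.next d))) = .Br0 := by grind
  have hk : X.lab (X.rot (X.next d)) = .Hr2 := by grind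
  obtain ⟨h2, hm, -, -⟩ := X.comp_Bm_of_Br0 hb
  have h3 := X.rot_next (d := X.rot (X.rot (X.next d))) (by simp [hb])
  rw [X.unrot_rot (by simp [hk])] at h3
  replace h3 := h3.trans (congrArg X.prev hr)
  have h4 := X.compLab_Bm hm
  have h5 := X.compLab_Bm h
  have h6 := X.tip_edge (.inr h)
  have h7 := X.tip_edge (.inr hm)
  rw [h3, X.prev_prev_prev_H' h5.1] at h7
  have h8 := X.red_of_Hr1_Hr1 h5.2.2.2.1 (by rw [h6]; exact h5.2.2.1)
  have h9 := X.red_of_Hr1_Hr1 h4.2.2.2.1 (by rw [h7]; exact h5.2.2.2.1)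
  rw [h7, h6] at h9
  rw [h6] at h8
  grind

/-- The tip following `d` in the new tile belongs to a boat having a red vertex in common with the
red tip before `d`. At that vertex `Br1` comes right after `Br0`, the pattern of a new hexagon. -/
theorem comp_rot_next_Sr {d : D} (h : X.lab d = .Sg) (hp : X.lab (X.prev d) = .Sr) :
    X.compLab (X.compRot (X.compNext d)) = .Hg1 := by
  have h1 := X.tipOf_of_Sr_Sg_Sr h hp
  have h2 := X.rot_Sg h
  simp only [hp, reduceCtorEq, false_and, or_false, true_and] at h2
  have h3 : X.compNext d = X.tipOf (X.prev (X.rot d)) := by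
    simp only [compNext, h, X.prev_Hg1 h2, reduceCtorEq, if_false, tipOf]
  rw [h3, X.compRot_eq_next (by simp [h1.1]), h1.2.2]
  have h4 := X.next_Bm _ h1.1
  rw [h1.2.2] at h4
  have h5 := X.red_of_Sr hp
  have h6 := X.compLab_Br1 h4
  rw [h1.2.1, h5.2.1] at h6
  simpa using h6

/-- If the red vertex between the two boats carried a star tip, the next tip would belong to a star.
So it carries three hexagons, the pattern of a new boat. -/
theorem comp_rot_next_Sg {d : D} (h : X.lab d = .Bm) (hn : X.lab (X.compNext d) = .Bm) :
    X.compLab (X.compRot (X.compNext d)) = .Bg1 := by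
  have h0 : X.lab d ≠ .out := by simp [h]
  have hb := X.prev_Bm h
  obtain ⟨-, -, h2, -⟩ := X.comp_Bm_of_Br0 hb
  rw [X.next_prev h0] at h2
  rw [X.compRot_eq_next (by simp [hn])]
  have h3 := X.red_of_Br0 hb
  have e1 := X.rot_ne_out (X.prev_ne_out h0)
  have e2 := X.rot_ne_out e1
  have e3 := X.rot_ne_out e2
  rw [h2, X.next_prev e3]
  rw [h2] at hn
  have h4 : X.lab (X.rot (X.rot (X.rot (X.prev d)))) = .Br1 := by
    rcases h3 with h3 | h3
    · have := X.prev_Sr h3.2.2.1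
      simp [hn] at this
    · exact h3.2.2.1
  have h6 := X.compLab_Br1 h4
  rw [X.unrot_rot e2] at h6
  grind

theorem lab_of_compLab_Hg0 {d : D} (h : X.compLab d = .Hg0) :
    X.lab d = .Br0 ∧ X.lab (X.rot d) = .Br1 := by
  rcases X.compLab_cases d with h' | h' | h' | h' | h' | h' | ⟨g, h'⟩ | ⟨g, h'⟩ | ⟨g, h'⟩ | ⟨g, h'⟩ |
    ⟨g, h'⟩ | ⟨g, h'⟩ <;> grind

theorem lab_of_compLab_Bg0 {d : D} (h : X.compLab d = .Bg0) :
    X.lab d = .Br0 ∧ X.lab (X.rot d) = .Hr1 := by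
  rcases X.compLab_cases d with h' | h' | h' | h' | h' | h' | ⟨g, h'⟩ | ⟨g, h'⟩ | ⟨g, h'⟩ | ⟨g, h'⟩ |
    ⟨g, h'⟩ | ⟨g, h'⟩ <;> grind

theorem lab_of_compLab_Bm {d : D} (h : X.compLab d = .Bm) :
    X.lab d = .Bm := by
  rcases X.compLab_cases d with h' | h' | h' | h' | h' | h' | ⟨g, h'⟩ | ⟨g, h'⟩ | ⟨g, h'⟩ | ⟨g, h'⟩ |
    ⟨g, h'⟩ | ⟨g, h'⟩ <;> grind

theorem lab_of_compLab_Sr {d : D} (h : X.compLab d = .Sr) :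
    X.lab d = .Sg ∧ X.lab (X.prev d) = .Sr ∧ X.lab (X.next d) = .Sr := by
  rcases X.compLab_cases d with h' | h' | h' | h' | h' | h' | ⟨g, h'⟩ | ⟨g, h'⟩ | ⟨g, h'⟩ | ⟨g, h'⟩ |
    ⟨g, h'⟩ | ⟨g, h'⟩ <;> grind

theorem lab_of_compLab_Sg {d : D} (h : X.compLab d = .Sg) :
    X.lab d = .Bm := by
  rcases X.compLab_cases d with h' | h' | h' | h' | h' | h' | ⟨g, h'⟩ | ⟨g, h'⟩ | ⟨g, h'⟩ | ⟨g, h'⟩ |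
    ⟨g, h'⟩ | ⟨g, h'⟩ <;> grind

theorem lab_of_compLab_Br1 {d : D} (h : X.compLab d = .Hg1 ∨ X.compLab d = .Bg1) :
    X.lab d = .Br1 := by
  rcases X.compLab_cases d with h' | h' | h' | h' | h' | h' | ⟨g, h'⟩ | ⟨g, h'⟩ | ⟨g, h'⟩ | ⟨g, h'⟩ |
    ⟨g, h'⟩ | ⟨g, h'⟩ <;> grind

theorem lab_of_compLab_Hr2 {d : D} (h : X.compLab d = .Hr2) :
    X.lab d = .Sr := by
  rcases X.compLab_cases d with h' | h' | h' | h' | h' | h' | ⟨g, h'⟩ | ⟨g, h'⟩ | ⟨g, h'⟩ | ⟨g, h'⟩ |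
    ⟨g, h'⟩ | ⟨g, h'⟩ <;> grind

theorem lab_of_compLab_red {d : D} (h : X.compLab d = .Hr1 ∨ X.compLab d = .Br0 ∨ X.compLab d = .Br1) :
    X.lab d = .Sg := by
  rcases X.compLab_cases d with h' | h' | h' | h' | h' | h' | ⟨g, h'⟩ | ⟨g, h'⟩ | ⟨g, h'⟩ | ⟨g, h'⟩ |
    ⟨g, h'⟩ | ⟨g, h'⟩ <;> grind

theorem comp_rot_S {d : D} (h : X.lab d = .Sg) : X.compRot d = X.next d :=
  X.compRot_eq_next (by simp [h])

/-- Whether the next tip of the star is red decides both labels; this gives the transitions at the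
new red vertices. -/
theorem compLab_Sg' {d : D} (h : X.lab d = .Sg) :
    ((X.compLab d = .Sr ∨ X.compLab d = .Br1) ∧ X.compLab (X.next d) = .Hr2) ∨
    ((X.compLab d = .Br0 ∨ X.compLab d = .Hr1) ∧
      (X.compLab (X.next d) = .Br1 ∨ X.compLab (X.next d) = .Hr1)) := by
  have h1 := X.compLab_Sg h
  rcases X.next_Sg d h with h2 | h2
  · have := X.compLab_Sr h2
    grind
  · have h3 := X.compLab_Sg h2
    rw [X.prev_next (by simp [h])] at h3
    grind

/-- The composition of a star map. -/
def comp : StarMap D where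
  lab := X.compLab
  next := X.compNext
  rot := X.compRot
  next_Hg0 d := (X.comp_next_lab d).1
  next_Hr1 d := (X.comp_next_lab d).2.1
  next_Hg1 d := (X.comp_next_lab d).2.2.1
  next_Hr2 d := (X.comp_next_lab d).2.2.2.1
  next_Bg0 d := (X.comp_next_lab d).2.2.2.2.1
  next_Br0 d := (X.comp_next_lab d).2.2.2.2.2.1
  next_Bm d := (X.comp_next_lab d).2.2.2.2.2.2.1
  next_Br1 d := (X.comp_next_lab d).2.2.2.2.2.2.2.1
  next_Bg1 d := (X.comp_next_lab d).2.2.2.2.2.2.2.2.1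
  next_Sr d := (X.comp_next_lab d).2.2.2.2.2.2.2.2.2.1
  next_Sg d := (X.comp_next_lab d).2.2.2.2.2.2.2.2.2.2
  next_H _ := X.comp_next_H
  next_BS _ := X.comp_next_BS
  rot_Hg0 d h := by
    have hd := X.lab_of_compLab_Hg0 h
    rw [X.compRot_eq_next (by simp [hd.1])]
    exact X.comp_rot_Hg0 hd.1 hd.2
  rot_Bg0 d h := by
    have hd := X.lab_of_compLab_Bg0 h
    rw [X.compRot_eq_next (by simp [hd.1])]
    exact X.comp_rot_Bg0 hd.1 hd.2
  rot_Bm d h := by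
    have hd := X.lab_of_compLab_Bm h
    rw [X.compRot_eq_next (by simp [hd])]
    exact X.comp_rot_Bm hd h
  rot_next_Sr d h := by
    have hd := X.lab_of_compLab_Sr h
    exact X.comp_rot_next_Sr hd.1 hd.2.1
  rot_next_Sg d h h' := X.comp_rot_next_Sg (X.lab_of_compLab_Sg h) (X.lab_of_compLab_Sg h')
  rot_Hg1 d h := by
    have hd := X.lab_of_compLab_Br1 (.inl h)
    rw [X.compRot_Br1 hd]
    have := X.compLab_Br0 (X.prev_Bm (X.prev_Br1 hd))
    tauto
  rot_Bg1 d h := by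
    have hd := X.lab_of_compLab_Br1 (.inr h)
    rw [X.compRot_Br1 hd]
    have := X.compLab_Br0 (X.prev_Bm (X.prev_Br1 hd))
    tauto
  rot_Hr1 d h := by
    have hd := X.lab_of_compLab_red (.inl h)
    have hc := X.comp_rot_S hd
    have := X.compLab_Sg' hd
    grind
  rot_Hr2 d h := by
    have hd := X.lab_of_compLab_Hr2 h
    rw [X.compRot_eq_next (by simp [hd])]
    have := X.compLab_Sg (X.next_Sr d hd)
    rw [X.prev_next (by simp [hd])] at this
    grind
  rot_Br0 d h := by
    have hd := X.lab_of_compLab_red (.inr (.inl h))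
    have hc := X.comp_rot_S hd
    have := X.compLab_Sg' hd
    grind
  rot_Br1 d h := by
    have hd := X.lab_of_compLab_red (.inr (.inr h))
    have hc := X.comp_rot_S hd
    have := X.compLab_Sg' hd
    grind
  rot_Sr d h := by
    have hd := X.lab_of_compLab_Sr h
    rw [X.compRot_eq_next (by simp [hd.1])]
    exact X.compLab_Sr hd.2.2
  rot_green _ := X.comp_rot_green
  rot_red _ := X.comp_rot_red
  opp_opp _ := X.comp_opp_opp

end StarMap
-- Counting up to an error linear in the radius
/-- The number of elements of `A` of height at most `r`. -/
noncomputable def count {D : Type*} (ρ : D → ℝ) (A : Set D) (r : ℝ) : ℝ := ({d ∈ A | ρ d ≤ r}.ncard : ℝ)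

/-- Heights distributed like the distances from a point in a uniformly discrete planar set. -/
structure Planar {D : Type*} (ρ : D → ℝ) : Prop where
  finite : ∀ r, {d | ρ d ≤ r}.Finite
  quadratic : (fun r => count ρ Set.univ r) =O[atTop] fun r : ℝ => r ^ 2
  annulus : ∀ L : ℝ, (fun r => (({d | |ρ d - r| ≤ L}.ncard : ℕ) : ℝ)) =O[atTop] fun r : ℝ => r

variable {D : Type*} {ρ : D → ℝ}

theorem Planar.finite_sep (hρ : Planar ρ) (A : Set D) (r : ℝ) : {d ∈ A | ρ d ≤ r}.Finite :=
  (hρ.finite r).subset fun _ h => h.2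

theorem Planar.count_union (hρ : Planar ρ) {A B : Set D} (h : Disjoint A B) :
    count ρ (A ∪ B) = count ρ A + count ρ B := by
  ext r
  have : {d ∈ A ∪ B | ρ d ≤ r} = {d ∈ A | ρ d ≤ r} ∪ {d ∈ B | ρ d ≤ r} := by
    ext d; simp only [Set.mem_union, Set.mem_ofPred_eq]; tauto
  simp only [count, this, Pi.add_apply]
  rw [Set.ncard_union_eq _ (hρ.finite_sep A r) (hρ.finite_sep B r)]
  · push_cast; rfl
  · exact h.mono (fun _ h => h.1) (fun _ h => h.1)

theorem count_nonneg (A : Set D) (r : ℝ) : 0 ≤ count ρ A r := by unfold count; positivity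

theorem Planar.count_le_univ (hρ : Planar ρ) (A : Set D) (r : ℝ) :
    count ρ A r ≤ count ρ Set.univ r := by
  unfold count
  have h : {d ∈ A | ρ d ≤ r} ⊆ {d ∈ Set.univ | ρ d ≤ r} := fun d h => ⟨trivial, h.2⟩
  exact_mod_cast Set.ncard_le_ncard h (hρ.finite_sep _ r)

theorem Planar.finite_annulus (hρ : Planar ρ) (L r : ℝ) : {d | |ρ d - r| ≤ L}.Finite :=
  (hρ.finite (r + L)).subset fun d (h : |ρ d - r| ≤ L) => by
    have := abs_le.1 h
    simp only [Set.mem_ofPred_eq]; linarith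

/-- A point is lost under `f` only if `f` carries it across the level `r`, and then its own height
is within `L` of `r`. -/
theorem Planar.count_le_of_injOn (hρ : Planar ρ) {A B : Set D} {f : D → D} (hf : Set.MapsTo f A B)
    (hi : Set.InjOn f A) {L : ℝ} (hL : ∀ d ∈ A, |ρ (f d) - ρ d| ≤ L) (r : ℝ) :
    count ρ A r ≤ count ρ B r + (({d | |ρ d - r| ≤ L}.ncard : ℕ) : ℝ) := by
  unfold count
  have h1 : {d ∈ A | ρ d ≤ r} ⊆ {d ∈ A | ρ (f d) ≤ r ∧ ρ d ≤ r} ∪ {d | |ρ d - r| ≤ L} := by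
    rintro d ⟨hd, hr⟩
    by_cases h : ρ (f d) ≤ r
    · exact .inl ⟨hd, h, hr⟩
    · right
      have := abs_le.1 (hL d hd)
      simp only [Set.mem_ofPred_eq, abs_le]
      constructor <;> linarith
  have hfin : {d ∈ A | ρ (f d) ≤ r ∧ ρ d ≤ r}.Finite :=
    (hρ.finite r).subset fun d h => h.2.2
  have h2 := Set.ncard_le_ncard h1 (hfin.union (hρ.finite_annulus L r))
  have h3 := Set.ncard_union_le {d ∈ A | ρ (f d) ≤ r ∧ ρ d ≤ r} {d | |ρ d - r| ≤ L}
  have h4 : {d ∈ A | ρ (f d) ≤ r ∧ ρ d ≤ r}.ncard ≤ {d ∈ B | ρ d ≤ r}.ncard :=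
    Set.ncard_le_ncard_of_injOn f (fun d h => ⟨hf h.1, h.2.1⟩)
      (fun a ha b hb => hi ha.1 hb.1) (hρ.finite_sep B r)
  exact_mod_cast h2.trans (h3.trans (by omega))

/-- A bijection moving heights by a bounded amount, and its inverse, lose at most the points in an
annulus. -/
theorem Planar.count_sub_isBigO (hρ : Planar ρ) {A B : Set D} {f : D → D} (hf : Set.BijOn f A B)
    {L : ℝ} (hL : ∀ d ∈ A, |ρ (f d) - ρ d| ≤ L) :
    (count ρ A - count ρ B) =O[atTop] fun r : ℝ => r := by
  refine Asymptotics.IsBigO.trans (.of_norm_le fun r => ?_) (hρ.annulus L)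
  rcases isEmpty_or_nonempty D with hD | hD
  · simp [count, Set.eq_empty_of_isEmpty]
  have h1 := hρ.count_le_of_injOn hf.mapsTo hf.injOn hL r
  have hinv := hf.invOn_invFunOn
  have h2 := hρ.count_le_of_injOn (f := Function.invFunOn f A) (A := B) (B := A) (L := L)
    (hf.surjOn.mapsTo_invFunOn) (hinv.2.injOn) (fun d hd => by
      have h3 := hL _ (hf.surjOn.mapsTo_invFunOn hd)
      rw [hinv.2 hd] at h3
      rwa [abs_sub_comm]) r
  rw [Pi.sub_apply, Real.norm_eq_abs, abs_le]
  constructor <;> linarith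

/-! ### The contraction of the deviation from the golden ratio -/

namespace StarMap

/-- A map that changes the height by a bounded amount. -/
def BddMove (ρ : D → ℝ) (f : D → D) : Prop := ∃ L, ∀ d, |ρ (f d) - ρ d| ≤ L

theorem BddMove.comp {f g : D → D} (hf : BddMove ρ f) (hg : BddMove ρ g) :
    BddMove ρ (fun d => f (g d)) := by
  obtain ⟨L, hL⟩ := hf
  obtain ⟨M, hM⟩ := hg
  refine ⟨L + M, fun d => ?_⟩
  have := abs_sub_le (ρ (f (g d))) (ρ (g d)) (ρ d)
  linarith [hL (g d), hM d]

theorem BddMove.iterate {f : D → D} (hf : BddMove ρ f) (n : ℕ) : BddMove ρ (f^[n]) := by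
  induction n with
  | zero => exact ⟨0, by simp⟩
  | succ n ih => exact ih.comp hf

theorem BddMove.of_cases {f g : D → D} {p : D → Prop} (hf : BddMove ρ f)
    (hg : BddMove ρ g) {k : D → D} (h₁ : ∀ d, p d → k d = f d) (h₂ : ∀ d, ¬ p d → k d = g d) :
    BddMove ρ k := by
  obtain ⟨L, hL⟩ := hf
  obtain ⟨M, hM⟩ := hg
  refine ⟨max L M, fun d => ?_⟩
  by_cases h : p d
  · rw [h₁ d h]; exact (hL d).trans (le_max_left _ _)
  · rw [h₂ d h]; exact (hM d).trans (le_max_right _ _)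

variable (X : StarMap D)

theorem bddMove_prev (hn : BddMove ρ X.next) : BddMove ρ X.prev := hn.iterate 19

/-- On each of finitely many cases `compNext` is a fixed word in `rot` and `prev`. The bound grows
under iteration, which is harmless because only a fixed number of compositions is used at a time. -/
theorem bddMove_compNext (hn : BddMove ρ X.next) (hr : BddMove ρ X.rot) :
    BddMove ρ X.comp.next := by
  have hp := X.bddMove_prev hn
  have h1 : BddMove ρ fun d => if X.lab (X.prev (X.rot d)) = .Br1 then X.prev (X.rot d)
      else X.rot (X.prev (X.prev (X.rot d))) :=
    BddMove.of_cases (hp.comp hr) (hr.comp (hp.comp (hp.comp hr)))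
      (p := fun d => X.lab (X.prev (X.rot d)) = .Br1) (fun d h => if_pos h) (fun d h => if_neg h)
  have h2 : BddMove ρ fun d => if X.lab d = .Br1 ∨ X.lab d = .Sr then X.rot (X.rot d) else
      if X.lab (X.prev (X.rot d)) = .Br1 then X.prev (X.rot d)
      else X.rot (X.prev (X.prev (X.rot d))) :=
    BddMove.of_cases (hr.comp hr) h1 (p := fun d => X.lab d = .Br1 ∨ X.lab d = .Sr)
      (fun d h => if_pos h) (fun d h => if_neg h)
  refine BddMove.of_cases (hr.comp hp) h2 (p := fun d => X.lab d = .Br0) (fun d h => ?_)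
    fun d h => ?_
  · exact X.compNext_Br0 h
  · change X.compNext d = _
    unfold compNext
    cases hd : X.lab d <;> simp_all

theorem bddMove_compRot (hn : BddMove ρ X.next) : BddMove ρ X.comp.rot := by
  have hp := X.bddMove_prev hn
  exact BddMove.of_cases (hp.comp hp) hn (p := fun d => X.lab d = .Br1)
    (fun d h => X.compRot_Br1 h) (fun d h => X.compRot_eq_next h)

/-- The corners with a given label. -/
def cls (l : Lab) : Set D := {d | X.lab d = l}

theorem disjoint_cls {l l' : Lab} (h : l ≠ l') : Disjoint (X.cls l) (X.cls l') :=
  Set.disjoint_left.2 fun _ h1 h2 => h (h1.symm.trans h2)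

theorem count_next (hρ : Planar ρ) (hn : BddMove ρ X.next) {l l' : Lab} (hl : l ≠ .out)
    (hl' : l' ≠ .out)
    (h : ∀ d, X.lab d = l → X.lab (X.next d) = l') (h' : ∀ d, X.lab d = l' → X.lab (X.prev d) = l) :
    (count ρ (X.cls l) - count ρ (X.cls l')) =O[atTop] fun r : ℝ => r := by
  obtain ⟨L, hL⟩ := hn
  refine hρ.count_sub_isBigO (f := X.next) (L := L) ⟨h, ?_, ?_⟩ fun d _ => hL d
  · intro a ha b hb hab
    rw [← X.prev_next (X.lab_ne_out_of_eq ha hl), hab, X.prev_next (X.lab_ne_out_of_eq hb hl)]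
  · intro d hd
    exact ⟨X.prev d, h' d hd, X.next_prev (X.lab_ne_out_of_eq hd hl')⟩

/-- At a red vertex each `Hr2` is followed by `Br0` or `Sr`, and each of these is preceded by `Hr2`.
The red star tips are the corners `Hr2` of the new hexagons. -/
theorem count_Hr2 (hρ : Planar ρ) (hr : BddMove ρ X.rot) :
    (count ρ (X.cls .Hr2) - (count ρ (X.cls .Br0) + count ρ (X.comp.cls .Hr2)))
      =O[atTop] fun r : ℝ => r := by
  have h1 : X.comp.cls .Hr2 = X.cls .Sr := by
    ext d
    exact ⟨fun h => X.lab_of_compLab_Hr2 h, fun h => X.compLab_Sr h⟩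
  rw [h1, ← hρ.count_union (X.disjoint_cls (by simp))]
  obtain ⟨L, hL⟩ := hr
  refine hρ.count_sub_isBigO (f := X.rot) (L := L) ⟨fun d h => X.rot_Hr2 d h, ?_, ?_⟩ fun d _ => hL d
  · intro a ha b hb hab
    rw [← X.unrot_rot (X.lab_ne_out_of_eq ha (by simp)), hab,
      X.unrot_rot (X.lab_ne_out_of_eq hb (by simp))]
  · rintro d hd
    have h0 : X.lab d ≠ .out := by
      rcases hd with hd | hd <;> exact X.lab_ne_out_of_eq hd (by simp)
    refine ⟨X.unrot d, ?_, X.rot_unrot h0⟩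
    have := X.unrot_cases h0
    rcases hd with hd | hd <;>
    · change X.lab d = _ at hd
      change X.lab (X.unrot d) = _
      simpa [hd] using this

/-- The corner `Br0` of an old boat becomes the first corner of exactly one new boat or new hexagon.
-/
theorem count_Br0 (hρ : Planar ρ) (hn : BddMove ρ X.next) (hr : BddMove ρ X.rot) :
    (count ρ (X.cls .Br0) - (count ρ (X.comp.cls .Br0) + count ρ (X.comp.cls .Hr2)))
      =O[atTop] fun r : ℝ => r := by
  have h1 : X.cls .Br0 = X.comp.cls .Bg0 ∪ X.comp.cls .Hg0 := by
    ext d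
    constructor
    · intro h
      rcases X.compLab_Br0 h with h | h
      · exact .inr h.1
      · exact .inl h.1
    · rintro (h | h)
      · exact (X.lab_of_compLab_Bg0 h).1
      · exact (X.lab_of_compLab_Hg0 h).1
  rw [h1, hρ.count_union (X.comp.disjoint_cls (by simp)), add_sub_add_comm]
  have hc := X.bddMove_compNext hn hr
  refine (X.comp.count_next hρ hc (by simp) (by simp) X.comp.next_Bg0
    (fun _ => X.comp.prev_Br0)).add ?_
  have := X.comp.count_next hρ hc (by simp) (by simp) X.comp.next_Hr2 (fun _ => X.comp.prev_Hg0)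
  exact this.neg_left.congr_left fun r => by simp

/-- The deviation of a star map from the golden ratio. -/
noncomputable def dev (X : StarMap D) (ρ : D → ℝ) : ℝ → ℝ :=
  count ρ (X.cls .Hr2) - φ • count ρ (X.cls .Br0)

theorem dev_comp (hρ : Planar ρ) (hn : BddMove ρ X.next) (hr : BddMove ρ X.rot) :
    (X.dev ρ - (φ⁻¹ ^ 2) • X.comp.dev ρ) =O[atTop] fun r : ℝ => r := by
  have h1 := X.count_Hr2 hρ hr
  have h2 := X.count_Br0 hρ hn hr
  -- From h = b + h' one gets h - φb = (1 - φ)b + h', and b = b' + h' turns this into (2 - φ)h' - (φ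
  -- - 1)b' = φ⁻²(h' - φb').
  refine (h1.add (h2.const_mul_left (1 - φ))).congr_left fun r => ?_
  simp only [dev, Pi.sub_apply, Pi.add_apply, Pi.smul_apply, smul_eq_mul]
  have h3 : φ⁻¹ = φ - 1 := by
    rw [Real.inv_goldenRatio]; have := Real.goldenRatio_add_goldenConj; linarith
  have h4 := Real.goldenRatio_sq
  rw [h3]
  generalize φ = p at *
  generalize count ρ (X.cls .Hr2) r = h
  generalize count ρ (X.cls .Br0) r = b
  generalize count ρ (X.comp.cls .Hr2) r = h'
  generalize count ρ (X.comp.cls .Br0) r = b'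
  linear_combination (h' - b' * (p - 1)) * h4

/-- The bound does not depend on the star map but only on the heights, so it holds for all
compositions at once. -/
theorem dev_le (hρ : Planar ρ) (r : ℝ) : |X.dev ρ r| ≤ 3 * count ρ Set.univ r := by
  have h1 := hρ.count_le_univ (X.cls .Hr2) r
  have h2 := hρ.count_le_univ (X.cls .Br0) r
  have h3 := count_nonneg (ρ := ρ) (X.cls .Hr2) r
  have h4 := count_nonneg (ρ := ρ) (X.cls .Br0) r
  have h5 := Real.goldenRatio_lt_two
  have h6 := Real.goldenRatio_pos
  simp only [dev, Pi.sub_apply, Pi.smul_apply, smul_eq_mul]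
  rw [abs_le]
  constructor <;> nlinarith

theorem dev_iterate (hρ : Planar ρ) (n : ℕ) : ∀ X : StarMap D, BddMove ρ X.next → BddMove ρ X.rot →
    (X.dev ρ - (φ⁻¹ ^ 2) ^ n • (comp^[n] X).dev ρ) =O[atTop] fun r : ℝ => r := by
  induction n with
  | zero => intro X _ _; exact (Asymptotics.isBigO_zero _ _).congr_left fun r => by simp
  | succ n ih =>
    intro X hn hr
    have h1 := X.dev_comp hρ hn hr
    have h2 := ih X.comp (X.bddMove_compNext hn hr) (X.bddMove_compRot hn)
    refine (h1.add (h2.const_mul_left (φ⁻¹ ^ 2))).congr_left fun r => ?_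
    simp only [Pi.sub_apply, Pi.smul_apply, smul_eq_mul, Function.iterate_succ_apply, pow_succ]
    ring

theorem dev_isLittleO (hρ : Planar ρ) (hn : BddMove ρ X.next) (hr : BddMove ρ X.rot) :
    X.dev ρ =o[atTop] fun r : ℝ => r ^ 2 := by
  obtain ⟨C, hC0, hC⟩ := hρ.quadratic.exists_pos
  rw [Asymptotics.isLittleO_iff]
  intro ε hε
  have hφ : φ⁻¹ ^ 2 < 1 := by
    have := Real.one_lt_goldenRatio
    have h1 : φ⁻¹ < 1 := inv_lt_one_of_one_lt₀ this
    have h0 : 0 < φ⁻¹ := by positivity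
    nlinarith
  -- `n` is fixed before `r` tends to infinity, since the constant in the error term of
  -- `dev_iterate` depends on `n`; the bound 3C r² for the iterated deviation does not.
  obtain ⟨n, hn'⟩ := exists_pow_lt_of_lt_one (show 0 < ε / 2 / (3 * C) by positivity) hφ
  have h1 : (X.dev ρ - (φ⁻¹ ^ 2) ^ n • (comp^[n] X).dev ρ) =o[atTop] fun r : ℝ => r ^ 2 := by
    refine (dev_iterate hρ n X hn hr).trans_isLittleO ?_
    simpa using Asymptotics.isLittleO_pow_pow_atTop_of_lt (𝕜 := ℝ) (show 1 < 2 by norm_num)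
  have h2 := Asymptotics.isLittleO_iff.1 h1 (half_pos hε)
  filter_upwards [h2, hC.bound] with r h2 h3
  have h4 := (comp^[n] X).dev_le hρ r
  simp only [Pi.sub_apply, Pi.smul_apply, smul_eq_mul, Real.norm_eq_abs] at h2 h3 ⊢
  rw [abs_of_nonneg (count_nonneg _ _)] at h3
  have h5 : |(φ⁻¹ ^ 2) ^ n * (comp^[n] X).dev ρ r| ≤ ε / 2 * |r ^ 2| := by
    rw [abs_mul, abs_of_nonneg (by positivity)]
    calc (φ⁻¹ ^ 2) ^ n * |(comp^[n] X).dev ρ r| ≤ ε / 2 / (3 * C) * (3 * (C * |r ^ 2|)) := by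
          gcongr
          linarith
      _ = ε / 2 * |r ^ 2| := by field_simp
  have := abs_sub_abs_le_abs_sub (X.dev ρ r) ((φ⁻¹ ^ 2) ^ n * (comp^[n] X).dev ρ r)
  linarith

theorem isLittleO_of_isBigO {f : ℝ → ℝ} (h : f =O[atTop] fun r : ℝ => r) :
    f =o[atTop] fun r : ℝ => r ^ 2 := by
  refine h.trans_isLittleO ?_
  simpa using Asymptotics.isLittleO_pow_pow_atTop_of_lt (𝕜 := ℝ) (show 1 < 2 by norm_num)

/-- Convex sides of tiles are glued to reflex sides. -/
theorem count_sides (hρ : Planar ρ) (hn : BddMove ρ X.next) (hr : BddMove ρ X.rot) :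
    (count ρ (X.cls .Hg1) + count ρ (X.cls .Hr2) + count ρ (X.cls .Bg1) -
      (count ρ (X.cls .Br0) + count ρ (X.cls .Bm) + (count ρ (X.cls .Sr) + count ρ (X.cls .Sg))))
      =O[atTop] fun r : ℝ => r := by
  have d1 : Disjoint (X.cls .Hg1 ∪ X.cls .Hr2) (X.cls .Bg1) :=
    Set.disjoint_union_left.2 ⟨X.disjoint_cls (by simp), X.disjoint_cls (by simp)⟩
  have d2 : Disjoint (X.cls .Br0 ∪ X.cls .Bm) (X.cls .Sr ∪ X.cls .Sg) :=
    Set.disjoint_union_left.2 ⟨Set.disjoint_union_right.2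
      ⟨X.disjoint_cls (by simp), X.disjoint_cls (by simp)⟩, Set.disjoint_union_right.2
      ⟨X.disjoint_cls (by simp), X.disjoint_cls (by simp)⟩⟩
  rw [← hρ.count_union (X.disjoint_cls (by simp)), ← hρ.count_union d1,
    ← hρ.count_union (X.disjoint_cls (by simp)), ← hρ.count_union (X.disjoint_cls (by simp)),
    ← hρ.count_union d2]
  obtain ⟨L, hL⟩ := hr.comp hn
  -- A side is named by the corner where it starts. The sides after `Hg1`, `Hr2`, `Bg1` have a
  -- convex blue corner, those after `Br0`, `Bm` and the star tips a reflex one. The remaining sides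
  -- are straight.
  have key1 : ∀ d ∈ X.cls .Hg1 ∪ X.cls .Hr2 ∪ X.cls .Bg1, X.lab d ≠ .out ∧
      X.rot (X.next d) ∈ X.cls .Br0 ∪ X.cls .Bm ∪ (X.cls .Sr ∪ X.cls .Sg) := by
    rintro d ((h | h) | h) <;> refine ⟨X.lab_ne_out_of_eq h (by simp), ?_⟩
    · rcases X.rot_Hr2 _ (X.next_Hg1 d h) with h | h
      · exact .inl (.inl h)
      · exact .inr (.inl h)
    · rcases X.rot_Hg0 _ (X.next_Hr2 d h) with h | h
      · exact .inl (.inr h)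
      · exact .inr (.inr h.1)
    · exact .inr (.inr (X.rot_Bg0 _ (X.next_Bg1 d h)).1)
  have key2 : ∀ d ∈ X.cls .Br0 ∪ X.cls .Bm ∪ (X.cls .Sr ∪ X.cls .Sg), X.lab d ≠ .out ∧
      X.rot (X.next d) ∈ X.cls .Hg1 ∪ X.cls .Hr2 ∪ X.cls .Bg1 := by
    rintro d ((h | h) | (h | h)) <;> refine ⟨X.lab_ne_out_of_eq h (by simp), ?_⟩
    · exact .inl (.inl (X.rot_Bm _ (X.next_Br0 d h)))
    · exact .inl (.inr (X.rot_Br1 _ (X.next_Bm d h)))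
    · exact .inl (.inl (X.rot_next_Sr d h))
    · rcases X.next_Sg d h with h' | h'
      · exact .inl (.inr (X.rot_Sr _ h'))
      · exact .inr (X.rot_next_Sg d h h')
  refine hρ.count_sub_isBigO (f := fun d => X.rot (X.next d)) (L := L)
    ⟨fun d h => (key1 d h).2, ?_, ?_⟩ fun d _ => hL d
  · intro a ha b hb hab
    dsimp only at hab
    rw [← X.opp_opp a (key1 a ha).1, hab, X.opp_opp b (key1 b hb).1]
  · intro d hd
    exact ⟨X.rot (X.next d), (key2 d hd).2, X.opp_opp d (key2 d hd).1⟩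

theorem inv_goldenRatio_eq : φ⁻¹ = φ - 1 := by
  rw [Real.inv_goldenRatio]; have := Real.goldenRatio_add_goldenConj; linarith

theorem sqrt_five_eq : √5 = 2 * φ - 1 := by
  rw [Real.goldenRatio]; ring

/-! ### Asymptotic numbers of corners per boat -/

/-- `f` is asymptotically `a` times the number of boats. -/
def Share (X : StarMap D) (ρ : D → ℝ) (f : ℝ → ℝ) (a : ℝ) : Prop :=
  (fun r => f r - a * count ρ (X.cls .Br0) r) =o[atTop] fun r : ℝ => r ^ 2

section share
variable {X}

theorem Share.add {f g : ℝ → ℝ} {a b : ℝ} (hf : X.Share ρ f a) (hg : X.Share ρ g b) :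
    X.Share ρ (f + g) (a + b) :=
  (Asymptotics.IsLittleO.add hf hg).congr_left fun r => by simp only [Pi.add_apply]; ring

theorem Share.sub {f g : ℝ → ℝ} {a b : ℝ} (hf : X.Share ρ f a) (hg : X.Share ρ g b) :
    X.Share ρ (f - g) (a - b) :=
  (Asymptotics.IsLittleO.sub hf hg).congr_left fun r => by simp only [Pi.sub_apply]; ring

theorem Share.smul {f : ℝ → ℝ} {a : ℝ} (hf : X.Share ρ f a) (c : ℝ) :
    X.Share ρ (c • f) (c * a) :=
  (Asymptotics.IsLittleO.const_mul_left hf c).congr_left fun r => by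
    simp only [Pi.smul_apply, smul_eq_mul]; ring

theorem Share.congr {f g : ℝ → ℝ} {a : ℝ} (hf : X.Share ρ f a)
    (h : (f - g) =O[atTop] fun r : ℝ => r) : X.Share ρ g a :=
  (Asymptotics.IsLittleO.sub hf (isLittleO_of_isBigO h)).congr_left fun r => by
    simp only [Pi.sub_apply]; ring

end share

theorem share_Br0 : X.Share ρ (count ρ (X.cls .Br0)) 1 :=
  (Asymptotics.isLittleO_zero _ _).congr_left fun r => by simp

theorem share_Hr2 (hρ : Planar ρ) (hn : BddMove ρ X.next) (hr : BddMove ρ X.rot) :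
    X.Share ρ (count ρ (X.cls .Hr2)) φ :=
  (X.dev_isLittleO hρ hn hr).congr_left fun r => by simp [dev]

theorem count_Sr_eq : X.comp.cls .Hr2 = X.cls .Sr := by
  ext d
  exact ⟨fun h => X.lab_of_compLab_Hr2 h, fun h => X.compLab_Sr h⟩

/-- From h' = h - b: the red star tips are the hexagons of the composition. -/
theorem share_Sr (hρ : Planar ρ) (hn : BddMove ρ X.next) (hr : BddMove ρ X.rot) :
    X.Share ρ (count ρ (X.cls .Sr)) (φ - 1) := by
  have h := ((X.share_Hr2 hρ hn hr).sub X.share_Br0).congr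
    (g := count ρ (X.cls .Sr)) ((X.count_Hr2 hρ hr).congr_left fun r => ?_)
  · exact h
  · rw [count_Sr_eq]
    simp only [Pi.sub_apply, Pi.add_apply]
    ring

/-- The corners between two red tips of a star. -/
def betweenRed : Set D := {d | X.lab d = .Sg ∧ X.lab (X.prev d) = .Sr ∧ X.lab (X.next d) = .Sr}

theorem share_betweenRed (hρ : Planar ρ) (hn : BddMove ρ X.next) (hr : BddMove ρ X.rot) :
    X.Share ρ (count ρ X.betweenRed) (2 * φ - 3) := by
  have h1 : X.betweenRed = X.comp.cls .Sr := by
    ext d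
    constructor
    · rintro ⟨h1, h2, h3⟩
      change X.compLab d = _
      have := X.compLab_Sg h1
      simpa [h2, h3] using this
    · exact fun h => X.lab_of_compLab_Sr h
  -- The new boats per old boat: b' = b - h', and 1 - (φ - 1) = 2 - φ.
  have hb : X.Share ρ (count ρ (X.comp.cls .Br0)) (2 - φ) := by
    have h := ((X.share_Br0 (ρ := ρ)).sub (X.share_Sr hρ hn hr)).congr
      (g := count ρ (X.comp.cls .Br0)) ((X.count_Br0 hρ hn hr).congr_left fun r => ?_)
    · convert h using 1; ring
    · rw [count_Sr_eq]
      simp only [Pi.sub_apply, Pi.add_apply]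
      ring
  -- The relation h' = b' + h'' for the composition, where h'' counts its red star tips; thus h''
  -- has share (φ - 1) - (2 - φ).
  have h2 := X.comp.count_Hr2 hρ (X.bddMove_compRot hn)
  rw [count_Sr_eq, count_Sr_eq, ← h1] at h2
  have h := ((X.share_Sr hρ hn hr).sub hb).congr (g := count ρ X.betweenRed)
    (h2.congr_left fun r => ?_)
  · convert h using 1; ring
  · simp only [Pi.sub_apply, Pi.add_apply]
    ring

theorem share_H (hρ : Planar ρ) (hn : BddMove ρ X.next) (hr : BddMove ρ X.rot) :
    X.Share ρ (count ρ (X.cls .Hg0)) φ ∧ X.Share ρ (count ρ (X.cls .Hr1)) φ ∧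
    X.Share ρ (count ρ (X.cls .Hg1)) φ := by
  have h0 := (X.share_Hr2 hρ hn hr).congr
    (X.count_next hρ hn (by simp) (by simp) X.next_Hr2 (fun _ => X.prev_Hg0))
  have h1 := h0.congr (X.count_next hρ hn (by simp) (by simp) X.next_Hg0 (fun _ => X.prev_Hr1))
  exact ⟨h0, h1, h1.congr
    (X.count_next hρ hn (by simp) (by simp) X.next_Hr1 (fun _ => X.prev_Hg1))⟩

theorem share_B (hρ : Planar ρ) (hn : BddMove ρ X.next) :
    X.Share ρ (count ρ (X.cls .Bm)) 1 ∧ X.Share ρ (count ρ (X.cls .Br1)) 1 ∧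
    X.Share ρ (count ρ (X.cls .Bg1)) 1 ∧ X.Share ρ (count ρ (X.cls .Bg0)) 1 := by
  have h0 := (X.share_Br0 (ρ := ρ)).congr
    (X.count_next hρ hn (by simp) (by simp) X.next_Br0 (fun _ => X.prev_Bm))
  have h1 := h0.congr (X.count_next hρ hn (by simp) (by simp) X.next_Bm (fun _ => X.prev_Br1))
  have h2 := h1.congr (X.count_next hρ hn (by simp) (by simp) X.next_Br1 (fun _ => X.prev_Bg1))
  exact ⟨h0, h1, h2, h2.congr
    (X.count_next hρ hn (by simp) (by simp) X.next_Bg1 (fun _ => X.prev_Bg0))⟩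

/-- A hexagon has two convex bent sides, a boat one convex and two reflex, a star five reflex. Hence
the star tips number 2h + b - 2b. -/
theorem share_S (hρ : Planar ρ) (hn : BddMove ρ X.next) (hr : BddMove ρ X.rot) :
    X.Share ρ (count ρ (X.cls .Sr) + count ρ (X.cls .Sg)) (2 * φ - 1) := by
  obtain ⟨-, -, h1⟩ := X.share_H hρ hn hr
  obtain ⟨b1, -, b2, -⟩ := X.share_B hρ hn
  have h := ((((h1.add (X.share_Hr2 hρ hn hr)).add b2).sub X.share_Br0).sub b1).congr
    (g := count ρ (X.cls .Sr) + count ρ (X.cls .Sg))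
    ((X.count_sides hρ hn hr).congr_left fun r => ?_)
  · convert h using 1; ring
  · simp only [Pi.sub_apply, Pi.add_apply]
    ring

end StarMap
-- Sectors: the shape of a polygon near a corner
/-- The unit vector of argument `x`. -/
noncomputable def dir (x : ℝ) : ℂ := Complex.exp (x * Complex.I)

theorem dir_add (x y : ℝ) : dir (x + y) = dir x * dir y := by
  simp only [dir, Complex.ofReal_add, add_mul, Complex.exp_add]

theorem norm_dir (x : ℝ) : ‖dir x‖ = 1 := Complex.norm_exp_ofReal_mul_I x

theorem dir_ne_zero (x : ℝ) : dir x ≠ 0 := Complex.exp_ne_zero _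

theorem dir_add_pi (x : ℝ) : dir (x + Real.pi) = -dir x := by
  rw [dir_add]; simp [dir]

theorem dir_re (x : ℝ) : (dir x).re = Real.cos x := Complex.exp_ofReal_mul_I_re x
theorem dir_im (x : ℝ) : (dir x).im = Real.sin x := Complex.exp_ofReal_mul_I_im x

theorem dir_eq_dir_iff {x y : ℝ} : dir x = dir y ↔ ∃ n : ℤ, x = y + n * (2 * Real.pi) := by
  rw [dir, dir, Complex.exp_eq_exp_iff_exists_int]
  refine exists_congr fun n => ?_
  constructor
  · intro h
    have h2 : ((x : ℂ) - (y + n * (2 * Real.pi))) * Complex.I = 0 := by linear_combination h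
    have h3 : (x : ℂ) - (y + n * (2 * Real.pi)) = 0 := by simpa using h2
    have h4 : (x : ℂ) = ((y + n * (2 * Real.pi) : ℝ) : ℂ) := by push_cast; linear_combination h3
    exact_mod_cast h4
  · rintro rfl; push_cast; ring

theorem dir_add_int (x : ℝ) (n : ℤ) : dir (x + n * (2 * Real.pi)) = dir x :=
  dir_eq_dir_iff.2 ⟨n, rfl⟩

theorem exists_int_mem_Ioc (x : ℝ) : ∃ n : ℤ, -Real.pi < x + n * (2 * Real.pi) ∧
    x + n * (2 * Real.pi) ≤ Real.pi := by
  obtain ⟨n, hn, -⟩ := existsUnique_add_zsmul_mem_Ioc Real.two_pi_pos x (-Real.pi)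
  refine ⟨n, by simpa using hn.1, ?_⟩
  have := hn.2
  rw [zsmul_eq_mul] at this
  linarith

/-- The parallelogram spanned by two vectors. -/
def para (u v : ℂ) : Set ℂ := {z | ∃ s t : ℝ, 0 ≤ s ∧ s ≤ 1 ∧ 0 ≤ t ∧ t ≤ 1 ∧ z = s * u + t * v}

theorem rhombus_eq_para (u v : ℂ) : rhombus u v = para u v := by
  apply Set.Subset.antisymm
  · apply convexHull_min
    · rintro z (rfl | rfl | rfl | rfl)
      · exact ⟨0, 0, by simp⟩
      · exact ⟨1, 0, by simp⟩
      · exact ⟨1, 1, by simp⟩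
      · exact ⟨0, 1, by simp⟩
    · rintro _ ⟨s, t, hs, hs', ht, ht', rfl⟩ _ ⟨s₂, t₂, hs₂, hs₂', ht₂, ht₂', rfl⟩ a b ha hb hab
      refine ⟨a * s + b * s₂, a * t + b * t₂, by positivity, ?_, by positivity, ?_, ?_⟩
      · nlinarith
      · nlinarith
      · simp only [Complex.real_smul]; push_cast; ring
  · rintro _ ⟨s, t, hs, hs', ht, ht', rfl⟩
    have hc := convex_convexHull ℝ ({0, u, u + v, v} : Set ℂ)
    have h0 : (0 : ℂ) ∈ rhombus u v := subset_convexHull ℝ _ (by simp)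
    have h1 : u ∈ rhombus u v := subset_convexHull ℝ _ (by simp)
    have h2 : u + v ∈ rhombus u v := subset_convexHull ℝ _ (by simp)
    have h3 : v ∈ rhombus u v := subset_convexHull ℝ _ (by simp)
    have ha := hc h0 h1 (sub_nonneg.2 hs') hs (by ring)
    have hb := hc h3 h2 (sub_nonneg.2 hs') hs (by ring)
    have h := hc ha hb (sub_nonneg.2 ht') ht (by ring)
    have e : (s * u + t * v : ℂ) = (1 - t) • ((1 - s) • (0 : ℂ) + s • u) +
        t • ((1 - s) • v + s • (u + v)) := by
      simp only [Complex.real_smul]; push_cast; ring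
    rw [e]; exact h

theorem isClosed_rhombus (u v : ℂ) : IsClosed (rhombus u v) :=
  (Set.Finite.isCompact_convexHull (𝕜 := ℝ) (by simp)).isClosed

/-- A parallelogram seen from its second, third or fourth corner. -/
theorem para_eq_image_right (u v : ℂ) : para u v = (u + ·) '' para v (-u) := by
  ext z
  constructor
  · rintro ⟨s, t, hs, hs', ht, ht', rfl⟩
    exact ⟨t * v + (1 - s : ℝ) * (-u), ⟨t, 1 - s, ht, ht', by linarith, by linarith, rfl⟩, by
      push_cast; ring⟩
  · rintro ⟨_, ⟨s, t, hs, hs', ht, ht', rfl⟩, rfl⟩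
    exact ⟨1 - t, s, by linarith, by linarith, hs, hs', by push_cast; ring⟩

theorem para_eq_image_left (u v : ℂ) : para u v = (v + ·) '' para (-v) u := by
  ext z
  constructor
  · rintro ⟨s, t, hs, hs', ht, ht', rfl⟩
    exact ⟨(1 - t : ℝ) * (-v) + s * u, ⟨1 - t, s, by linarith, by linarith, hs, hs', rfl⟩, by
      push_cast; ring⟩
  · rintro ⟨_, ⟨s, t, hs, hs', ht, ht', rfl⟩, rfl⟩
    exact ⟨t, 1 - s, ht, ht', by linarith, by linarith, by push_cast; ring⟩

theorem para_eq_image_opposite (u v : ℂ) : para u v = (u + v + ·) '' para (-u) (-v) := by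
  ext z
  constructor
  · rintro ⟨s, t, hs, hs', ht, ht', rfl⟩
    exact ⟨(1 - s : ℝ) * (-u) + (1 - t : ℝ) * (-v),
      ⟨1 - s, 1 - t, by linarith, by linarith, by linarith, by linarith, rfl⟩, by
      push_cast; ring⟩
  · rintro ⟨_, ⟨s, t, hs, hs', ht, ht', rfl⟩, rfl⟩
    exact ⟨1 - s, 1 - t, by linarith, by linarith, by linarith, by linarith, by push_cast; ring⟩

/-- A point of the cone spanned by two unit vectors has its argument between theirs. -/
theorem arg_of_mem_cone {α δ γ s t ρ : ℝ} (hδ : 0 < δ) (hδ' : δ < Real.pi) (hs : 0 ≤ s) (ht : 0 ≤ t)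
    (hρ : 0 < ρ) (h : s * dir α + t * dir (α + δ) = ρ * dir γ) :
    ∃ n : ℤ, α ≤ γ + n * (2 * Real.pi) ∧ γ + n * (2 * Real.pi) ≤ α + δ := by
  -- After rotation by -α, the imaginary part t sin δ = ρ sin x forces x ≥ 0, and eliminating t
  -- gives s sin δ = ρ sin(δ - x), which forces x ≤ δ.
  obtain ⟨n, hn, hn'⟩ := exists_int_mem_Ioc (γ - α)
  refine ⟨n, ?_⟩
  set x := γ - α + n * (2 * Real.pi) with hx
  have hγ : dir γ = dir α * dir x := by
    rw [← dir_add, hx, ← dir_add_int γ n]; congr 1; ring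
  rw [hγ, dir_add] at h
  have h1 : s + t * dir δ = ρ * dir x := by
    have : dir α * (s + t * dir δ - ρ * dir x) = 0 := by linear_combination h
    rcases mul_eq_zero.1 this with h | h
    · exact absurd h (dir_ne_zero α)
    · linear_combination h
  have him := congrArg Complex.im h1
  have hre := congrArg Complex.re h1
  simp only [Complex.add_im, Complex.ofReal_im, Complex.im_ofReal_mul, zero_add, dir_im,
    Complex.add_re, Complex.ofReal_re, Complex.re_ofReal_mul, dir_re] at him hre
  have hsδ := Real.sin_pos_of_pos_of_lt_pi hδ hδ'
  have hx0 : 0 ≤ x := by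
    by_contra hneg
    have := Real.sin_neg_of_neg_of_neg_pi_lt (not_le.1 hneg) hn
    nlinarith [mul_nonneg ht hsδ.le]
  have hxδ : x ≤ δ := by
    by_contra hgt
    have h3 : 0 < Real.sin (x - δ) := Real.sin_pos_of_pos_of_lt_pi (by linarith) (by linarith)
    rw [Real.sin_sub] at h3
    have h4 : ρ * (Real.sin x * Real.cos δ - Real.cos x * Real.sin δ) = - (s * Real.sin δ) := by
      linear_combination (-Real.cos δ) * him + Real.sin δ * hre
    nlinarith [mul_nonneg hs hsδ.le, mul_pos hρ h3]
  constructor <;> linarith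

theorem dir_eq_cone {α δ x : ℝ} (hx : 0 < x) (hx' : x < δ) (hδ' : δ < Real.pi) :
    ∃ s t : ℝ, 0 < s ∧ 0 < t ∧ dir (α + x) = s * dir α + t * dir (α + δ) := by
  have hsδ := Real.sin_pos_of_pos_of_lt_pi (hx.trans hx') hδ'
  -- The coefficients come from the law of sines.
  refine ⟨Real.sin (δ - x) / Real.sin δ, Real.sin x / Real.sin δ,
    div_pos (Real.sin_pos_of_pos_of_lt_pi (by linarith) (by linarith)) hsδ,
    div_pos (Real.sin_pos_of_pos_of_lt_pi hx (by linarith)) hsδ, ?_⟩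
  rw [dir_add, dir_add]
  have : dir x = (Real.sin (δ - x) / Real.sin δ : ℝ) + (Real.sin x / Real.sin δ : ℝ) * dir δ := by
    apply Complex.ext
    · simp only [Complex.add_re, Complex.ofReal_re, Complex.re_ofReal_mul, dir_re]
      rw [Real.sin_sub]; field_simp; ring
    · simp only [Complex.add_im, Complex.ofReal_im, Complex.im_ofReal_mul, dir_im]
      field_simp; ring
  rw [this]; ring

theorem mem_interior_para {u v : ℂ} (h : u.re * v.im - u.im * v.re ≠ 0) {s t : ℝ} (hs : 0 < s)
    (hs' : s < 1) (ht : 0 < t) (ht' : t < 1) : (s * u + t * v : ℂ) ∈ interior (para u v) := by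
  set c := u.re * v.im - u.im * v.re with hc
  -- `f` and `g` are the coordinates in the basis u, v, by Cramer's rule.
  let f : ℂ → ℝ := fun z => (z.re * v.im - z.im * v.re) / c
  let g : ℂ → ℝ := fun z => (u.re * z.im - u.im * z.re) / c
  have hf : Continuous f := by fun_prop
  have hg : Continuous g := by fun_prop
  have ho : IsOpen (f ⁻¹' Set.Ioo 0 1 ∩ g ⁻¹' Set.Ioo 0 1) :=
    (isOpen_Ioo.preimage hf).inter (isOpen_Ioo.preimage hg)
  refine mem_interior.2 ⟨_, ?_, ho, ?_⟩
  · rintro z ⟨⟨h1, h2⟩, ⟨h3, h4⟩⟩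
    refine ⟨f z, g z, h1.le, h2.le, h3.le, h4.le, ?_⟩
    apply Complex.ext
    · simp only [Complex.add_re, Complex.re_ofReal_mul, f, g]
      field_simp; rw [hc]; ring
    · simp only [Complex.add_im, Complex.im_ofReal_mul, f, g]
      field_simp; rw [hc]; ring
  · have e1 : f (s * u + t * v) = s := by
      simp only [Complex.add_re, Complex.re_ofReal_mul, f, Complex.add_im, Complex.im_ofReal_mul]
      field_simp; rw [hc]; ring
    have e2 : g (s * u + t * v) = t := by
      simp only [Complex.add_re, Complex.re_ofReal_mul, g, Complex.add_im, Complex.im_ofReal_mul]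
      field_simp; rw [hc]; ring
    exact ⟨by rw [Set.mem_preimage, e1]; exact ⟨hs, hs'⟩, by rw [Set.mem_preimage, e2]; exact ⟨ht, ht'⟩⟩

/-- Near `p`, the set `R` is the sector from the argument `α` to the argument `α + Θ`. -/
structure IsCorner (R : Set ℂ) (p : ℂ) (α Θ : ℝ) : Prop where
  inside : ∃ N : Set ℝ, N.Countable ∧ ∀ x ∈ Set.Ioo 0 Θ \ N,
    ∀ᶠ t : ℝ in 𝓝[>] 0, p + t * dir (α + x) ∈ interior R
  outside : ∀ γ : ℝ, (∃ᶠ t : ℝ in 𝓝[>] 0, p + t * dir γ ∈ R) →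
    ∃ n : ℤ, α ≤ γ + n * (2 * Real.pi) ∧ γ + n * (2 * Real.pi) ≤ α + Θ

theorem isCorner_para (p : ℂ) {α δ : ℝ} (hδ : 0 < δ) (hδ' : δ < Real.pi) :
    IsCorner ((p + ·) '' para (dir α) (dir (α + δ))) p α δ where
  inside := by
    refine ⟨∅, Set.countable_empty, fun x hx => ?_⟩
    obtain ⟨s, t, hs, ht, h⟩ := dir_eq_cone (α := α) hx.1.1 hx.1.2 hδ'
    have h1 : ∀ᶠ r : ℝ in 𝓝[>] 0, 0 < r := self_mem_nhdsWithin
    have h2 : ∀ᶠ r : ℝ in 𝓝[>] 0, r * s < 1 := by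
      refine nhdsWithin_le_nhds (Continuous.tendsto' (by fun_prop) 0 0 (by simp) |>.eventually_lt_const
        zero_lt_one)
    have h3 : ∀ᶠ r : ℝ in 𝓝[>] 0, r * t < 1 := by
      refine nhdsWithin_le_nhds (Continuous.tendsto' (by fun_prop) 0 0 (by simp) |>.eventually_lt_const
        zero_lt_one)
    filter_upwards [h1, h2, h3] with r h1 h2 h3
    have hd : (dir α).re * (dir (α + δ)).im - (dir α).im * (dir (α + δ)).re ≠ 0 := by
      simp only [dir_re, dir_im]
      have : Real.cos α * Real.sin (α + δ) - Real.sin α * Real.cos (α + δ) = Real.sin δ := by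
        rw [mul_comm (Real.cos α), mul_comm (Real.sin α), ← Real.sin_sub]; congr 1; ring
      rw [this]
      exact (Real.sin_pos_of_pos_of_lt_pi hδ hδ').ne'
    have := mem_interior_para hd (mul_pos h1 hs) h2 (mul_pos h1 ht) h3
    have himg : interior ((p + ·) '' para (dir α) (dir (α + δ))) =
        (p + ·) '' interior (para (dir α) (dir (α + δ))) :=
      ((Homeomorph.addLeft p).image_interior _).symm
    rw [himg]
    refine ⟨_, this, ?_⟩
    rw [h]; push_cast; ring
  outside := by
    intro γ h
    obtain ⟨r, ⟨_, ⟨s, t, hs, -, ht, -, rfl⟩, h⟩, hr⟩ :=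
      (h.and_eventually (self_mem_nhdsWithin : ∀ᶠ r : ℝ in 𝓝[>] 0, 0 < r)).exists
    exact arg_of_mem_cone hδ hδ' hs ht hr (add_left_cancel h)

theorem IsCorner.union {R R' : Set ℂ} {p : ℂ} {α Θ Θ' : ℝ} (hΘ : 0 ≤ Θ) (hΘ' : 0 ≤ Θ')
    (h : IsCorner R p α Θ) (h' : IsCorner R' p (α + Θ) Θ') :
    IsCorner (R ∪ R') p α (Θ + Θ') where
  inside := by
    obtain ⟨N, hN, h1⟩ := h.inside
    obtain ⟨N', hN', h2⟩ := h'.inside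
    -- The common ray of the two sectors joins the exceptional set, since points on it need not be
    -- interior to either piece. A countable exceptional set is enough for later use, as some
    -- direction always avoids it.
    refine ⟨N ∪ ((Θ + ·) '' N') ∪ {Θ}, (hN.union (hN'.image _)).union (Set.countable_singleton _),
      fun x hx => ?_⟩
    obtain ⟨⟨hx0, hx1⟩, hx2⟩ := hx
    simp only [Set.mem_union, Set.mem_image, Set.mem_singleton_iff, not_or] at hx2
    rcases lt_trichotomy x Θ with hlt | heq | hgt
    · filter_upwards [h1 x ⟨⟨hx0, hlt⟩, hx2.1.1⟩] with t ht
      exact interior_mono Set.subset_union_left ht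
    · exact absurd heq hx2.2
    · have := h2 (x - Θ) ⟨⟨by linarith, by linarith⟩, fun hm => hx2.1.2 ⟨x - Θ, hm, by ring⟩⟩
      filter_upwards [this] with t ht
      have e : α + Θ + (x - Θ) = α + x := by ring
      rw [e] at ht
      exact interior_mono Set.subset_union_right ht
  outside := by
    intro γ hγ
    rcases Filter.frequently_or_distrib.1 hγ with hγ | hγ
    · obtain ⟨n, h1, h2⟩ := h.outside γ hγ
      exact ⟨n, h1, by linarith⟩
    · obtain ⟨n, h1, h2⟩ := h'.outside γ hγ
      exact ⟨n, by linarith, by linarith⟩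

theorem tendsto_ray (p w : ℂ) : Tendsto (fun t : ℝ => p + t * w) (𝓝[>] 0) (𝓝 p) :=
  (Continuous.tendsto' (by fun_prop) 0 p (by simp)).mono_left nhdsWithin_le_nhds

/-- A closed set that misses `p` has no influence near `p`. -/
theorem IsCorner.union_of_notMem {R K : Set ℂ} {p : ℂ} {α Θ : ℝ} (h : IsCorner R p α Θ)
    (hK : IsClosed K) (hp : p ∉ K) : IsCorner (R ∪ K) p α Θ where
  inside := by
    obtain ⟨N, hN, h1⟩ := h.inside
    refine ⟨N, hN, fun x hx => ?_⟩
    filter_upwards [h1 x hx] with t ht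
    exact interior_mono Set.subset_union_left ht
  outside := by
    intro γ hγ
    rcases Filter.frequently_or_distrib.1 hγ with hγ | hγ
    · exact h.outside γ hγ
    · have : ∀ᶠ t : ℝ in 𝓝[>] 0, p + t * dir γ ∈ Kᶜ :=
        tendsto_ray p (dir γ) (hK.isOpen_compl.mem_nhds hp)
      exact absurd this hγ

/-- Corners are preserved by direct isometries. -/
theorem IsCorner.image {R : Set ℂ} {p : ℂ} {α Θ : ℝ} (h : IsCorner R p α Θ) (θ : ℝ) (b : ℂ) :
    IsCorner ((fun z => dir θ * z + b) '' R) (dir θ * p + b) (θ + α) Θ where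
  inside := by
    obtain ⟨N, hN, h1⟩ := h.inside
    refine ⟨N, hN, fun x hx => ?_⟩
    filter_upwards [h1 x hx] with t ht
    have himg : interior ((fun z => dir θ * z + b) '' R) = (fun z => dir θ * z + b) '' interior R :=
      (((Homeomorph.mulLeft₀ (dir θ) (dir_ne_zero θ)).trans
        (Homeomorph.addRight b)).image_interior R).symm
    rw [himg]
    refine ⟨_, ht, ?_⟩
    rw [add_assoc θ, dir_add θ]; ring
  outside := by
    intro γ hγ
    obtain ⟨n, h1, h2⟩ := h.outside (γ - θ) (hγ.mono fun t ht => by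
      obtain ⟨z, hz, h⟩ := ht
      have e : dir γ = dir θ * dir (γ - θ) := by rw [← dir_add]; congr 1; ring
      have h' : dir θ * (z - (p + t * dir (γ - θ))) = 0 := by
        dsimp only at h
        rw [e] at h; linear_combination h
      rcases mul_eq_zero.1 h' with h' | h'
      · exact absurd h' (dir_ne_zero θ)
      · rwa [← sub_eq_zero.1 h'])
    exact ⟨n, by linarith, by linarith⟩

theorem ζ_eq_dir (k : ℕ) : ζ k = dir (2 * k * (Real.pi / 5)) := by
  rw [ζ, dir]; congr 1; push_cast; ring

theorem ζ_add_five (k : ℕ) : ζ (k + 5) = ζ k := by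
  rw [ζ_eq_dir, ζ_eq_dir, dir_eq_dir_iff]
  exact ⟨1, by push_cast; ring⟩

theorem ζ_five : ζ 5 = ζ 0 := ζ_add_five 0

theorem dir_eq_dir_unit {a b : ℤ} :
    dir (a * (Real.pi / 5)) = dir (b * (Real.pi / 5)) ↔ ∃ n : ℤ, a = b + 10 * n := by
  rw [dir_eq_dir_iff]
  refine exists_congr fun n => ?_
  have hpi := Real.pi_pos
  constructor
  · intro h
    have : (a : ℝ) = b + 10 * n := by field_simp at h; linarith
    exact_mod_cast this
  · rintro rfl
    push_cast; ring

/-! ### Prototiles as fans of rhombuses around the origin -/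

namespace Proto

/-- The number of fifths of a turn from the `k`-th ray of a prototile to its successor, or `0` if
there is no `k`-th ray. -/
def gap : Proto → Fin 5 → ℕ
  | .H => ![1, 2, 0, 2, 0]
  | .B => ![1, 1, 1, 2, 0]
  | .S0 | .S1 | .S2 => ![1, 1, 1, 1, 1]

/-- The ray that precedes the `k`-th ray of a prototile. -/
def back : Proto → Fin 5 → Fin 5
  | .H => ![3, 0, 0, 1, 0]
  | .B => ![3, 0, 1, 2, 0]
  | .S0 | .S1 | .S2 => ![4, 0, 1, 2, 3]

/-- The ray that follows the `k`-th ray of a prototile. -/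
def forth : Proto → Fin 5 → Fin 5
  | .H => ![1, 3, 0, 0, 0]
  | .B => ![1, 2, 3, 0, 0]
  | .S0 | .S1 | .S2 => ![1, 2, 3, 4, 0]

theorem gap_le_two (P : Proto) (k : Fin 5) : P.gap k ≤ 2 := by
  cases P <;> revert k <;> decide

theorem back_spec (P : Proto) (k : Fin 5) (h : P.gap k ≠ 0) : P.gap (P.back k) ≠ 0 ∧
    ((P.back k : ℕ) + P.gap (P.back k) = k ∨ (P.back k : ℕ) + P.gap (P.back k) = k + 5) ∧
    P.gap k + P.gap (P.back k) ≤ 4 ∧ P.back k ≠ k := by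
  cases P <;> revert k <;> decide

theorem forth_spec (P : Proto) (k : Fin 5) (h : P.gap k ≠ 0) : P.gap (P.forth k) ≠ 0 ∧
    ((P.forth k : ℕ) = k + P.gap k ∨ (P.forth k : ℕ) + 5 = k + P.gap k) ∧
    P.back (P.forth k) = k := by
  cases P <;> revert k <;> decide

/-- The rhombus of a prototile that follows the `k`-th ray. -/
noncomputable def rhomb (P : Proto) (k : Fin 5) : Set ℂ := rhombus (ζ k) (ζ (k + P.gap k))

theorem region_eq (P : Proto) : P.region = ⋃ k ∈ {k | P.gap k ≠ 0}, P.rhomb k := by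
  ext z
  simp only [Set.mem_iUnion, Set.mem_ofPred_eq, exists_prop, Fin.exists_fin_succ]
  cases P <;> simp [region, gap, rhomb, fat, thin, or_assoc]

/-- The position of a corner of a prototile: the end of a ray, or the far vertex of a rhombus. -/
noncomputable def vtx (P : Proto) : Fin 5 × Bool → ℂ
  | (k, false) => ζ k
  | (k, true) => ζ k + ζ (k + P.gap k)

/-- The argument, in tenths of a turn, of the position of a corner of a prototile. -/
def polar (P : Proto) : Fin 5 × Bool → ℕ
  | (k, false) => 2 * k
  | (k, true) => 2 * k + P.gap k

/-- The argument, in tenths of a turn, of the side that follows a corner of a prototile. -/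
def start (P : Proto) : Fin 5 × Bool → ℕ
  | (k, false) => 2 * (k + P.gap k)
  | (k, true) => 2 * k + 5

/-- The angle of a prototile at a corner, in fifths of a turn. -/
def size (P : Proto) : Fin 5 × Bool → ℕ
  | (k, false) => 5 - P.gap k - P.gap (P.back k)
  | (k, true) => P.gap k

/-- The colour of a corner of a prototile. -/
def colour : Proto → Fin 5 × Bool → Colour
  | .H, (k, false) => ![.green, .green, .blue, .red, .blue] k
  | .H, (k, true) => ![.red, .blue, .blue, .blue, .blue] k
  | .B, (k, false) => ![.green, .blue, .blue, .green, .blue] k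
  | .B, (k, true) => ![.red, .green, .red, .blue, .blue] k
  | .S0, (_, false) | .S1, (_, false) | .S2, (_, false) => .blue
  | .S0, (_, true) => .green
  | .S1, (k, true) => ![.red, .green, .green, .green, .green] k
  | .S2, (k, true) => ![.red, .green, .red, .green, .green] k

theorem mem_vertices_iff (P : Proto) (p : ℂ) (c : Colour) :
    (p, c) ∈ P.vertices ↔ ∃ x : Fin 5 × Bool, P.gap x.1 ≠ 0 ∧ p = P.vtx x ∧ c = P.colour x := by
  have key : ∀ Q : Fin 5 × Bool → Prop, (∃ x, Q x) ↔
      (Q (0, false) ∨ Q (0, true) ∨ Q (1, false) ∨ Q (1, true) ∨ Q (2, false) ∨ Q (2, true) ∨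
      Q (3, false) ∨ Q (3, true) ∨ Q (4, false) ∨ Q (4, true)) := by
    intro Q
    simp [Prod.exists, Fin.exists_fin_succ, Bool.exists_bool, or_assoc]
  rw [key]
  cases P <;> simp [vertices, starVertices, gap, vtx, colour, ζ_five]

/-- The far vertex of a rhombus lies on its bisector, at distance 2 cos(gap · π/5), which is
positive as the gap is at most 2. Arguments in tenths of a turn reduce incidences to finite
arithmetic modulo 10. -/
theorem vtx_polar (P : Proto) (x : Fin 5 × Bool) : ∃ ρ : ℝ, 0 < ρ ∧
    P.vtx x = ρ * dir (P.polar x * (Real.pi / 5)) := by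
  rcases x with ⟨k, _ | _⟩
  · exact ⟨1, one_pos, by simp only [vtx, polar, ζ_eq_dir]; push_cast; ring⟩
  · have hg := P.gap_le_two k
    refine ⟨2 * Real.cos (P.gap k * (Real.pi / 5)), ?_, ?_⟩
    · have hg' : (P.gap k : ℝ) ≤ 2 := by exact_mod_cast hg
      have := Real.pi_pos
      have : 0 < Real.cos (P.gap k * (Real.pi / 5)) :=
        Real.cos_pos_of_mem_Ioo ⟨by nlinarith [(P.gap k).cast_nonneg (α := ℝ)], by nlinarith⟩
      positivity
    · simp only [vtx, polar, ζ_eq_dir]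
      set y := (P.gap k : ℝ) * (Real.pi / 5)
      have e1 : (2 * ((k : ℕ) : ℝ) * (Real.pi / 5)) = (2 * k + P.gap k : ℕ) * (Real.pi / 5) + (-y) := by
        simp only [y]; push_cast; ring
      have e2 : (2 * ((k + P.gap k : ℕ) : ℝ) * (Real.pi / 5)) =
          (2 * k + P.gap k : ℕ) * (Real.pi / 5) + y := by simp only [y]; push_cast; ring
      rw [e1, e2, dir_add, dir_add]
      have : dir (-y) + dir y = (2 * Real.cos y : ℝ) := by
        apply Complex.ext
        · rw [Complex.add_re, dir_re, dir_re, Complex.ofReal_re, Real.cos_neg]; ring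
        · rw [Complex.add_im, dir_im, dir_im, Complex.ofReal_im, Real.sin_neg]; ring
      rw [← mul_add, this, mul_comm]

theorem polar_inj (P : Proto) {x y : Fin 5 × Bool} (hx : P.gap x.1 ≠ 0) (hy : P.gap y.1 ≠ 0)
    {n : ℤ} (h : (P.polar x : ℤ) = P.polar y + 10 * n) : x = y := by
  have h10 : P.polar x % 10 = P.polar y % 10 := by omega
  revert hx hy h10
  clear h
  cases P <;> revert x y <;> decide

theorem vtx_inj (P : Proto) {x y : Fin 5 × Bool} (hx : P.gap x.1 ≠ 0) (hy : P.gap y.1 ≠ 0)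
    (h : P.vtx x = P.vtx y) : x = y := by
  obtain ⟨ρ, hρ, h1⟩ := P.vtx_polar x
  obtain ⟨ρ', hρ', h2⟩ := P.vtx_polar y
  rw [h1, h2] at h
  have hn := congrArg norm h
  simp only [norm_mul, norm_dir, Complex.norm_real, Real.norm_eq_abs, abs_of_pos hρ,
    abs_of_pos hρ', mul_one] at hn
  subst hn
  have h3 := mul_left_cancel₀ (by exact_mod_cast hρ.ne' : (ρ : ℂ) ≠ 0) h
  obtain ⟨n, hn⟩ := (dir_eq_dir_unit (a := P.polar x) (b := P.polar y)).1 (by exact_mod_cast h3)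
  exact P.polar_inj hx hy hn

theorem polar_of_mem_rhomb (P : Proto) {k : Fin 5} (hk : P.gap k ≠ 0) {x : Fin 5 × Bool}
    (h : P.vtx x ∈ P.rhomb k) : ∃ n : ℤ, 2 * (k : ℤ) ≤ P.polar x + 10 * n ∧
      P.polar x + 10 * n ≤ 2 * k + 2 * (P.gap k : ℤ) := by
  obtain ⟨ρ, hρ, h1⟩ := P.vtx_polar x
  rw [rhomb, rhombus_eq_para] at h
  obtain ⟨s, t, hs, -, ht, -, h⟩ := h
  have hg : (P.gap k : ℝ) ≤ 2 := by exact_mod_cast P.gap_le_two k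
  have hg' : (1 : ℝ) ≤ P.gap k := by exact_mod_cast Nat.one_le_iff_ne_zero.2 hk
  have hpi := Real.pi_pos
  have e : (2 * ((k + P.gap k : ℕ) : ℝ) * (Real.pi / 5)) =
    2 * k * (Real.pi / 5) + 2 * P.gap k * (Real.pi / 5) := by push_cast; ring
  rw [ζ_eq_dir, ζ_eq_dir, h1, e] at h
  obtain ⟨n, h2, h3⟩ := arg_of_mem_cone (by positivity) (by nlinarith) hs ht hρ h.symm
  refine ⟨n, ?_, ?_⟩
  · have : (2 * k : ℝ) ≤ P.polar x + 10 * n := by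
      have h4 : 2 * (k : ℝ) * (Real.pi / 5) ≤ (P.polar x + 10 * n) * (Real.pi / 5) := by linarith
      exact le_of_mul_le_mul_right h4 (by positivity)
    exact_mod_cast this
  · have : (P.polar x + 10 * n : ℝ) ≤ 2 * k + 2 * P.gap k := by
      have h4 : (P.polar x + 10 * n) * (Real.pi / 5) ≤
        (2 * (k : ℝ) + 2 * P.gap k) * (Real.pi / 5) := by linarith
      exact le_of_mul_le_mul_right h4 (by positivity)
    exact_mod_cast this

/-- The argument alone shows that a vertex lies only in the rhombuses of which it is a corner. -/
theorem polar_spec (P : Proto) {k : Fin 5} (hk : P.gap k ≠ 0) {x : Fin 5 × Bool}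
    (hx : P.gap x.1 ≠ 0) {n : ℤ} (h : 2 * (k : ℤ) ≤ P.polar x + 10 * n)
    (h' : P.polar x + 10 * n ≤ 2 * k + 2 * (P.gap k : ℤ)) :
    k = x.1 ∨ (x.2 = false ∧ k = P.back x.1) := by
  have h1 : (P.polar x + 20 - 2 * k) % 10 ≤ 2 * P.gap k := by
    have := P.gap_le_two k
    have := k.2
    omega
  clear h h'
  revert hk hx h1
  cases P <;> revert k x <;> decide

theorem isClosed_biUnion_rhomb (P : Proto) (s : Set (Fin 5)) : IsClosed (⋃ k ∈ s, P.rhomb k) :=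
  s.toFinite.isClosed_biUnion fun _ _ => isClosed_rhombus _ _

/-- The local shape of a prototile at its corners. -/
theorem isCorner_region (P : Proto) (x : Fin 5 × Bool) (hx : P.gap x.1 ≠ 0) :
    IsCorner P.region (P.vtx x) (P.start x * (Real.pi / 5)) (P.size x * (2 * (Real.pi / 5))) := by
  have hpi := Real.pi_pos
  rcases x with ⟨k, _ | _⟩
  -- At the end of a ray two rhombuses meet along the segment towards the origin, in direction -ζ k.
  -- Their angles there are 5 - 2 gap tenths of a turn each.
  · obtain ⟨hb, hbk, hsum, hne⟩ := P.back_spec k hx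
    have hreg : P.region = P.rhomb k ∪ P.rhomb (P.back k) ∪
        ⋃ j ∈ {j | P.gap j ≠ 0 ∧ j ≠ k ∧ j ≠ P.back k}, P.rhomb j := by
      rw [region_eq]
      ext z
      simp only [Set.mem_union, Set.mem_iUnion, Set.mem_ofPred_eq, exists_prop]
      constructor
      · rintro ⟨j, hj, hz⟩
        by_cases h1 : j = k
        · subst h1; exact .inl (.inl hz)
        by_cases h2 : j = P.back k
        · subst h2; exact .inl (.inr hz)
        exact .inr ⟨j, ⟨hj, h1, h2⟩, hz⟩
      · rintro ((hz | hz) | ⟨j, hj, hz⟩)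
        · exact ⟨k, hx, hz⟩
        · exact ⟨_, hb, hz⟩
        · exact ⟨j, hj.1, hz⟩
    rw [hreg]
    refine IsCorner.union_of_notMem ?_ (P.isClosed_biUnion_rhomb _) ?_
    · have hg : (P.gap k : ℝ) ≤ 2 := by exact_mod_cast P.gap_le_two k
      have hg' : (P.gap (P.back k) : ℝ) ≤ 2 := by exact_mod_cast P.gap_le_two _
      have hg0 : (0 : ℝ) < P.gap k := by exact_mod_cast Nat.pos_of_ne_zero hx
      have hg0' : (0 : ℝ) < P.gap (P.back k) := by exact_mod_cast Nat.pos_of_ne_zero hb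
      have hsz : (P.size (k, false) : ℝ) * (2 * (Real.pi / 5)) =
          (5 - 2 * P.gap k) * (Real.pi / 5) + (5 - 2 * P.gap (P.back k)) * (Real.pi / 5) := by
        have : (P.size (k, false) : ℝ) = 5 - P.gap k - P.gap (P.back k) := by
          simp only [size]
          rw [Nat.cast_sub (by omega), Nat.cast_sub (by omega)]; norm_num
        rw [this]; ring
      rw [hsz]
      have neg : dir (((P.start (k, false) : ℕ) : ℝ) * (Real.pi / 5) +
          (5 - 2 * P.gap k) * (Real.pi / 5)) = -ζ k := by
        rw [ζ_eq_dir, ← dir_add_pi]; congr 1; simp only [start]; push_cast; ring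
      have h1 : IsCorner (P.rhomb k) (P.vtx (k, false)) (P.start (k, false) * (Real.pi / 5))
          ((5 - 2 * P.gap k) * (Real.pi / 5)) := by
        have := isCorner_para (P.vtx (k, false)) (α := P.start (k, false) * (Real.pi / 5))
          (δ := (5 - 2 * P.gap k) * (Real.pi / 5)) (by nlinarith) (by nlinarith)
        rw [neg] at this
        have e : dir (P.start (k, false) * (Real.pi / 5)) = ζ (k + P.gap k) := by
          rw [ζ_eq_dir]; congr 1; simp only [start]; push_cast; ring
        rw [rhomb, rhombus_eq_para, para_eq_image_right]
        rw [e] at this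
        exact this
      have h2 : IsCorner (P.rhomb (P.back k)) (P.vtx (k, false))
          (P.start (k, false) * (Real.pi / 5) + (5 - 2 * P.gap k) * (Real.pi / 5))
          ((5 - 2 * P.gap (P.back k)) * (Real.pi / 5)) := by
        have := isCorner_para (P.vtx (k, false))
          (α := P.start (k, false) * (Real.pi / 5) + (5 - 2 * P.gap k) * (Real.pi / 5))
          (δ := (5 - 2 * P.gap (P.back k)) * (Real.pi / 5)) (by nlinarith) (by nlinarith)
        rw [neg] at this
        have ez : ζ (P.back k + P.gap (P.back k)) = ζ k := by
          rcases hbk with h | h <;> rw [h]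
          exact ζ_add_five k
        have e : ζ (P.back k) = dir (P.start (k, false) * (Real.pi / 5) +
            (5 - 2 * P.gap k) * (Real.pi / 5) + (5 - 2 * P.gap (P.back k)) * (Real.pi / 5)) := by
          rw [ζ_eq_dir, dir_eq_dir_iff]
          have hk' : ((P.back k : ℕ) : ℝ) + P.gap (P.back k) = k ∨
              ((P.back k : ℕ) : ℝ) + P.gap (P.back k) = k + 5 := by exact_mod_cast hbk
          rcases hk' with h | h
          · refine ⟨-1, ?_⟩
            simp only [start]; push_cast
            linear_combination (2 * Real.pi / 5) * h
          · refine ⟨0, ?_⟩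
            simp only [start]; push_cast
            linear_combination (2 * Real.pi / 5) * h
        rw [rhomb, rhombus_eq_para, para_eq_image_left, ez, e]
        exact this
      exact h1.union (by nlinarith) (by nlinarith) h2
    · simp only [Set.mem_iUnion, Set.mem_ofPred_eq, exists_prop, not_exists, not_and]
      rintro j ⟨hj, h1, h2⟩ hm
      obtain ⟨n, h3, h4⟩ := P.polar_of_mem_rhomb hj hm
      rcases P.polar_spec hj hx h3 h4 with h | h
      · exact h1 h
      · exact h2 h.2
  -- A far vertex lies in a single rhombus, seen from its corner opposite to the origin.
  · have hreg : P.region = P.rhomb k ∪ ⋃ j ∈ {j | P.gap j ≠ 0 ∧ j ≠ k}, P.rhomb j := by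
      rw [region_eq]
      ext z
      simp only [Set.mem_union, Set.mem_iUnion, Set.mem_ofPred_eq, exists_prop]
      constructor
      · rintro ⟨j, hj, hz⟩
        by_cases h1 : j = k
        · subst h1; exact .inl hz
        exact .inr ⟨j, ⟨hj, h1⟩, hz⟩
      · rintro (hz | ⟨j, hj, hz⟩)
        · exact ⟨k, hx, hz⟩
        · exact ⟨j, hj.1, hz⟩
    rw [hreg]
    refine IsCorner.union_of_notMem ?_ (P.isClosed_biUnion_rhomb _) ?_
    · have hg : (P.gap k : ℝ) ≤ 2 := by exact_mod_cast P.gap_le_two k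
      have hg0 : (0 : ℝ) < P.gap k := by exact_mod_cast Nat.pos_of_ne_zero hx
      have := isCorner_para (P.vtx (k, true)) (α := P.start (k, true) * (Real.pi / 5))
          (δ := P.size (k, true) * (2 * (Real.pi / 5))) (by simp only [size]; positivity)
          (by simp only [size]; nlinarith)
      have e1 : dir (P.start (k, true) * (Real.pi / 5)) = -ζ k := by
        rw [ζ_eq_dir, ← dir_add_pi]; congr 1; simp only [start]; push_cast; ring
      have e2 : dir (P.start (k, true) * (Real.pi / 5) + P.size (k, true) * (2 * (Real.pi / 5))) =
          -ζ (k + P.gap k) := by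
        rw [ζ_eq_dir, ← dir_add_pi]; congr 1; simp only [start, size]; push_cast; ring
      rw [e1, e2] at this
      rw [rhomb, rhombus_eq_para, para_eq_image_opposite]
      exact this
    · simp only [Set.mem_iUnion, Set.mem_ofPred_eq, exists_prop, not_exists, not_and]
      rintro j ⟨hj, h1⟩ hm
      obtain ⟨n, h3, h4⟩ := P.polar_of_mem_rhomb hj hm
      rcases P.polar_spec hj hx h3 h4 with h | h
      · exact h1 h
      · exact absurd h.1 (by simp)

end Proto
-- Mirror symmetries and placement by direct isometries
theorem ζ_congr {a b : ℕ} (h : a % 5 = b % 5) : ζ a = ζ b := by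
  rw [ζ_eq_dir, ζ_eq_dir, dir_eq_dir_iff]
  refine ⟨(a / 5 : ℕ) - (b / 5 : ℕ), ?_⟩
  have ha : (a : ℝ) = 5 * (a / 5 : ℕ) + (a % 5 : ℕ) := by exact_mod_cast (Nat.div_add_mod a 5).symm
  have hb : (b : ℝ) = 5 * (b / 5 : ℕ) + (b % 5 : ℕ) := by exact_mod_cast (Nat.div_add_mod b 5).symm
  rw [h] at ha
  rw [ha, hb]
  generalize a / 5 = m
  generalize b / 5 = n
  push_cast; ring

open scoped ComplexConjugate in
theorem ζ_mul_conj (m k : ℕ) : ζ m * conj (ζ k) = ζ (m + 4 * k) := by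
  have h : conj (ζ k) = dir (-(2 * k * (Real.pi / 5))) := by
    have h' : ∀ x : ℝ, conj (dir x) = dir (-x) := fun x => by
      rw [dir, dir, ← Complex.exp_conj]; simp
    rw [ζ_eq_dir, h']
  rw [h, ζ_eq_dir, ζ_eq_dir, ← dir_add, dir_eq_dir_iff]
  exact ⟨-k, by push_cast; ring⟩

instance : DecidableEq Colour := fun a b => by
  cases a <;> cases b <;> first | exact isTrue rfl | exact isFalse (by simp)

namespace Proto

/-- The axis of a mirror symmetry of a prototile. -/
def axis : Proto → ℕ
  | .H | .S0 | .S1 => 1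
  | .B | .S2 => 3

open scoped ComplexConjugate in
/-- A mirror symmetry of a prototile. -/
noncomputable def mirror (P : Proto) (z : ℂ) : ℂ := ζ P.axis * conj z

theorem mirror_mirror (P : Proto) (z : ℂ) : P.mirror (P.mirror z) = z := by
  rw [mirror, mirror, map_mul, Complex.conj_conj, ← mul_assoc, ζ_mul_conj,
    ζ_congr (b := 0) (by omega)]
  simp [ζ]

/-- The mirror sends ζ k to ζ (axis - k), written with 4k for -k modulo 5. It reverses orientation,
so the rhombus after ray k goes to the one after the image of the ray where it ends. -/
theorem mirror_index (P : Proto) (k : Fin 5) (hk : P.gap k ≠ 0) :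
    (∃ j, P.gap j = P.gap k ∧ (j : ℕ) % 5 = (P.axis + 4 * (k + P.gap k)) % 5 ∧
      P.colour (j, true) = P.colour (k, true)) ∧
    ∃ j, P.gap j ≠ 0 ∧ (j : ℕ) % 5 = (P.axis + 4 * k) % 5 ∧
      P.colour (j, false) = P.colour (k, false) := by
  cases P <;> revert k <;> decide

theorem mirror_mem_region (P : Proto) {z : ℂ} (hz : z ∈ P.region) : P.mirror z ∈ P.region := by
  rw [region_eq] at hz ⊢
  simp only [Set.mem_iUnion, Set.mem_ofPred_eq, exists_prop] at hz ⊢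
  obtain ⟨k, hk, hz⟩ := hz
  obtain ⟨⟨j, hj, hjk, -⟩, -⟩ := P.mirror_index k hk
  refine ⟨j, by rwa [hj], ?_⟩
  rw [rhomb, rhombus_eq_para] at hz ⊢
  obtain ⟨s, t, hs, hs', ht, ht', rfl⟩ := hz
  refine ⟨t, s, ht, ht', hs, hs', ?_⟩
  rw [ζ_congr hjk, ζ_congr (a := j + P.gap j) (b := P.axis + 4 * k) (by omega), mirror, map_add,
    map_mul, map_mul, Complex.conj_ofReal, Complex.conj_ofReal, ← ζ_mul_conj, ← ζ_mul_conj]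
  ring

theorem mirror_mem_vertices (P : Proto) {p : ℂ} {c : Colour} (h : (p, c) ∈ P.vertices) :
    (P.mirror p, c) ∈ P.vertices := by
  rw [mem_vertices_iff] at h ⊢
  obtain ⟨⟨k, t⟩, hk, rfl, rfl⟩ := h
  obtain ⟨⟨j, hj, hjk, hc⟩, ⟨j', hj', hjk', hc'⟩⟩ := P.mirror_index k hk
  cases t with
  | false =>
    refine ⟨(j', false), hj', ?_, hc'.symm⟩
    simp only [vtx, mirror, ζ_mul_conj]
    rw [ζ_congr hjk']
  | true =>
    refine ⟨(j, true), by simpa [hj] using hk, ?_, hc.symm⟩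
    simp only [vtx, mirror, map_add, mul_add, ζ_mul_conj]
    rw [ζ_congr hjk, ζ_congr (a := j + P.gap j) (b := P.axis + 4 * k) (by omega), add_comm]
    congr 2; ring

end Proto

open scoped ComplexConjugate in
/-- The isometries of the plane. -/
theorem isometryEquiv_complex (e : ℂ ≃ᵢ ℂ) : ∃ (θ : ℝ) (b : ℂ),
    (∀ z, e z = dir θ * z + b) ∨ (∀ z, e z = dir θ * conj z + b) := by
  obtain ⟨a, ha⟩ := linear_isometry_complex e.toRealLinearIsometryEquiv
  have hd : dir (Complex.arg a) = a := by
    have := Complex.norm_mul_exp_arg_mul_I (a : ℂ)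
    rwa [Circle.norm_coe, Complex.ofReal_one, one_mul] at this
  refine ⟨Complex.arg a, e 0, ?_⟩
  have h : ∀ z, e z = e.toRealLinearIsometryEquiv z + e 0 := fun z => by
    simp [IsometryEquiv.toRealLinearIsometryEquiv_apply]
  rw [hd]
  rcases ha with ha | ha
  · left; intro z; rw [h, ha]; simp [rotation_apply]
  · right; intro z; rw [h, ha]; simp [rotation_apply]

namespace StarTiling
variable {ι : Type*} (T : StarTiling ι)

/-- Tiles can be placed by direct isometries. -/
theorem exists_direct (i : ι) : ∃ (θ : ℝ) (b : ℂ),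
    (fun z => dir θ * z + b) '' (T.proto i).region = T.tile i ∧
    ∀ z c, (∃ p, (p, c) ∈ (T.proto i).vertices ∧ T.place i p = z) ↔
      ∃ p, (p, c) ∈ (T.proto i).vertices ∧ dir θ * p + b = z := by
  obtain ⟨θ, b, h | h⟩ := isometryEquiv_complex (T.place i)
  · refine ⟨θ, b, ?_, fun z c => by simp only [h]⟩
    rw [tile]
    exact Set.image_congr fun z _ => (h z).symm
  -- An indirect isometry is composed with the mirror of the prototile, which preserves region and
  -- coloured vertices.
  · set P := T.proto i
    have hm : ∀ z, T.place i z = dir (θ - 2 * P.axis * (Real.pi / 5)) * P.mirror z + b := fun z => by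
      rw [h, Proto.mirror, ← mul_assoc, ζ_eq_dir, ← dir_add]
      congr 3; ring
    refine ⟨θ - 2 * P.axis * (Real.pi / 5), b, ?_, fun z c => ⟨?_, ?_⟩⟩
    · apply Set.Subset.antisymm
      · rintro _ ⟨z, hz, rfl⟩
        exact ⟨P.mirror z, P.mirror_mem_region hz, by rw [hm, P.mirror_mirror]⟩
      · rintro _ ⟨z, hz, rfl⟩
        exact ⟨P.mirror z, P.mirror_mem_region hz, (hm z).symm⟩
    · rintro ⟨p, hp, rfl⟩
      exact ⟨P.mirror p, P.mirror_mem_vertices hp, (hm p).symm⟩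
    · rintro ⟨p, hp, rfl⟩
      exact ⟨P.mirror p, P.mirror_mem_vertices hp, by rw [hm, P.mirror_mirror]⟩

/-- The argument of the direct isometry that places a tile. -/
noncomputable def turn (i : ι) : ℝ := (T.exists_direct i).choose

/-- The translation of the direct isometry that places a tile. -/
noncomputable def shift (i : ι) : ℂ := (T.exists_direct i).choose_spec.choose

theorem image_region (i : ι) :
    (fun z => dir (T.turn i) * z + T.shift i) '' (T.proto i).region = T.tile i :=
  (T.exists_direct i).choose_spec.choose_spec.1

theorem vertex_iff (i : ι) (z : ℂ) (c : Colour) :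
    (∃ p, (p, c) ∈ (T.proto i).vertices ∧ T.place i p = z) ↔
      ∃ p, (p, c) ∈ (T.proto i).vertices ∧ dir (T.turn i) * p + T.shift i = z :=
  (T.exists_direct i).choose_spec.choose_spec.2 z c

/-- The corners of the tiles of a tiling. -/
abbrev Dart : Type _ := {d : ι × (Fin 5 × Bool) // (T.proto d.1).gap d.2.1 ≠ 0}

variable {T}

namespace Dart

/-- The position of a corner. -/
noncomputable def pos (d : T.Dart) : ℂ := dir (T.turn d.1.1) * (T.proto d.1.1).vtx d.1.2 + T.shift d.1.1

/-- The argument of the side that follows a corner. -/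
noncomputable def arg (d : T.Dart) : ℝ := T.turn d.1.1 + (T.proto d.1.1).start d.1.2 * (Real.pi / 5)

/-- The angle at a corner, in fifths of a turn. -/
def size (d : T.Dart) : ℕ := (T.proto d.1.1).size d.1.2

/-- The colour of a corner. -/
def colour (d : T.Dart) : Colour := (T.proto d.1.1).colour d.1.2

theorem isCorner (d : T.Dart) :
    IsCorner (T.tile d.1.1) d.pos d.arg (d.size * (2 * (Real.pi / 5))) := by
  rw [← T.image_region]
  exact ((T.proto d.1.1).isCorner_region d.1.2 d.2).image _ _

theorem vertex (d : T.Dart) :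
    ∃ p, (p, d.colour) ∈ (T.proto d.1.1).vertices ∧ T.place d.1.1 p = d.pos :=
  (T.vertex_iff _ _ _).2 ⟨_, (Proto.mem_vertices_iff _ _ _).2 ⟨d.1.2, d.2, rfl, rfl⟩, rfl⟩

theorem eq_of_pos_eq {d e : T.Dart} (h : d.pos = e.pos) (hi : d.1.1 = e.1.1) : d = e := by
  obtain ⟨⟨i, x⟩, hd⟩ := d
  obtain ⟨⟨j, y⟩, he⟩ := e
  dsimp only at hi
  subst hi
  have h1 : dir (T.turn i) * (T.proto i).vtx x = dir (T.turn i) * (T.proto i).vtx y :=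
    add_right_cancel h
  have := (T.proto i).vtx_inj hd he (mul_left_cancel₀ (dir_ne_zero _) h1)
  subst this
  rfl

/-- This is where the edge-to-edge and colour conditions enter: a vertex on a tile is a corner of
that tile. -/
theorem exists_of_mem_tile {d : T.Dart} {j : ι} (h : d.pos ∈ T.tile j) :
    ∃ e : T.Dart, e.1.1 = j ∧ e.pos = d.pos ∧ e.colour = d.colour := by
  obtain ⟨p, hp, hpd⟩ := d.vertex
  obtain ⟨q, hq, hqd⟩ := h
  have hv := T.vertices_match _ j p q _ hp (hpd.trans hqd.symm) hq
  obtain ⟨p', hp', h'⟩ := (T.vertex_iff j d.pos d.colour).1 ⟨q, hv, hqd⟩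
  obtain ⟨x, hx, rfl, hc⟩ := (Proto.mem_vertices_iff _ _ _).1 hp'
  exact ⟨⟨(j, x), hx⟩, rfl, h', hc.symm⟩

end Dart

end StarTiling
-- Area estimates for the numbers of tiles
open MeasureTheory in
/-- The number of disjoint discs of the same radius in a set of finite area is bounded. -/
theorem ncard_mul_le_of_disjoint_balls {ι : Type*} {c : ι → ℂ} {ε : ℝ} (hε : 0 < ε)
    (hd : Pairwise fun i j => Disjoint (Metric.ball (c i) ε) (Metric.ball (c j) ε))
    {A : Set ℂ} {V : ℝ} (hV : 0 ≤ V) (hA : volume A ≤ ENNReal.ofReal V) {s : Set ι}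
    (hs : ∀ i ∈ s, Metric.ball (c i) ε ⊆ A) :
    s.Finite ∧ (s.ncard : ℝ) * (Real.pi * ε ^ 2) ≤ V := by
  have hpi := Real.pi_pos
  have key : ∀ t : Finset ι, ↑t ⊆ s → (t.card : ℝ) * (Real.pi * ε ^ 2) ≤ V := by
    intro t ht
    have h1 : volume (⋃ i ∈ t, Metric.ball (c i) ε) = ∑ i ∈ t, volume (Metric.ball (c i) ε) :=
      measure_biUnion_finset (fun i _ j _ hij => hd hij) fun i _ => measurableSet_ball
    have h2 : volume (⋃ i ∈ t, Metric.ball (c i) ε) ≤ volume A :=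
      measure_mono (Set.iUnion₂_subset fun i hi => hs i (ht hi))
    have h3 : ∀ i, volume (Metric.ball (c i) ε) = ENNReal.ofReal (Real.pi * ε ^ 2) := fun i => by
      rw [Complex.volume_ball, mul_comm Real.pi, ENNReal.ofReal_mul (by positivity),
        ENNReal.ofReal_pow hε.le, ← NNReal.coe_real_pi, ENNReal.ofReal_coe_nnreal]
    simp only [h3, Finset.sum_const, nsmul_eq_mul] at h1
    rw [h1] at h2
    have h4 := h2.trans hA
    rw [← ENNReal.ofReal_natCast, ← ENNReal.ofReal_mul (by positivity)] at h4
    exact (ENNReal.ofReal_le_ofReal_iff hV).1 h4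
  have hfin : s.Finite := by
    by_contra hinf
    obtain ⟨n, hn⟩ := exists_nat_gt (V / (Real.pi * ε ^ 2))
    obtain ⟨t, hts, htn⟩ := Set.Infinite.exists_subset_card_eq hinf n
    have := key t hts
    rw [htn] at this
    rw [div_lt_iff₀ (by positivity)] at hn
    linarith
  refine ⟨hfin, ?_⟩
  have := key hfin.toFinset (by simp)
  rwa [← Set.ncard_eq_toFinset_card s hfin] at this

theorem Proto.rhomb_zero_subset (P : Proto) : rhombus (ζ 0) (ζ 1) ⊆ P.region := by
  have h : P.gap 0 = 1 := by cases P <;> rfl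
  rw [P.region_eq]
  intro z hz
  simp only [Set.mem_iUnion, Set.mem_ofPred_eq, exists_prop]
  refine ⟨0, by simp [h], ?_⟩
  rw [rhomb, h]
  exact hz

theorem Proto.norm_le_two (P : Proto) {z : ℂ} (hz : z ∈ P.region) : ‖z‖ ≤ 2 := by
  rw [P.region_eq] at hz
  simp only [Set.mem_iUnion, Set.mem_ofPred_eq, exists_prop] at hz
  obtain ⟨k, -, hz⟩ := hz
  rw [rhomb, rhombus_eq_para] at hz
  obtain ⟨s, t, hs, hs', ht, ht', rfl⟩ := hz
  refine (norm_add_le _ _).trans ?_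
  rw [norm_mul, norm_mul, ζ_eq_dir, ζ_eq_dir, norm_dir, norm_dir, Complex.norm_real,
    Complex.norm_real, Real.norm_eq_abs, Real.norm_eq_abs, abs_of_nonneg hs, abs_of_nonneg ht]
  linarith

theorem Proto.isClosed_region (P : Proto) : IsClosed P.region := by
  rw [P.region_eq]; exact P.isClosed_biUnion_rhomb _

/-- A point in the interior of all prototiles. -/
noncomputable def midpt : ℂ := (1 / 2 : ℝ) * ζ 0 + (1 / 2 : ℝ) * ζ 1

theorem midpt_mem : midpt ∈ interior (rhombus (ζ 0) (ζ 1)) := by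
  rw [rhombus_eq_para]
  refine mem_interior_para ?_ (by norm_num) (by norm_num) (by norm_num) (by norm_num)
  have := Real.pi_pos
  have h : 0 < Real.sin (2 * 1 * (Real.pi / 5)) :=
    Real.sin_pos_of_pos_of_lt_pi (by positivity) (by linarith)
  simp only [ζ_eq_dir, dir_re, dir_im]
  simpa using h.ne'

theorem exists_inradius : ∃ ε : ℝ, 0 < ε ∧ ε ≤ 1 ∧ ∀ P : Proto, Metric.ball midpt ε ⊆ P.region := by
  obtain ⟨ε, hε, h⟩ := Metric.isOpen_iff.1 isOpen_interior midpt midpt_mem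
  exact ⟨min ε 1, by positivity, min_le_right _ _, fun P =>
    ((Metric.ball_subset_ball (min_le_left _ _)).trans h).trans
      (interior_subset.trans P.rhomb_zero_subset)⟩

/-- A common inradius of the prototiles. -/
noncomputable def inradius : ℝ := exists_inradius.choose

theorem inradius_pos : 0 < inradius := exists_inradius.choose_spec.1
theorem inradius_le_one : inradius ≤ 1 := exists_inradius.choose_spec.2.1
theorem ball_subset_region (P : Proto) : Metric.ball midpt inradius ⊆ P.region :=
  exists_inradius.choose_spec.2.2 P

namespace StarTiling
variable {ι : Type*} (T : StarTiling ι)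

/-- A point in the interior of a tile. -/
noncomputable def center (i : ι) : ℂ := T.place i midpt

theorem ball_subset_tile (i : ι) : Metric.ball (T.center i) inradius ⊆ T.tile i := by
  rw [center, ← IsometryEquiv.image_ball]
  exact Set.image_mono (ball_subset_region _)

theorem disjoint_balls : Pairwise fun i j =>
    Disjoint (Metric.ball (T.center i) inradius) (Metric.ball (T.center j) inradius) := by
  intro i j hij
  refine (T.interior_disjoint hij).mono ?_ ?_ <;>
  exact interior_maximal (T.ball_subset_tile _) Metric.isOpen_ball

theorem isClosed_tile (i : ι) : IsClosed (T.tile i) :=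
  (T.place i).toHomeomorph.isClosedMap _ (T.proto i).isClosed_region

theorem dist_center_le {i : ι} {z : ℂ} (hz : z ∈ T.tile i) : dist z (T.center i) ≤ 4 := by
  obtain ⟨w, hw, rfl⟩ := hz
  rw [center, IsometryEquiv.dist_eq, dist_eq_norm]
  have h1 := (T.proto i).norm_le_two hw
  have h2 := (T.proto i).norm_le_two
    (ball_subset_region (T.proto i) (Metric.mem_ball_self inradius_pos))
  linarith [norm_sub_le w midpt]

theorem exists_mem_tile (z : ℂ) : ∃ i, z ∈ T.tile i := by
  have : z ∈ ⋃ i, T.place i '' (T.proto i).region := by rw [T.covers]; trivial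
  exact Set.mem_iUnion.1 this

open MeasureTheory in
-- Packing: the tiles contain disjoint discs of a common radius at most 1, all within the disc of
-- radius r + 1.
theorem tiles_closedBall (x : ℂ) {r : ℝ} (hr : 0 ≤ r) :
    {i | dist (T.center i) x ≤ r}.Finite ∧
    ({i | dist (T.center i) x ≤ r}.ncard : ℝ) * (Real.pi * inradius ^ 2) ≤
      Real.pi * (r + 1) ^ 2 := by
  have hpi := Real.pi_pos
  refine ncard_mul_le_of_disjoint_balls inradius_pos T.disjoint_balls (by positivity)
    (A := Metric.closedBall x (r + 1)) ?_ ?_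
  · rw [Complex.volume_closedBall, mul_comm Real.pi, ENNReal.ofReal_mul (by positivity),
        ENNReal.ofReal_pow (by positivity), ← NNReal.coe_real_pi, ENNReal.ofReal_coe_nnreal]
  · intro i hi z hz
    rw [Metric.mem_ball] at hz
    have hi' : dist (T.center i) x ≤ r := hi
    rw [Metric.mem_closedBall]
    linarith [dist_triangle z (T.center i) x, inradius_le_one]

open MeasureTheory in
-- Packing in an annulus, of area π((r + L + 1)² - (r - L - 1)²) = 4πr(L + 1).
theorem tiles_annulus (x : ℂ) {r L : ℝ} (hL : 0 ≤ L) (hr : L + 1 ≤ r) :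
    ({i | |dist (T.center i) x - r| ≤ L}.ncard : ℝ) * (Real.pi * inradius ^ 2) ≤
      Real.pi * (4 * r * (L + 1)) := by
  have hpi := Real.pi_pos
  refine (ncard_mul_le_of_disjoint_balls inradius_pos T.disjoint_balls (by
    have : 0 ≤ r := by linarith
    positivity)
    (A := Metric.closedBall x (r + (L + 1)) \ Metric.ball x (r - (L + 1))) ?_ ?_).2
  · rw [measure_sdiff (Metric.ball_subset_closedBall.trans
      (Metric.closedBall_subset_closedBall (by linarith))) measurableSet_ball.nullMeasurableSet
      (by finiteness)]
    have e : ∀ y : ℝ, 0 ≤ y → ENNReal.ofReal y ^ 2 * (NNReal.pi : ENNReal) =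
        ENNReal.ofReal (Real.pi * y ^ 2) := fun y hy => by
      rw [mul_comm Real.pi, ENNReal.ofReal_mul (by positivity),
        ENNReal.ofReal_pow (by positivity), ← NNReal.coe_real_pi, ENNReal.ofReal_coe_nnreal]
    rw [Complex.volume_closedBall, Complex.volume_ball, e _ (by linarith), e _ (by linarith),
      ← ENNReal.ofReal_sub _ (by positivity)]
    apply ENNReal.ofReal_le_ofReal
    apply le_of_eq; ring
  · intro i hi z hz
    rw [Metric.mem_ball] at hz
    have hi' := abs_le.1 (show |dist (T.center i) x - r| ≤ L from hi)
    have := dist_triangle z (T.center i) x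
    have := dist_triangle_left (T.center i) x z
    have := inradius_le_one
    refine ⟨?_, ?_⟩
    · rw [Metric.mem_closedBall]; linarith
    · rw [Metric.mem_ball, not_lt]
      linarith

open MeasureTheory in
/-- The tiles contained in a disc are at least as many as its area suggests. -/
theorem le_tileCount (x : ℂ) {r : ℝ} (hr : 8 ≤ r) :
    (r - 8) ^ 2 ≤ 16 * (T.tileCount Set.univ x r : ℝ) := by
  set s := {i | T.proto i ∈ Set.univ ∧ T.tile i ⊆ Metric.closedBall x r} with hs
  have hpi := Real.pi_pos
  have hfin : s.Finite := by
    refine (T.tiles_closedBall x (r := r) (by linarith)).1.subset fun i hi => ?_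
    exact hi.2 (T.ball_subset_tile i (Metric.mem_ball_self inradius_pos))
  -- A tile lies within 4 of its centre, so its diameter is at most 8. Tiles meeting the disc of
  -- radius r - 8 stay in the disc of radius r, and discs of radius 4 cover them.
  have hcov : Metric.closedBall x (r - 8) ⊆ ⋃ i ∈ hfin.toFinset, Metric.closedBall (T.center i) 4 := by
    intro z hz
    obtain ⟨i, hi⟩ := T.exists_mem_tile z
    have h1 := T.dist_center_le hi
    simp only [Set.mem_iUnion, Set.Finite.mem_toFinset, exists_prop]
    refine ⟨i, ⟨trivial, fun w hw => ?_⟩, h1⟩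
    have h2 := T.dist_center_le hw
    rw [Metric.mem_closedBall] at hz ⊢
    have := dist_triangle w (T.center i) x
    have := dist_triangle_left (T.center i) x z
    linarith
  have e : ∀ y : ℝ, 0 ≤ y → ENNReal.ofReal y ^ 2 * (NNReal.pi : ENNReal) =
      ENNReal.ofReal (Real.pi * y ^ 2) := fun y hy => by
    rw [mul_comm Real.pi, ENNReal.ofReal_mul (by positivity),
      ENNReal.ofReal_pow (by positivity), ← NNReal.coe_real_pi, ENNReal.ofReal_coe_nnreal]
  have h1 := (measure_mono hcov).trans (measure_biUnion_finset_le (μ := volume) _ _)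
  simp only [Complex.volume_closedBall, Finset.sum_const, nsmul_eq_mul] at h1
  rw [e _ (by linarith), e _ (by norm_num), ← ENNReal.ofReal_natCast,
    ← ENNReal.ofReal_mul (by positivity), ENNReal.ofReal_le_ofReal_iff (by positivity),
    ← Set.ncard_eq_toFinset_card s hfin] at h1
  have h2 : (T.tileCount Set.univ x r : ℝ) = s.ncard := rfl
  rw [h2]
  have : Real.pi * ((r - 8) ^ 2) ≤ Real.pi * (16 * s.ncard) := by linarith
  exact le_of_mul_le_mul_left this hpi

theorem finite_tiles_near (z : ℂ) : {i | (T.tile i ∩ Metric.ball z 1).Nonempty}.Finite := by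
  refine (T.tiles_closedBall z (r := 5) (by norm_num)).1.subset ?_
  rintro i ⟨w, hw, hz⟩
  have := T.dist_center_le hw
  rw [Metric.mem_ball] at hz
  simp only [Set.mem_ofPred_eq]
  linarith [dist_triangle_left (T.center i) z w]

variable {T}

/-! ### Sectors of the corners at a vertex -/

namespace Dart

theorem pos_mem_tile (d : T.Dart) : d.pos ∈ T.tile d.1.1 := by
  have h := d.isCorner
  obtain ⟨N, hN, hin⟩ := h.inside
  have hsz : 0 < d.size := by
    have : ∀ (P : Proto) (x : Fin 5 × Bool), P.gap x.1 ≠ 0 → 0 < P.size x := by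
      intro P x; cases P <;> revert x <;> decide
    exact this _ _ d.2
  have hpos : (0 : ℝ) < d.size * (2 * (Real.pi / 5)) := by
    have := Real.pi_pos
    positivity
  -- An open interval is uncountable, so some direction avoids the exceptional set; the position is
  -- then a limit of points of the tile.
  have : (Set.Ioo 0 (d.size * (2 * (Real.pi / 5))) \ N).Nonempty := by
    by_contra hne
    rw [Set.not_nonempty_iff_eq_empty, Set.sdiff_eq_empty] at hne
    exact (Cardinal.Real.Ioo_countable_iff.not.2 (not_le.2 hpos)) (hN.mono hne)
  obtain ⟨x, hx⟩ := this
  refine (T.isClosed_tile d.1.1).mem_of_frequently_of_tendsto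
    (Eventually.frequently ?_) (tendsto_ray d.pos (dir (d.arg + x)))
  filter_upwards [hin x hx] with t ht
  exact interior_subset ht

theorem colour_eq {d e : T.Dart} (h : d.pos = e.pos) : d.colour = e.colour := by
  obtain ⟨e', h1, h2, h3⟩ := exists_of_mem_tile (d := d) (j := e.1.1) (h ▸ e.pos_mem_tile)
  rw [← h3, eq_of_pos_eq (h2.trans h) h1]

/-- Every direction at a vertex lies in the sector of a corner. -/
theorem exists_sector (d : T.Dart) (γ : ℝ) : ∃ e : T.Dart, e.pos = d.pos ∧
    ∃ n : ℤ, e.arg ≤ γ + n * (2 * Real.pi) ∧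
      γ + n * (2 * Real.pi) ≤ e.arg + e.size * (2 * (Real.pi / 5)) := by
  have hF := T.finite_tiles_near d.pos
  have h1 : ∀ᶠ t : ℝ in 𝓝[>] 0, d.pos + t * dir γ ∈ Metric.ball d.pos 1 :=
    tendsto_ray d.pos (dir γ) (Metric.ball_mem_nhds _ one_pos)
  -- Only finitely many tiles come near the vertex, so one of them meets the ray arbitrarily close
  -- to it.
  have h2 : ∃ i, ∃ᶠ t : ℝ in 𝓝[>] 0, d.pos + t * dir γ ∈ T.tile i := by
    by_contra! hne
    have h3 := (eventually_all_finite hF).2 fun i _ => hne i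
    obtain ⟨t, h4, h5⟩ := (h1.and h3).exists
    obtain ⟨i, hi⟩ := T.exists_mem_tile (d.pos + t * dir γ)
    exact h5 i ⟨_, hi, h4⟩ hi
  obtain ⟨i, hi⟩ := h2
  have hmem : d.pos ∈ T.tile i :=
    (T.isClosed_tile i).mem_of_frequently_of_tendsto hi (tendsto_ray d.pos (dir γ))
  obtain ⟨e, rfl, he, -⟩ := exists_of_mem_tile hmem
  refine ⟨e, he, e.isCorner.outside γ ?_⟩
  rwa [he]

/-- The open sectors of distinct corners at a vertex are disjoint. -/
theorem eq_of_sectors {d e : T.Dart} (h : d.pos = e.pos) {γ : ℝ} {n : ℤ}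
    (h1 : d.arg < γ) (h2 : γ < d.arg + d.size * (2 * (Real.pi / 5)))
    (h3 : e.arg < γ + n * (2 * Real.pi))
    (h4 : γ + n * (2 * Real.pi) < e.arg + e.size * (2 * (Real.pi / 5))) : d = e := by
  obtain ⟨N, hN, hd⟩ := d.isCorner.inside
  obtain ⟨N', hN', he⟩ := e.isCorner.inside
  set b := min (d.arg + d.size * (2 * (Real.pi / 5)))
    (e.arg + e.size * (2 * (Real.pi / 5)) - n * (2 * Real.pi))
  have hb : γ < b := lt_min h2 (by linarith)
  have hc : ((fun x => d.arg + x) '' N ∪ (fun x => e.arg + x - n * (2 * Real.pi)) '' N').Countable :=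
    (hN.image _).union (hN'.image _)
  -- A direction `y` slightly beyond γ avoids both exceptional sets, and the ray in this direction
  -- enters both interiors.
  obtain ⟨y, hy, hyN⟩ : (Set.Ioo γ b \ _).Nonempty := by
    by_contra hne
    rw [Set.not_nonempty_iff_eq_empty, Set.sdiff_eq_empty] at hne
    exact (Cardinal.Real.Ioo_countable_iff.not.2 (not_le.2 hb)) (hc.mono hne)
  simp only [Set.mem_union, Set.mem_image, not_or, not_exists, not_and] at hyN
  have hb1 : b ≤ _ := min_le_left _ _
  have hb2 : b ≤ _ := min_le_right _ _
  have e1 := hd (y - d.arg) ⟨⟨by linarith [hy.1], by linarith [hy.2]⟩,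
    fun hm => hyN.1 _ hm (by ring)⟩
  have e2 := he (y - e.arg + n * (2 * Real.pi)) ⟨⟨by linarith [hy.1], by linarith [hy.2]⟩,
    fun hm => hyN.2 _ hm (by ring)⟩
  obtain ⟨t, h5, h6⟩ := (e1.and e2).exists
  have w1 : d.arg + (y - d.arg) = y := by ring
  have w2 : dir (e.arg + (y - e.arg + n * (2 * Real.pi))) = dir y := by
    rw [← dir_add_int y n]; congr 1; ring
  rw [w1] at h5
  rw [w2, ← h] at h6
  apply eq_of_pos_eq h
  by_contra hne
  exact Set.disjoint_left.1 (T.interior_disjoint hne) h5 h6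

end Dart
end StarTiling
-- Walking around tiles and vertices
namespace Proto

theorem size_pos (P : Proto) {x : Fin 5 × Bool} (hx : P.gap x.1 ≠ 0) : 0 < P.size x := by
  revert hx; cases P <;> revert x <;> decide

theorem size_le (P : Proto) {x : Fin 5 × Bool} (hx : P.gap x.1 ≠ 0) : P.size x ≤ 3 := by
  revert hx; cases P <;> revert x <;> decide

/-- The corner of a prototile that follows a given one. -/
def succ (P : Proto) : Fin 5 × Bool → Fin 5 × Bool
  | (k, false) => (k, true)
  | (k, true) => (P.forth k, false)

/-- The corner of a prototile that precedes a given one. -/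
def pred (P : Proto) : Fin 5 × Bool → Fin 5 × Bool
  | (k, false) => (P.back k, true)
  | (k, true) => (k, false)

theorem gap_succ (P : Proto) {x : Fin 5 × Bool} (hx : P.gap x.1 ≠ 0) : P.gap (P.succ x).1 ≠ 0 := by
  revert hx; cases P <;> revert x <;> decide

theorem gap_pred (P : Proto) {x : Fin 5 × Bool} (hx : P.gap x.1 ≠ 0) : P.gap (P.pred x).1 ≠ 0 := by
  revert hx; cases P <;> revert x <;> decide

theorem succ_pred (P : Proto) {x : Fin 5 × Bool} (hx : P.gap x.1 ≠ 0) : P.succ (P.pred x) = x := by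
  revert hx; cases P <;> revert x <;> decide

theorem start_succ (P : Proto) {x : Fin 5 × Bool} (hx : P.gap x.1 ≠ 0) :
    ((P.start (P.succ x) : ℕ) + 2 * P.size (P.succ x)) % 10 = (P.start x + 5) % 10 := by
  revert hx; cases P <;> revert x <;> decide

theorem vtx_succ (P : Proto) {x : Fin 5 × Bool} (hx : P.gap x.1 ≠ 0) :
    P.vtx (P.succ x) = P.vtx x + dir (P.start x * (Real.pi / 5)) := by
  rcases x with ⟨k, _ | _⟩
  · simp only [succ, vtx, start]
    rw [ζ_eq_dir (k + P.gap k)]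
    congr 2; push_cast; ring
  · obtain ⟨-, h, -⟩ := P.forth_spec k hx
    simp only [succ, vtx, start]
    have h1 : ζ (P.forth k) = ζ (k + P.gap k) := ζ_congr (by omega)
    have h2 : dir ((2 * k + 5 : ℕ) * (Real.pi / 5)) = -ζ k := by
      rw [ζ_eq_dir, ← dir_add_pi]; congr 1; push_cast; ring
    rw [h1, h2]; ring

end Proto

namespace StarTiling
variable {ι : Type*} {T : StarTiling ι}

namespace Dart

theorem size_pos (d : T.Dart) : 0 < d.size := Proto.size_pos _ d.2
theorem size_le (d : T.Dart) : d.size ≤ 3 := Proto.size_le _ d.2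

/-- The next corner of the same tile. -/
def next (d : T.Dart) : T.Dart := ⟨(d.1.1, (T.proto d.1.1).succ d.1.2), Proto.gap_succ _ d.2⟩

/-- The previous corner of the same tile. -/
def prev (d : T.Dart) : T.Dart := ⟨(d.1.1, (T.proto d.1.1).pred d.1.2), Proto.gap_pred _ d.2⟩

theorem next_prev (d : T.Dart) : d.prev.next = d := by
  obtain ⟨⟨i, x⟩, hd⟩ := d
  simp only [next, prev, Proto.succ_pred _ hd]

theorem pos_next (d : T.Dart) : d.next.pos = d.pos + dir d.arg := by
  simp only [pos, next, arg, Proto.vtx_succ _ d.2, dir_add]; ring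

/-- The sector of a corner ends at the reversed incoming side. -/
theorem dir_arg_next (d : T.Dart) :
    dir (d.next.arg + d.next.size * (2 * (Real.pi / 5))) = -dir d.arg := by
  have h := (T.proto d.1.1).start_succ d.2
  rw [← dir_add_pi]
  simp only [arg, next, size]
  set a := (T.proto d.1.1).start ((T.proto d.1.1).succ d.1.2)
  set b := (T.proto d.1.1).size ((T.proto d.1.1).succ d.1.2)
  set c := (T.proto d.1.1).start d.1.2
  have h1 : dir (((a + 2 * b : ℕ) : ℤ) * (Real.pi / 5)) = dir (((c + 5 : ℕ) : ℤ) * (Real.pi / 5)) := by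
    rw [dir_eq_dir_unit]
    exact ⟨((a + 2 * b : ℕ) : ℤ) / 10 - ((c + 5 : ℕ) : ℤ) / 10, by omega⟩
  have e1 : T.turn d.1.1 + a * (Real.pi / 5) + b * (2 * (Real.pi / 5)) =
      T.turn d.1.1 + ((a + 2 * b : ℕ) : ℤ) * (Real.pi / 5) := by push_cast; ring
  have e2 : T.turn d.1.1 + c * (Real.pi / 5) + Real.pi =
      T.turn d.1.1 + ((c + 5 : ℕ) : ℤ) * (Real.pi / 5) := by push_cast; ring
  rw [e1, e2, dir_add, dir_add, h1]

theorem exists_sector' (d : T.Dart) (γ : ℝ) : ∃ (e : T.Dart) (α : ℝ), e.pos = d.pos ∧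
    dir α = dir e.arg ∧ α ≤ γ ∧ γ ≤ α + e.size * (2 * (Real.pi / 5)) := by
  obtain ⟨e, he, n, h1, h2⟩ := d.exists_sector γ
  refine ⟨e, e.arg + (-n : ℤ) * (2 * Real.pi), he, dir_add_int _ _, ?_, ?_⟩ <;> push_cast <;> linarith

theorem eq_of_sectors' {d e : T.Dart} (h : d.pos = e.pos) {α β γ : ℝ} (hα : dir α = dir d.arg)
    (hβ : dir β = dir e.arg) (h1 : α < γ) (h2 : γ < α + d.size * (2 * (Real.pi / 5)))
    (h3 : β < γ) (h4 : γ < β + e.size * (2 * (Real.pi / 5))) : d = e ∧ α = β := by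
  obtain ⟨m, hm⟩ := dir_eq_dir_iff.1 hα
  obtain ⟨n, hn⟩ := dir_eq_dir_iff.1 hβ
  have hde : d = e := by
    refine eq_of_sectors h (γ := γ - m * (2 * Real.pi)) (n := m - n) ?_ ?_ ?_ ?_ <;>
    push_cast <;> linarith
  refine ⟨hde, ?_⟩
  subst hde
  -- The two sectors belong to one corner and both contain γ. They are narrower than a full turn, so
  -- their starting arguments cannot differ by a nonzero multiple of 2π.
  have hpi := Real.pi_pos
  have hs : (d.size : ℝ) ≤ 3 := by exact_mod_cast d.size_le
  have hs' : d.size * (2 * (Real.pi / 5)) < 2 * Real.pi := by nlinarith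
  have h5 : ((m - n : ℤ) : ℝ) * (2 * Real.pi) < 1 * (2 * Real.pi) := by push_cast; linarith
  have h6 : (-1 : ℝ) * (2 * Real.pi) < ((m - n : ℤ) : ℝ) * (2 * Real.pi) := by push_cast; linarith
  have h7 := lt_of_mul_lt_mul_right h5 (by positivity)
  have h8 := lt_of_mul_lt_mul_right h6 (by positivity)
  have h9 : m - n < 1 := by exact_mod_cast h7
  have h10 : -1 < m - n := by exact_mod_cast h8
  have : m = n := by omega
  rw [hm, hn, this]

/-- A corner is determined by its position and any of the directions in its sector. -/
theorem eq_of_dir {d e : T.Dart} (h : d.pos = e.pos) {m : ℕ} (hm : m < d.size)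
    (hd : dir e.arg = dir (d.arg + m * (2 * (Real.pi / 5)))) : d = e ∧ m = 0 := by
  have hpi := Real.pi_pos
  have h1 : (m : ℝ) + 1 ≤ d.size := by exact_mod_cast hm
  have h2 : (1 : ℝ) ≤ e.size := by exact_mod_cast e.size_pos
  have hm0 : (0 : ℝ) ≤ m := m.cast_nonneg
  obtain ⟨h3, h4⟩ := eq_of_sectors' h (α := d.arg) (β := d.arg + m * (2 * (Real.pi / 5)))
    (γ := d.arg + m * (2 * (Real.pi / 5)) + Real.pi / 5) rfl hd.symm (by nlinarith) (by nlinarith)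
    (by nlinarith) (by nlinarith)
  refine ⟨h3, ?_⟩
  have : (m : ℝ) * (2 * (Real.pi / 5)) = 0 := by linarith
  rcases mul_eq_zero.1 this with h | h
  · exact_mod_cast h
  · nlinarith

theorem exists_rot (d : T.Dart) : ∃ e : T.Dart, e.pos = d.pos ∧
    dir e.arg = dir (d.arg + d.size * (2 * (Real.pi / 5))) := by
  have hpi := Real.pi_pos
  set η := d.arg + d.size * (2 * (Real.pi / 5)) with hη
  have hsize : ∀ e : T.Dart, 2 * (Real.pi / 5) ≤ e.size * (2 * (Real.pi / 5)) := fun e => by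
    have h2 : (1 : ℝ) ≤ e.size := by exact_mod_cast e.size_pos
    nlinarith
  -- A sector that reaches beyond the end η of the sector of `d` starts at η or later, for otherwise
  -- the two would overlap.
  have key : ∀ (e : T.Dart) (α γ : ℝ), e.pos = d.pos → dir α = dir e.arg → η < γ →
      γ ≤ α + e.size * (2 * (Real.pi / 5)) → η ≤ α := by
    intro e α γ he hα hγ hγ'
    by_contra! hlt
    have hs := hsize d
    have hmax : max α d.arg < η := max_lt hlt (by linarith)
    have ha := le_max_left α d.arg
    have hb := le_max_right α d.arg
    obtain ⟨h1, h2⟩ := eq_of_sectors' he.symm (α := d.arg) (β := α) (γ := (max α d.arg + η) / 2)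
      rfl hα (by linarith) (by linarith) (by linarith) (by linarith)
    subst h1 h2
    linarith
  -- Sectors have width at least 2π/5. If the one containing η + π/5 left a gap after η, the sector
  -- covering the middle of the gap would overlap it.
  obtain ⟨e, α, he, hα, h1, h2⟩ := d.exists_sector' (η + Real.pi / 5)
  have h3 := key e α _ he hα (by linarith) h2
  rcases h3.eq_or_lt with h3 | h3
  · exact ⟨e, he, by rw [← hα, h3]⟩
  obtain ⟨e', α', he', hα', h1', h2'⟩ := d.exists_sector' ((η + α) / 2)
  have h3' := key e' α' _ he' hα' (by linarith) h2'
  rcases h3'.eq_or_lt with h3' | h3'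
  · exact ⟨e', he', by rw [← hα', h3']⟩
  exfalso
  have s1 := hsize e
  have s2 := hsize e'
  obtain ⟨-, h5⟩ := eq_of_sectors' (he.trans he'.symm) (α := α) (β := α')
    (γ := (α + (η + 2 * (Real.pi / 5))) / 2) hα hα'
    (by linarith) (by linarith) (by linarith) (by linarith)
  linarith

/-- The next corner around the same vertex. -/
noncomputable def rot (d : T.Dart) : T.Dart := d.exists_rot.choose

theorem pos_rot (d : T.Dart) : d.rot.pos = d.pos := d.exists_rot.choose_spec.1

theorem dir_rot (d : T.Dart) : dir d.rot.arg = dir (d.arg + d.size * (2 * (Real.pi / 5))) :=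
  d.exists_rot.choose_spec.2

theorem eq_of_pos_dir {d e : T.Dart} (h : d.pos = e.pos) (hd : dir d.arg = dir e.arg) : d = e :=
  (eq_of_dir h (m := 0) d.size_pos (by simp [hd])).1

/-- `d.next.rot` starts where `d.next` stands and runs back along the side of `d`, so doing this
twice restores position and direction. -/
theorem opp_opp (d : T.Dart) : d.next.rot.next.rot = d := by
  have h1 : dir d.next.rot.arg = -dir d.arg := by rw [dir_rot, dir_arg_next]
  apply eq_of_pos_dir
  · rw [pos_rot, pos_next, pos_rot, pos_next, h1]; ring
  · rw [dir_rot, dir_arg_next, h1, neg_neg]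

theorem colour_rot (d : T.Dart) : d.rot.colour = d.colour := colour_eq d.pos_rot

/-- The corner across a side ends where the side starts. -/
theorem pos_opp_next (d : T.Dart) : d.next.rot.next.pos = d.pos := by
  rw [← pos_rot, opp_opp]

theorem colour_opp_next (d : T.Dart) : d.next.rot.next.colour = d.colour := colour_eq d.pos_opp_next

theorem dir_add_mul_five (x : ℝ) : dir (x + 5 * (2 * (Real.pi / 5))) = dir x :=
  dir_eq_dir_iff.2 ⟨1, by push_cast; ring⟩

theorem dir_rot_add (d : T.Dart) (y : ℝ) :
    dir (d.rot.arg + y) = dir (d.arg + d.size * (2 * (Real.pi / 5)) + y) := by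
  rw [dir_add, dir_rot, ← dir_add]

/-- At a blue vertex, two corners meet. -/
theorem rot_rot_of_size {d : T.Dart} (h : 2 ≤ d.size) (h' : 2 ≤ d.rot.size)
    (h'' : 2 ≤ d.rot.rot.size) : d.rot.rot = d ∧ d.size + d.rot.size = 5 := by
  have e1 : ∀ y, dir (d.rot.rot.arg + y) = dir (d.arg + (d.size + d.rot.size : ℕ) *
      (2 * (Real.pi / 5)) + y) := fun y => by
    rw [dir_rot_add, add_assoc, dir_rot_add]; congr 1; push_cast; ring
  have hp : d.rot.rot.pos = d.pos := by rw [pos_rot, pos_rot]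
  have hs := d.size_le
  have hs' := d.rot.size_le
  obtain h5 | h5 | h5 : d.size + d.rot.size = 5 ∨ d.size + d.rot.size = 4 ∨
    d.size + d.rot.size = 6 := by omega
  · refine ⟨eq_of_pos_dir hp ?_, h5⟩
    have := e1 0
    rw [add_zero, add_zero, h5] at this
    rw [this]
    exact_mod_cast dir_add_mul_five d.arg
  -- Sizes 2 and 2 leave one unit, too little for the third corner: `d` would start inside its
  -- sector.
  · exfalso
    have := eq_of_dir hp (m := 1) (by omega) (by
      rw [e1, h5, ← dir_add_mul_five d.arg]; congr 1; push_cast; ring)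
    omega
  -- Sizes 3 and 3 exceed a full turn: `d` would start inside the sector of `d.rot`.
  · exfalso
    have h3 : d.size = 3 := by omega
    have := eq_of_dir (d.pos_rot) (m := 2) (by omega) (by
      rw [dir_rot_add, h3, ← dir_add_mul_five d.arg]; congr 1; push_cast; ring)
    omega

theorem dir_rot_iterate (d : T.Dart) (n : ℕ) : dir (rot^[n] d).arg =
    dir (d.arg + (∑ k ∈ Finset.range n, (rot^[k] d).size : ℕ) * (2 * (Real.pi / 5))) := by
  induction n with
  | zero => simp
  | succ n ih =>
    rw [Function.iterate_succ_apply', dir_rot, Finset.sum_range_succ, dir_add, ih, ← dir_add]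
    congr 1; push_cast; ring

theorem pos_rot_iterate (d : T.Dart) (n : ℕ) : (rot^[n] d).pos = d.pos := by
  induction n with
  | zero => rfl
  | succ n ih => rw [Function.iterate_succ_apply', pos_rot, ih]

theorem rot_iterate_eq {d : T.Dart} {n : ℕ} (h : ∑ k ∈ Finset.range n, (rot^[k] d).size = 5) :
    rot^[n] d = d := by
  refine eq_of_pos_dir (d.pos_rot_iterate n) ?_
  rw [dir_rot_iterate, h]
  exact_mod_cast dir_add_mul_five d.arg

/-- The unit sectors at a vertex are covered by the corners found by rotation. -/
theorem exists_cover (d : T.Dart) (m : ℕ) : ∃ (e : T.Dart) (j : ℕ), e.pos = d.pos ∧ j < e.size ∧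
    dir (e.arg + j * (2 * (Real.pi / 5))) = dir (d.arg + m * (2 * (Real.pi / 5))) := by
  induction m with
  | zero => exact ⟨d, 0, rfl, d.size_pos, rfl⟩
  | succ m ih =>
    obtain ⟨e, j, h1, h2, h3⟩ := ih
    have h4 : dir (e.arg + (j + 1 : ℕ) * (2 * (Real.pi / 5))) =
        dir (d.arg + (m + 1 : ℕ) * (2 * (Real.pi / 5))) := by
      have e1 : e.arg + (j + 1 : ℕ) * (2 * (Real.pi / 5)) =
        e.arg + j * (2 * (Real.pi / 5)) + 2 * (Real.pi / 5) := by push_cast; ring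
      have e2 : d.arg + (m + 1 : ℕ) * (2 * (Real.pi / 5)) =
        d.arg + m * (2 * (Real.pi / 5)) + 2 * (Real.pi / 5) := by push_cast; ring
      rw [e1, e2, dir_add, h3, ← dir_add]
    by_cases hj : j + 1 < e.size
    · exact ⟨e, j + 1, h1, hj, h4⟩
    · refine ⟨e.rot, 0, by rw [pos_rot, h1], e.rot.size_pos, ?_⟩
      have : j + 1 = e.size := by omega
      rw [← h4, this, Nat.cast_zero, zero_mul, add_zero, dir_rot]

/-- The corners at a vertex are aligned. -/
theorem exists_aligned {d e : T.Dart} (h : e.pos = d.pos) :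
    ∃ m : ℕ, m < 5 ∧ dir e.arg = dir (d.arg + m * (2 * (Real.pi / 5))) := by
  have hpi := Real.pi_pos
  obtain ⟨n, hn, -⟩ := existsUnique_add_zsmul_mem_Ico Real.two_pi_pos e.arg d.arg
  rw [zsmul_eq_mul] at hn
  set β := e.arg + n * (2 * Real.pi) with hβ
  have hdβ : dir β = dir e.arg := dir_add_int _ _
  set m := ⌊(β - d.arg) / (2 * (Real.pi / 5))⌋₊ with hm
  have hc : 0 < 2 * (Real.pi / 5) := by positivity
  have hm1 : m * (2 * (Real.pi / 5)) ≤ β - d.arg :=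
    (le_div_iff₀ hc).1 (Nat.floor_le (div_nonneg (by linarith [hn.1]) hc.le))
  have hm2 : β - d.arg < (m + 1) * (2 * (Real.pi / 5)) :=
    (div_lt_iff₀ hc).1 (Nat.lt_floor_add_one _)
  obtain ⟨c, j, hc1, hc2, hc3⟩ := d.exists_cover m
  set α := d.arg + m * (2 * (Real.pi / 5)) - j * (2 * (Real.pi / 5)) with hα
  have hdα : dir α = dir c.arg := by
    have e1 : α = d.arg + m * (2 * (Real.pi / 5)) + (-(j * (2 * (Real.pi / 5)))) := by rw [hα]; ring
    rw [e1, dir_add, ← hc3, ← dir_add]; congr 1; ring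
  have hj : (j : ℝ) + 1 ≤ c.size := by exact_mod_cast hc2
  have hj0 : (0 : ℝ) ≤ j * (2 * (Real.pi / 5)) := by positivity
  have hj1 : ((j : ℝ) + 1) * (2 * (Real.pi / 5)) ≤ c.size * (2 * (Real.pi / 5)) := by gcongr
  have h2 : (1 : ℝ) ≤ e.size := by exact_mod_cast e.size_pos
  have h2' : 2 * (Real.pi / 5) ≤ e.size * (2 * (Real.pi / 5)) := by nlinarith
  -- The corner `c` covers the unit sector containing the start β of `e`, so the sectors of `c` and
  -- `e` overlap and start together, at m - j units from `d`.
  obtain ⟨-, h5⟩ := eq_of_sectors' (hc1.trans h.symm)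
    (γ := (β + (d.arg + (m + 1) * (2 * (Real.pi / 5)))) / 2) hdα hdβ
    (by linarith) (by linarith) (by linarith) (by linarith)
  have hjs : j < 5 := by have := c.size_le; omega
  refine ⟨(m + 5 - j) % 5, Nat.mod_lt _ (by norm_num), ?_⟩
  rw [← hdβ, ← h5, dir_eq_dir_iff]
  refine ⟨((m + 5 - j) / 5 : ℕ) - 1, ?_⟩
  have h6 := Nat.div_add_mod (m + 5 - j) 5
  have h7 : (5 : ℝ) * ((m + 5 - j) / 5 : ℕ) + ((m + 5 - j) % 5 : ℕ) = m + 5 - j := by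
    have : ((5 * ((m + 5 - j) / 5) + (m + 5 - j) % 5 : ℕ) : ℝ) = ((m + 5 - j : ℕ) : ℝ) := by rw [h6]
    rw [Nat.cast_sub (by omega)] at this
    push_cast at this ⊢
    exact this
  generalize (m + 5 - j) / 5 = q at *
  generalize (m + 5 - j) % 5 = s at *
  rw [hα]
  push_cast
  linear_combination (-(2 * (Real.pi / 5))) * h7

end Dart
end StarTiling
-- Suppressing the blue vertices: the star map of a tiling
namespace Proto

/-- The label of a corner of a prototile. -/
def lab : Proto → Fin 5 × Bool → Lab
  | .H, (k, false) => ![.Hg0, .Hg1, .out, .Hr2, .out] k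
  | .H, (k, true) => ![.Hr1, .out, .out, .out, .out] k
  | .B, (k, false) => ![.Bg0, .out, .out, .Bg1, .out] k
  | .B, (k, true) => ![.Br0, .Bm, .Br1, .out, .out] k
  | .S0, (_, false) | .S1, (_, false) | .S2, (_, false) => .out
  | .S0, (_, true) => .Sg
  | .S1, (k, true) => ![.Sr, .Sg, .Sg, .Sg, .Sg] k
  | .S2, (k, true) => ![.Sr, .Sg, .Sr, .Sg, .Sg] k

/-- The next corner of a prototile which is not blue. -/
def skip (P : Proto) (x : Fin 5 × Bool) : Fin 5 × Bool :=
  if P.colour (P.succ x) = .blue then P.succ (P.succ x) else P.succ x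

/-- What a corner of a prototile tells about the side before it: the colours of the ends and, if the
far end is blue, the size of the other corner at that end and the colour beyond. -/
def before (P : Proto) (x : Fin 5 × Bool) : Colour × Colour × ℕ × Colour :=
  (P.colour x, P.colour (P.pred x), if P.colour (P.pred x) = .blue then
    (5 - P.size (P.pred x), P.colour (P.pred (P.pred x))) else (0, .blue))

/-- What a corner of a prototile tells about the side after it. -/
def after (P : Proto) (x : Fin 5 × Bool) : Colour × Colour × ℕ × Colour :=
  (P.colour x, P.colour (P.succ x), if P.colour (P.succ x) = .blue then
    (P.size (P.succ x), P.colour (P.succ (P.succ x))) else (0, .blue))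

variable (P : Proto) {x : Fin 5 × Bool}

theorem lab_eq_out : P.lab x = .out ↔ P.colour x = .blue := by
  cases P <;> revert x <;> decide

theorem size_of_blue (hx : P.gap x.1 ≠ 0) (h : P.colour x = .blue) : 2 ≤ P.size x := by
  revert hx h; cases P <;> revert x <;> decide

theorem size_of_red (hx : P.gap x.1 ≠ 0) (h : P.colour x = .red) : P.size x = 1 := by
  revert hx h; cases P <;> revert x <;> decide

theorem colour_of_lab : P.colour x = match P.lab x with
    | .Hg0 | .Hg1 | .Bg0 | .Bg1 | .Bm | .Sg => .green
    | .Hr1 | .Hr2 | .Br0 | .Br1 | .Sr => .red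
    | .out => .blue := by
  cases P <;> revert x <;> decide

theorem size_of_lab : match P.lab x with
    | .Hg0 | .Hg1 | .Bg0 | .Bg1 => P.size x = 2
    | .out => True
    | _ => P.size x = 1 := by
  obtain ⟨k, _ | _⟩ := x <;> cases P <;> fin_cases k <;>
    first | exact rfl | exact trivial

theorem skip_iterate_four (h : P.lab x = .Hg0 ∨ P.lab x = .Hr1 ∨ P.lab x = .Hg1 ∨ P.lab x = .Hr2) :
    P.skip (P.skip (P.skip (P.skip x))) = x := by
  revert h; cases P <;> revert x <;> decide

theorem skip_iterate_five (h : P.lab x = .Bg0 ∨ P.lab x = .Br0 ∨ P.lab x = .Bm ∨ P.lab x = .Br1 ∨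
    P.lab x = .Bg1 ∨ P.lab x = .Sr ∨ P.lab x = .Sg) :
    P.skip (P.skip (P.skip (P.skip (P.skip x)))) = x := by
  revert h; cases P <;> revert x <;> decide

theorem lab_skip : match P.lab x with
    | .Hg0 => P.lab (P.skip x) = .Hr1
    | .Hr1 => P.lab (P.skip x) = .Hg1
    | .Hg1 => P.lab (P.skip x) = .Hr2
    | .Hr2 => P.lab (P.skip x) = .Hg0
    | .Bg0 => P.lab (P.skip x) = .Br0
    | .Br0 => P.lab (P.skip x) = .Bm
    | .Bm => P.lab (P.skip x) = .Br1
    | .Br1 => P.lab (P.skip x) = .Bg1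
    | .Bg1 => P.lab (P.skip x) = .Bg0
    | .Sr => P.lab (P.skip x) = .Sg
    | .Sg => P.lab (P.skip x) = .Sr ∨ P.lab (P.skip x) = .Sg
    | .out => True := by
  obtain ⟨k, _ | _⟩ := x <;> cases P <;> fin_cases k <;>
    first | exact rfl | exact trivial | exact .inl rfl | exact .inr rfl 

theorem before_of_lab : match P.lab x with
    | .Hg0 => P.before x = (.green, .blue, 3, .red)
    | .Bg0 => P.before x = (.green, .blue, 3, .green)
    | .Bm => P.before x = (.green, .blue, 2, .red)
    | .Sg => P.before x = (.green, .blue, 2, .red) ∨ P.before x = (.green, .blue, 2, .green)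
    | .Hg1 | .Bg1 => P.before x = (.green, .red, 0, .blue)
    | .Hr1 | .Br0 => P.before x = (.red, .green, 0, .blue)
    | .Hr2 => P.before x = (.red, .blue, 3, .green)
    | .Br1 | .Sr => P.before x = (.red, .blue, 2, .green)
    | .out => True := by
  obtain ⟨k, _ | _⟩ := x <;> cases P <;> fin_cases k <;>
    first | exact rfl | exact trivial | exact .inl rfl | exact .inr rfl 

theorem before_skip : match P.lab x with
    | .Sr => P.before (P.skip x) = (.green, .blue, 2, .red)
    | .Sg => P.lab (P.skip x) = .Sg → P.before (P.skip x) = (.green, .blue, 2, .green)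
    | _ => True := by
  obtain ⟨k, _ | _⟩ := x <;> cases P <;> fin_cases k <;>
    first | exact rfl | exact trivial | exact .inl rfl | exact .inr rfl | exact fun _ => rfl |
      exact fun h => nomatch h

theorem lab_of_after (hx : P.gap x.1 ≠ 0) :
    (P.after x = (.green, .blue, 3, .red) →
      P.lab x = .Bm ∨ (P.lab x = .Sg ∧ P.lab (P.skip x) = .Sr)) ∧
    (P.after x = (.green, .blue, 3, .green) → P.lab x = .Sg ∧ P.lab (P.skip x) = .Sg) ∧
    (P.after x = (.green, .blue, 2, .red) → P.lab x = .Hg1) ∧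
    (P.after x = (.green, .blue, 2, .green) → P.lab x = .Bg1) ∧
    (P.after x = (.green, .red, 0, .blue) → P.lab x = .Hg0 ∨ P.lab x = .Bg0) ∧
    (P.after x = (.red, .green, 0, .blue) → P.lab x = .Hr1 ∨ P.lab x = .Br1) ∧
    (P.after x = (.red, .blue, 3, .green) → P.lab x = .Br0 ∨ P.lab x = .Sr) ∧
    (P.after x = (.red, .blue, 2, .green) → P.lab x = .Hr2) := by
  refine ⟨?_, ?_, ?_, ?_, ?_, ?_, ?_, ?_⟩ <;> revert hx <;> cases P <;> revert x <;> decide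

end Proto

namespace StarTiling
variable {ι : Type*} {T : StarTiling ι}

namespace Dart

/-- The label of a corner. -/
def lab (d : T.Dart) : Lab := (T.proto d.1.1).lab d.1.2

/-- The next corner of the same tile which is not blue. -/
def skip (d : T.Dart) : T.Dart := if d.next.colour = .blue then d.next.next else d.next

theorem skip_val (d : T.Dart) : d.skip.1 = (d.1.1, (T.proto d.1.1).skip d.1.2) := by
  unfold skip Proto.skip
  change (if (T.proto d.1.1).colour ((T.proto d.1.1).succ d.1.2) = .blue then d.next.next
    else d.next).1 = _
  split_ifs <;> rfl

theorem lab_skip (d : T.Dart) : d.skip.lab = (T.proto d.1.1).lab ((T.proto d.1.1).skip d.1.2) := by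
  rw [lab, skip_val]

theorem rot_rot_of_blue {d : T.Dart} (h : d.colour = .blue) :
    d.rot.rot = d ∧ d.size + d.rot.size = 5 :=
  rot_rot_of_size (Proto.size_of_blue _ d.2 h)
    (Proto.size_of_blue _ d.rot.2 ((colour_rot d).trans h))
    (Proto.size_of_blue _ d.rot.rot.2 ((colour_rot _).trans ((colour_rot d).trans h)))

/-- At a blue vertex there are only two corners, so turning either way gives the same one. -/
theorem rot_of_opp {b : T.Dart} (hb : b.colour = .blue) : b.rot = b.next.rot.next := by
  have h := rot_rot_of_blue (d := b.next.rot.next) (b.colour_opp_next.trans hb)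
  rw [b.opp_opp] at h
  exact h.1

/-- The corners `d` and `d.rot` see the same side from its two faces. Together with the tables
`before_of_lab` and `lab_of_after` this yields all transitions of `rot`. -/
theorem after_rot (d : T.Dart) :
    (T.proto d.rot.1.1).after d.rot.1.2 = (T.proto d.1.1).before d.1.2 := by
  change (d.rot.colour, d.rot.next.colour, if d.rot.next.colour = .blue then
    (d.rot.next.size, d.rot.next.next.colour) else (0, .blue)) =
    (d.colour, d.prev.colour, if d.prev.colour = .blue then
    (5 - d.prev.size, d.prev.prev.colour) else (0, .blue))
  have h1 : d.rot.next.colour = d.prev.colour := by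
    conv_lhs => rw [← d.next_prev]
    exact d.prev.colour_opp_next
  rw [colour_rot, h1]
  split_ifs with hb
  · have h2 := rot_of_opp hb
    rw [next_prev] at h2
    have h3 := (rot_rot_of_blue hb).2
    have h4 := d.prev.prev.colour_opp_next
    rw [next_prev] at h4
    rw [← h2, h4]
    congr 3
    omega
  · rfl

/-- If the side is bent at a blue vertex, the neighbouring tile also skips that vertex, and only the
unit side next to `d` is crossed twice. -/
theorem skip_opp_opp {d : T.Dart} (h : d.lab ≠ .out) : d.skip.rot.skip.rot = d := by
  have hd : d.colour ≠ .blue := fun h' => h ((Proto.lab_eq_out _).2 h')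
  by_cases hb : d.next.colour = .blue
  · have h1 : d.skip = d.next.next := if_pos hb
    have h2 := rot_of_opp hb
    rw [h1]
    have h3 : d.next.next.rot.skip = d.next.rot.next := by
      rw [skip, ← h2, if_pos (by rw [colour_rot, hb])]
    rw [h3, opp_opp]
  · have h1 : d.skip = d.next := if_neg hb
    have h2 : d.next.rot.skip = d.next.rot.next := if_neg (by rwa [colour_opp_next])
    rw [h1, h2, opp_opp]

theorem colour_of_lab (d : T.Dart) : d.colour = match d.lab with
    | .Hg0 | .Hg1 | .Bg0 | .Bg1 | .Bm | .Sg => .green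
    | .Hr1 | .Hr2 | .Br0 | .Br1 | .Sr => .red
    | .out => .blue := Proto.colour_of_lab _

theorem size_of_red {d : T.Dart} (h : d.colour = .red) : d.size = 1 := Proto.size_of_red _ d.2 h

theorem size_of_lab (d : T.Dart) : match d.lab with
    | .Hg0 | .Hg1 | .Bg0 | .Bg1 => d.size = 2
    | .out => True
    | _ => d.size = 1 := Proto.size_of_lab _

theorem colour_rot_iterate (d : T.Dart) (n : ℕ) : (rot^[n] d).colour = d.colour :=
  colour_eq (d.pos_rot_iterate n)

theorem rot_of_red {d : T.Dart} (h : d.colour = .red) : d.rot.rot.rot.rot.rot = d :=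
  rot_iterate_eq (n := 5) (by
    rw [Finset.sum_congr rfl fun k _ => size_of_red ((d.colour_rot_iterate k).trans h)]; rfl)

theorem rot_of_base {d : T.Dart} (h : d.lab = .Hg0 ∨ d.lab = .Bg0) :
    d.rot.lab = .Bm ∨ d.rot.lab = .Sg := by
  have h1 := Proto.before_of_lab (T.proto d.1.1) (x := d.1.2)
  have h2 := Proto.lab_of_after (T.proto d.rot.1.1) d.rot.2
  rw [after_rot] at h2
  unfold lab at *
  rcases h with h | h <;> rw [h] at h1 <;> simp_all; tauto

theorem rot_of_tip {d : T.Dart} (h : d.lab = .Bm ∨ d.lab = .Sg) :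
    d.rot.lab = .Hg1 ∨ d.rot.lab = .Bg1 := by
  have h1 := Proto.before_of_lab (T.proto d.1.1) (x := d.1.2)
  have h2 := Proto.lab_of_after (T.proto d.rot.1.1) d.rot.2
  rw [after_rot] at h2
  unfold lab at *
  rcases h with h | h <;> rw [h] at h1 <;> simp_all
  rcases h1 with h1 | h1 <;> simp_all

theorem rot_of_flank {d : T.Dart} (h : d.lab = .Hg1 ∨ d.lab = .Bg1) :
    d.rot.lab = .Hg0 ∨ d.rot.lab = .Bg0 := by
  have h1 := Proto.before_of_lab (T.proto d.1.1) (x := d.1.2)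
  have h2 := Proto.lab_of_after (T.proto d.rot.1.1) d.rot.2
  rw [after_rot] at h2
  unfold lab at *
  rcases h with h | h <;> rw [h] at h1 <;> simp_all

theorem lab_of_green {d : T.Dart} (h : d.colour = .green) : (d.lab = .Hg0 ∨ d.lab = .Bg0) ∨
    (d.lab = .Bm ∨ d.lab = .Sg) ∨ (d.lab = .Hg1 ∨ d.lab = .Bg1) := by
  rw [d.colour_of_lab] at h
  cases hd : d.lab <;> rw [hd] at h <;> first | (simp; done) | cases h

theorem size_of_base {d : T.Dart} (h : d.lab = .Hg0 ∨ d.lab = .Bg0) : d.size = 2 := by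
  have := d.size_of_lab
  rcases h with h | h <;> rwa [h] at this

theorem size_of_flank {d : T.Dart} (h : d.lab = .Hg1 ∨ d.lab = .Bg1) : d.size = 2 := by
  have := d.size_of_lab
  rcases h with h | h <;> rwa [h] at this

theorem size_of_tip {d : T.Dart} (h : d.lab = .Bm ∨ d.lab = .Sg) : d.size = 1 := by
  have := d.size_of_lab
  rcases h with h | h <;> rwa [h] at this

/-- The corners at a green vertex run cyclically through base, tip and flank, of sizes 2, 1 and 2,
which fill the turn. -/
theorem rot_of_green {d : T.Dart} (h : d.colour = .green) : d.rot.rot.rot = d := by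
  apply rot_iterate_eq (n := 3)
  simp only [Finset.sum_range_succ, Finset.sum_range_zero, Function.iterate_zero, id,
    Function.iterate_succ, Function.comp, zero_add]
  rcases lab_of_green h with h0 | h0 | h0
  · have h1 := rot_of_base h0
    have h2 := rot_of_tip h1
    rw [size_of_base h0, size_of_tip h1, size_of_flank h2]
  · have h1 := rot_of_tip h0
    have h2 := rot_of_flank h1
    rw [size_of_tip h0, size_of_flank h1, size_of_base h2]
  · have h1 := rot_of_flank h0
    have h2 := rot_of_base h1
    rw [size_of_flank h0, size_of_base h1, size_of_tip h2]

theorem lab_skip_spec (d : T.Dart) : match d.lab with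
    | .Hg0 => d.skip.lab = .Hr1
    | .Hr1 => d.skip.lab = .Hg1
    | .Hg1 => d.skip.lab = .Hr2
    | .Hr2 => d.skip.lab = .Hg0
    | .Bg0 => d.skip.lab = .Br0
    | .Br0 => d.skip.lab = .Bm
    | .Bm => d.skip.lab = .Br1
    | .Br1 => d.skip.lab = .Bg1
    | .Bg1 => d.skip.lab = .Bg0
    | .Sr => d.skip.lab = .Sg
    | .Sg => d.skip.lab = .Sr ∨ d.skip.lab = .Sg
    | .out => True := by
  simp only [lab_skip]
  exact (T.proto d.1.1).lab_skip

theorem lab_rot_spec (d : T.Dart) : match d.lab with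
    | .Hg0 => d.rot.lab = .Bm ∨ (d.rot.lab = .Sg ∧ d.rot.skip.lab = .Sr)
    | .Bg0 => d.rot.lab = .Sg ∧ d.rot.skip.lab = .Sg
    | .Bm => d.rot.lab = .Hg1
    | .Hg1 => d.rot.lab = .Hg0 ∨ d.rot.lab = .Bg0
    | .Bg1 => d.rot.lab = .Hg0 ∨ d.rot.lab = .Bg0
    | .Hr1 => d.rot.lab = .Hr1 ∨ d.rot.lab = .Br1
    | .Hr2 => d.rot.lab = .Br0 ∨ d.rot.lab = .Sr
    | .Br0 => d.rot.lab = .Hr1 ∨ d.rot.lab = .Br1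
    | .Br1 => d.rot.lab = .Hr2
    | .Sr => d.rot.lab = .Hr2
    | _ => True := by
  have h1 := Proto.before_of_lab (T.proto d.1.1) (x := d.1.2)
  have h2 := Proto.lab_of_after (T.proto d.rot.1.1) d.rot.2
  rw [after_rot] at h2
  simp only [lab_skip]
  unfold lab
  cases h : (T.proto d.1.1).lab d.1.2 <;> rw [h] at h1 <;> dsimp only at h1 ⊢ <;>
    first | trivial | (rw [h1] at h2; simpa using h2)

theorem lab_rot_skip_spec (d : T.Dart) : match d.lab with
    | .Sr => d.skip.rot.lab = .Hg1
    | .Sg => d.skip.lab = .Sg → d.skip.rot.lab = .Bg1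
    | _ => True := by
  have h1 := Proto.before_skip (T.proto d.1.1) (x := d.1.2)
  have h2 := Proto.lab_of_after (T.proto d.skip.rot.1.1) d.skip.rot.2
  rw [after_rot, skip_val] at h2
  dsimp only at h2
  simp only [lab_skip]
  unfold lab
  cases h : (T.proto d.1.1).lab d.1.2 <;> rw [h] at h1 <;> dsimp only at h1 ⊢
  case Sr => rw [h1] at h2; simpa using h2
  case Sg => intro h3; rw [h1 h3] at h2; simpa using h2

end Dart

variable (T) in
/-- The star map of a tiling. -/
noncomputable def starMap : StarMap T.Dart where
  lab := Dart.lab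
  next := Dart.skip
  rot := Dart.rot
  next_Hg0 d h := by have := d.lab_skip_spec; rwa [h] at this
  next_Hr1 d h := by have := d.lab_skip_spec; rwa [h] at this
  next_Hg1 d h := by have := d.lab_skip_spec; rwa [h] at this
  next_Hr2 d h := by have := d.lab_skip_spec; rwa [h] at this
  next_Bg0 d h := by have := d.lab_skip_spec; rwa [h] at this
  next_Br0 d h := by have := d.lab_skip_spec; rwa [h] at this
  next_Bm d h := by have := d.lab_skip_spec; rwa [h] at this
  next_Br1 d h := by have := d.lab_skip_spec; rwa [h] at this
  next_Bg1 d h := by have := d.lab_skip_spec; rwa [h] at this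
  next_Sr d h := by have := d.lab_skip_spec; rwa [h] at this
  next_Sg d h := by have := d.lab_skip_spec; rwa [h] at this
  next_H d h := Subtype.ext (by simp only [Dart.skip_val]; rw [Proto.skip_iterate_four _ h])
  next_BS d h := Subtype.ext (by simp only [Dart.skip_val]; rw [Proto.skip_iterate_five _ h])
  rot_Hg0 d h := by have := d.lab_rot_spec; rwa [h] at this
  rot_Bg0 d h := by have := d.lab_rot_spec; rwa [h] at this
  rot_Bm d h := by have := d.lab_rot_spec; rwa [h] at this
  rot_next_Sr d h := by have := d.lab_rot_skip_spec; rwa [h] at this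
  rot_next_Sg d h := by have := d.lab_rot_skip_spec; rwa [h] at this
  rot_Hg1 d h := by have := d.lab_rot_spec; rwa [h] at this
  rot_Bg1 d h := by have := d.lab_rot_spec; rwa [h] at this
  rot_Hr1 d h := by have := d.lab_rot_spec; rwa [h] at this
  rot_Hr2 d h := by have := d.lab_rot_spec; rwa [h] at this
  rot_Br0 d h := by have := d.lab_rot_spec; rwa [h] at this
  rot_Br1 d h := by have := d.lab_rot_spec; rwa [h] at this
  rot_Sr d h := by have := d.lab_rot_spec; rwa [h] at this
  rot_green d h := Dart.rot_of_green (by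
    rw [Dart.colour_of_lab]; rcases h with h | h | h | h | h | h <;> rw [h])
  rot_red d h := Dart.rot_of_red (by
    rw [Dart.colour_of_lab]; rcases h with h | h | h | h | h <;> rw [h])
  opp_opp d h := Dart.skip_opp_opp h

theorem bddMove_rot (x : ℂ) :
    StarMap.BddMove (fun d : T.Dart => dist d.pos x) (T.starMap).rot :=
  ⟨0, fun d => by simp [starMap, Dart.pos_rot]⟩

theorem bddMove_next (x : ℂ) :
    StarMap.BddMove (fun d : T.Dart => dist d.pos x) (T.starMap).next := by
  have h1 : ∀ d : T.Dart, |dist d.next.pos x - dist d.pos x| ≤ 1 := fun d => by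
    refine (abs_dist_sub_le _ _ _).trans ?_
    rw [Dart.pos_next, dist_eq_norm, add_sub_cancel_left, norm_dir]
  -- A side is a unit segment, or two of them if it is bent.
  refine ⟨2, fun d => ?_⟩
  change |dist d.skip.pos x - dist d.pos x| ≤ 2
  have ha := abs_le.1 (h1 d)
  have hb := abs_le.1 (h1 d.next)
  unfold Dart.skip
  split_ifs <;> rw [abs_le] <;> constructor <;> linarith [ha.1, ha.2, hb.1, hb.2]

end StarTiling
-- From corners to tiles and vertices
namespace StarTiling
variable {ι : Type*} (T : StarTiling ι)

theorem darts_ncard_le {A : Set ι} (hA : A.Finite) :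
    {d : T.Dart | d.1.1 ∈ A}.Finite ∧ {d : T.Dart | d.1.1 ∈ A}.ncard ≤ A.ncard * 10 := by
  have h1 : Set.MapsTo Subtype.val {d : T.Dart | d.1.1 ∈ A} (A ×ˢ (Set.univ : Set (Fin 5 × Bool))) :=
    fun d hd => ⟨hd, trivial⟩
  have h2 : (A ×ˢ (Set.univ : Set (Fin 5 × Bool))).Finite := hA.prod Set.finite_univ
  refine ⟨Set.Finite.of_injOn h1 Subtype.val_injective.injOn h2, ?_⟩
  refine (Set.ncard_le_ncard_of_injOn _ h1 Subtype.val_injective.injOn h2).trans ?_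
  rw [Set.ncard_prod, Set.ncard_univ, Nat.card_eq_fintype_card]
  rfl

theorem dist_pos_center (d : T.Dart) : dist d.pos (T.center d.1.1) ≤ 4 :=
  T.dist_center_le d.pos_mem_tile

theorem planar (x : ℂ) : Planar (fun d : T.Dart => dist d.pos x) := by
  have hpi := Real.pi_pos
  have hε := inradius_pos
  have hle : ∀ r : ℝ, {d : T.Dart | dist d.pos x ≤ r} ⊆
      {d | d.1.1 ∈ {i | dist (T.center i) x ≤ r + 4}} := fun r d (hd : dist d.pos x ≤ r) => by
    have := dist_triangle_left (T.center d.1.1) x d.pos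
    have := T.dist_pos_center d
    simp only [Set.mem_ofPred_eq]
    linarith
  have hfin : ∀ r : ℝ, {i | dist (T.center i) x ≤ r}.Finite := fun r =>
    (T.tiles_closedBall x (le_max_right r 0)).1.subset fun i (hi : _ ≤ r) => hi.trans (le_max_left _ _)
  have hann : ∀ L r : ℝ, {d : T.Dart | |dist d.pos x - r| ≤ L} ⊆
      {d | d.1.1 ∈ {i | |dist (T.center i) x - r| ≤ |L| + 4}} :=
    fun L r d (hd : |dist d.pos x - r| ≤ L) => by
    have h1 := abs_dist_sub_le (T.center d.1.1) d.pos x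
    rw [dist_comm (T.center d.1.1) d.pos] at h1
    have h2 := T.dist_pos_center d
    have h3 := abs_sub_le (dist (T.center d.1.1) x) (dist d.pos x) r
    have h4 := le_abs_self L
    simp only [Set.mem_ofPred_eq]
    linarith
  have hc : 0 < Real.pi * inradius ^ 2 := by positivity
  refine ⟨fun r => (T.darts_ncard_le (hfin (r + 4))).1.subset (hle r), ?_, fun L => ?_⟩
  -- At most 10 corners per tile, and (r + 5)² ≤ 36 r² for r ≥ 1.
  · refine Asymptotics.IsBigO.of_bound (360 * Real.pi / (Real.pi * inradius ^ 2)) ?_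
    filter_upwards [eventually_ge_atTop 1] with r hr
    have h1 := T.darts_ncard_le (hfin (r + 4))
    have h2 := (T.tiles_closedBall x (show 0 ≤ r + 4 by linarith)).2
    have h3 : count (fun d : T.Dart => dist d.pos x) Set.univ r ≤
        ({i | dist (T.center i) x ≤ r + 4}.ncard : ℝ) * 10 := by
      unfold count
      have : {d ∈ (Set.univ : Set T.Dart) | dist d.pos x ≤ r} ⊆
        {d | d.1.1 ∈ {i | dist (T.center i) x ≤ r + 4}} := fun d hd => hle r hd.2
      exact_mod_cast (Set.ncard_le_ncard this h1.1).trans h1.2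
    rw [Real.norm_of_nonneg (count_nonneg _ _), Real.norm_of_nonneg (sq_nonneg r),
      div_mul_eq_mul_div, le_div_iff₀ hc]
    have h4 : Real.pi * (r + 4 + 1) ^ 2 ≤ Real.pi * (36 * r ^ 2) := by gcongr; nlinarith
    nlinarith [mul_le_mul_of_nonneg_right h3 hc.le]
  -- At most 10 corners per tile, times the factor 4 from the area of the annulus; corners lie
  -- within 4 of the centres of their tiles.
  · refine Asymptotics.IsBigO.of_bound (40 * Real.pi * (|L| + 4 + 1) / (Real.pi * inradius ^ 2)) ?_
    filter_upwards [eventually_ge_atTop (|L| + 4 + 1)] with r hr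
    have hL := abs_nonneg L
    have hfa : {i | |dist (T.center i) x - r| ≤ |L| + 4}.Finite :=
      (hfin (r + (|L| + 4))).subset fun i (hi : |dist (T.center i) x - r| ≤ |L| + 4) => by
        have := (abs_le.1 hi).2
        simp only [Set.mem_ofPred_eq]; linarith
    have h1 := T.darts_ncard_le hfa
    have h2 := T.tiles_annulus x (show 0 ≤ |L| + 4 by positivity) hr
    have h3 : ({d : T.Dart | |dist d.pos x - r| ≤ L}.ncard : ℝ) ≤
        ({i | |dist (T.center i) x - r| ≤ |L| + 4}.ncard : ℝ) * 10 := by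
      exact_mod_cast (Set.ncard_le_ncard (hann L r) h1.1).trans h1.2
    rw [Real.norm_of_nonneg (Nat.cast_nonneg _), Real.norm_of_nonneg (by linarith),
      div_mul_eq_mul_div, le_div_iff₀ hc]
    nlinarith [mul_le_mul_of_nonneg_right h3 hc.le]

/-- The corners of the tiles of class `K` that correspond to a given corner of the prototile. -/
def cornersAt (K : Set Proto) (k : Fin 5 × Bool) : Set T.Dart :=
  {d | T.proto d.1.1 ∈ K ∧ d.1.2 = k}

theorem disjoint_cornersAt {K K' : Set Proto} {k k' : Fin 5 × Bool} (h : k ≠ k') :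
    Disjoint (T.cornersAt K k) (T.cornersAt K' k') :=
  Set.disjoint_left.2 fun _ h1 h2 => h (h1.2.symm.trans h2.2)

theorem disjoint_cornersAt' {K K' : Set Proto} {k k' : Fin 5 × Bool} (h : Disjoint K K') :
    Disjoint (T.cornersAt K k) (T.cornersAt K' k') :=
  Set.disjoint_left.2 fun _ h1 h2 => Set.disjoint_left.1 h h1.1 h2.1

theorem finite_tiles_closedBall (K : Set Proto) (x : ℂ) (r : ℝ) :
    {i : ι | T.proto i ∈ K ∧ T.tile i ⊆ Metric.closedBall x r}.Finite := by
  refine (T.tiles_closedBall x (le_max_right r 0)).1.subset fun i hi => ?_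
  have h1 := hi.2 (T.ball_subset_tile i (Metric.mem_ball_self inradius_pos))
  exact (Metric.mem_closedBall.1 h1).trans (le_max_left _ _)

theorem tileCount_union {K K' : Set Proto} (h : Disjoint K K') (x : ℂ) (r : ℝ) :
    T.tileCount (K ∪ K') x r = T.tileCount K x r + T.tileCount K' x r := by
  unfold tileCount
  rw [← Set.ncard_union_eq _ (T.finite_tiles_closedBall K x r) (T.finite_tiles_closedBall K' x r)]
  · congr 1
    ext i
    simp only [Set.mem_union, Set.mem_ofPred_eq]
    tauto
  · exact Set.disjoint_left.2 fun _ h1 h2 => Set.disjoint_left.1 h h1.1 h2.1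

/-- Each tile of the class has exactly one such corner. Tiles have diameter at most 8, so a corner
in the disc whose tile sticks out lies in an annulus of that width. -/
theorem count_cornersAt {K : Set Proto} {k : Fin 5 × Bool} (hk : ∀ P ∈ K, P.gap k.1 ≠ 0) (x : ℂ) :
    (count (fun d : T.Dart => dist d.pos x) (T.cornersAt K k) -
      fun r => (T.tileCount K x r : ℝ)) =O[atTop] fun r : ℝ => r := by
  refine Asymptotics.IsBigO.trans (.of_norm_le fun r => ?_) ((T.planar x).annulus 8)
  set B := {d ∈ T.cornersAt K k | T.tile d.1.1 ⊆ Metric.closedBall x r} with hB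
  have hBA : B ⊆ {d ∈ T.cornersAt K k | dist d.pos x ≤ r} := fun d hd =>
    ⟨hd.1, Metric.mem_closedBall.1 (hd.2 d.pos_mem_tile)⟩
  have hfin := (T.planar x).finite_sep (T.cornersAt K k) r
  have h1 : T.tileCount K x r = B.ncard := by
    unfold tileCount
    rw [← Set.InjOn.ncard_image (s := B) (f := fun d : T.Dart => d.1.1)]
    · congr 1
      ext i
      constructor
      · rintro ⟨h1, h2⟩
        exact ⟨⟨(i, k), hk _ h1⟩, ⟨⟨h1, rfl⟩, h2⟩, rfl⟩
      · rintro ⟨d, ⟨⟨h1, -⟩, h2⟩, rfl⟩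
        exact ⟨h1, h2⟩
    · intro d hd e he hde
      exact Subtype.ext (Prod.ext hde (hd.1.2.trans he.1.2.symm))
  have h2 : {d ∈ T.cornersAt K k | dist d.pos x ≤ r} ⊆
      B ∪ {d : T.Dart | |dist d.pos x - r| ≤ 8} := by
    rintro d ⟨hd, hr⟩
    by_cases ht : T.tile d.1.1 ⊆ Metric.closedBall x r
    · exact .inl ⟨hd, ht⟩
    · right
      obtain ⟨z, hz, hzx⟩ := Set.not_subset.1 ht
      rw [Metric.mem_closedBall, not_le] at hzx
      have h3 := T.dist_center_le hz
      have h4 := T.dist_pos_center d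
      have h5 := dist_triangle z d.pos x
      have h6 := dist_triangle_right z d.pos (T.center d.1.1)
      rw [Set.mem_ofPred_eq, abs_le]
      constructor <;> linarith
  have h3 : B.ncard ≤ {d ∈ T.cornersAt K k | dist d.pos x ≤ r}.ncard := Set.ncard_le_ncard hBA hfin
  have h4 := (Set.ncard_le_ncard h2 ((hfin.subset hBA).union ((T.planar x).finite_annulus 8 r))).trans
    (Set.ncard_union_le _ _)
  have h3' : (B.ncard : ℝ) ≤ {d ∈ T.cornersAt K k | dist d.pos x ≤ r}.ncard := by exact_mod_cast h3
  have h4' : ({d ∈ T.cornersAt K k | dist d.pos x ≤ r}.ncard : ℝ) ≤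
    B.ncard + {d : T.Dart | |dist d.pos x - r| ≤ 8}.ncard := by exact_mod_cast h4
  rw [Pi.sub_apply, count, h1, Real.norm_of_nonneg (by linarith)]
  linarith

variable {T} in
theorem mem_colouredVertices {c : Colour} {z : ℂ} :
    z ∈ T.colouredVertices c ↔ ∃ d : T.Dart, d.colour = c ∧ d.pos = z := by
  constructor
  · rintro ⟨i, hi⟩
    obtain ⟨p, hp, hz⟩ := (T.vertex_iff i z c).1 hi
    obtain ⟨x, hx, rfl, hc⟩ := (Proto.mem_vertices_iff _ _ _).1 hp
    exact ⟨⟨(i, x), hx⟩, hc.symm, hz⟩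
  · rintro ⟨d, rfl, rfl⟩
    exact ⟨d.1.1, d.vertex⟩

theorem vertexCount_eq {A : Set T.Dart} {c : Colour}
    (h : Set.BijOn Dart.pos A (T.colouredVertices c)) (x : ℂ) (r : ℝ) :
    (T.vertexCount c x r : ℝ) = count (fun d : T.Dart => dist d.pos x) A r := by
  unfold vertexCount count
  rw [← Set.InjOn.ncard_image (s := {d ∈ A | dist d.pos x ≤ r}) (f := Dart.pos)
    (h.injOn.mono fun _ hd => hd.1), ← h.image_eq]
  congr 2
  ext z
  constructor
  · rintro ⟨⟨d, hd, rfl⟩, hz⟩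
    exact ⟨d, ⟨hd, hz⟩, rfl⟩
  · rintro ⟨d, ⟨hd, hz⟩, rfl⟩
    exact ⟨⟨d, hd, rfl⟩, hz⟩

namespace Dart
variable {T}

/-- The offset between the corners is 0 to 4 units. Offsets 1 and 4 make the sectors overlap, and
offsets 2 and 3 make the corners adjacent under `rot`. This shows that green vertices have one base
and blue vertices one corner of size 2. -/
theorem eq_of_size_two {d e : T.Dart} (h : d.pos = e.pos) (hd : d.size = 2) (he : e.size = 2)
    (hde : d.rot ≠ e) (hed : e.rot ≠ d) : d = e := by
  obtain ⟨m, hm, hm'⟩ := exists_aligned h.symm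
  have key : ∀ k : ℕ, m + k = 5 → dir d.arg = dir (e.arg + k * (2 * (Real.pi / 5))) := by
    intro k hk
    have hk' : (m : ℝ) + k = 5 := by exact_mod_cast hk
    rw [dir_add, hm', ← dir_add, ← dir_add_mul_five d.arg]
    congr 1
    rw [← hk']; ring
  have cases_m : m = 0 ∨ m = 1 ∨ m = 2 ∨ m = 3 ∨ m = 4 := by omega
  rcases cases_m with rfl | rfl | rfl | rfl | rfl
  · exact (eq_of_dir h (by omega) hm').1
  · exact (eq_of_dir h (by omega) hm').1
  · exact absurd (eq_of_pos_dir (d.pos_rot.trans h) (by rw [dir_rot, hm', hd])) hde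
  · exact absurd (eq_of_pos_dir (e.pos_rot.trans h.symm) (by rw [dir_rot, key 2 rfl, he])) hed
  · exact (eq_of_dir h.symm (m := 1) (by omega) (key 1 rfl)).1.symm

end Dart

theorem bijOn_green : Set.BijOn Dart.pos {d : T.Dart | d.lab = .Hg0 ∨ d.lab = .Bg0}
    (T.colouredVertices .green) := by
  have hne : ∀ d e : T.Dart, (d.lab = .Hg0 ∨ d.lab = .Bg0) → (e.lab = .Hg0 ∨ e.lab = .Bg0) →
      d.rot ≠ e := by
    rintro d e hd he rfl
    rcases Dart.rot_of_base hd with h | h <;> rw [h] at he <;> simp at he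
  refine ⟨fun d hd => mem_colouredVertices.2 ⟨d, ?_, rfl⟩, fun d hd e he hde => ?_, fun z hz => ?_⟩
  · rw [Dart.colour_of_lab]; rcases hd with h | h <;> rw [h]
  · exact Dart.eq_of_size_two hde (Dart.size_of_base hd) (Dart.size_of_base he) (hne _ _ hd he)
      (hne _ _ he hd)
  · obtain ⟨d, hd, rfl⟩ := mem_colouredVertices.1 hz
    rcases Dart.lab_of_green hd with h | h | h
    · exact ⟨d, h, rfl⟩
    · exact ⟨d.rot.rot, Dart.rot_of_flank (Dart.rot_of_tip h), by rw [Dart.pos_rot, Dart.pos_rot]⟩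
    · exact ⟨d.rot, Dart.rot_of_flank h, by rw [Dart.pos_rot]⟩

theorem bijOn_blue : Set.BijOn Dart.pos {d : T.Dart | d.colour = .blue ∧ d.size = 2}
    (T.colouredVertices .blue) := by
  have hne : ∀ d e : T.Dart, (d.colour = .blue ∧ d.size = 2) → (e.colour = .blue ∧ e.size = 2) →
      d.rot ≠ e := by
    rintro d e hd he rfl
    have := (Dart.rot_rot_of_blue hd.1).2
    omega
  refine ⟨fun d hd => mem_colouredVertices.2 ⟨d, hd.1, rfl⟩, fun d hd e he hde => ?_, fun z hz => ?_⟩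
  · exact Dart.eq_of_size_two hde hd.2 he.2 (hne _ _ hd he) (hne _ _ he hd)
  · obtain ⟨d, hd, rfl⟩ := mem_colouredVertices.1 hz
    have h1 := Proto.size_of_blue _ d.2 hd
    have h2 := Proto.size_of_blue _ d.rot.2 ((Dart.colour_rot d).trans hd)
    have h3 := (Dart.rot_rot_of_blue hd).2
    change 2 ≤ d.size at h1
    change 2 ≤ d.rot.size at h2
    by_cases h4 : d.size = 2
    · exact ⟨d, ⟨hd, h4⟩, rfl⟩
    · exact ⟨d.rot, ⟨(Dart.colour_rot d).trans hd, by omega⟩, Dart.pos_rot d⟩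

namespace Dart
variable {T}

theorem dir_rot_iterate_of_red {d : T.Dart} (h : d.colour = .red) (n : ℕ) :
    dir (rot^[n] d).arg = dir (d.arg + n * (2 * (Real.pi / 5))) := by
  rw [dir_rot_iterate, Finset.sum_congr rfl fun k _ =>
    size_of_red ((d.colour_rot_iterate k).trans h)]
  simp

theorem rot_iterate_injOn {d : T.Dart} (h : d.colour = .red) :
    Set.InjOn (fun n => rot^[n] d) (Finset.range 5) := by
  intro m hm n hn hmn
  have h1 : dir (rot^[m] d).arg = dir (rot^[n] d).arg := congrArg (fun e => dir e.arg) hmn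
  rw [dir_rot_iterate_of_red h, dir_rot_iterate_of_red h, dir_add, dir_add] at h1
  have h2 := mul_left_cancel₀ (dir_ne_zero _) h1
  obtain ⟨k, hk⟩ := (dir_eq_dir_unit (a := 2 * m) (b := 2 * n)).1 (by
    rw [show ((2 * m : ℤ) : ℝ) * (Real.pi / 5) = m * (2 * (Real.pi / 5)) by push_cast; ring,
      show ((2 * n : ℤ) : ℝ) * (Real.pi / 5) = n * (2 * (Real.pi / 5)) by push_cast; ring, h2])
  simp only [Finset.coe_range, Set.mem_Iio] at hm hn
  omega

theorem exists_rot_iterate {d e : T.Dart} (h : d.colour = .red) (he : e.pos = d.pos) :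
    ∃ m < 5, rot^[m] d = e := by
  obtain ⟨m, hm, hm'⟩ := exists_aligned he
  exact ⟨m, hm, eq_of_pos_dir ((d.pos_rot_iterate m).trans he.symm)
    ((dir_rot_iterate_of_red h m).trans hm'.symm)⟩

end Dart

/-- Five corners meet at each red vertex. -/
theorem five_mul_vertexCount_red (x : ℂ) (r : ℝ) : 5 * (T.vertexCount .red x r : ℝ) =
    count (fun d : T.Dart => dist d.pos x) {d | d.colour = .red} r := by
  classical
  have hfin := (T.planar x).finite_sep {d | d.colour = .red} r
  set s := hfin.toFinset with hs
  have hmem : ∀ d : T.Dart, d ∈ s ↔ d.colour = .red ∧ dist d.pos x ≤ r := fun d => by simp [hs]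
  have h1 : T.colouredVertices .red ∩ Metric.closedBall x r = (s.image Dart.pos : Finset ℂ) := by
    ext z
    rw [Set.mem_inter_iff, mem_colouredVertices, Finset.coe_image, Metric.mem_closedBall]
    constructor
    · rintro ⟨⟨d, hd, rfl⟩, hz⟩
      exact ⟨d, (hmem d).2 ⟨hd, hz⟩, rfl⟩
    · rintro ⟨d, hd, rfl⟩
      have := (hmem d).1 hd
      exact ⟨⟨d, this.1, rfl⟩, this.2⟩
  have h2 : ∀ z ∈ s.image Dart.pos, (s.filter fun d => d.pos = z).card = 5 := by
    intro z hz
    obtain ⟨d, hd, rfl⟩ := Finset.mem_image.1 hz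
    have hd' := (hmem d).1 hd
    rw [show s.filter (fun e => e.pos = d.pos) =
        (Finset.range 5).image (fun n => Dart.rot^[n] d) from ?_,
      Finset.card_image_of_injOn (Dart.rot_iterate_injOn hd'.1), Finset.card_range]
    ext e
    rw [Finset.mem_filter, Finset.mem_image]
    constructor
    · rintro ⟨-, he⟩
      obtain ⟨m, hm, hm'⟩ := Dart.exists_rot_iterate hd'.1 he
      exact ⟨m, Finset.mem_range.2 hm, hm'⟩
    · rintro ⟨m, -, rfl⟩
      rw [hmem, d.pos_rot_iterate, d.colour_rot_iterate]
      exact ⟨hd', rfl⟩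
  have h3 := Finset.card_eq_sum_card_fiberwise (f := Dart.pos) (s := s) (t := s.image Dart.pos)
    fun d hd => Finset.mem_coe.2 (Finset.mem_image_of_mem _ hd)
  rw [Finset.sum_congr rfl h2, Finset.sum_const, smul_eq_mul] at h3
  unfold vertexCount count
  rw [h1, Set.ncard_coe_finset, Set.ncard_eq_toFinset_card _ hfin, ← hs, h3]
  push_cast; ring

end StarTiling
-- Shares of tiles and vertices, and the limits
theorem StarMap.Share.tendsto_div {D : Type*} {X : StarMap D} {ρ : D → ℝ} {f g : ℝ → ℝ} {a b : ℝ}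
    (hβ : (fun r : ℝ => r ^ 2) =O[atTop] count ρ (X.cls .Br0)) (hf : X.Share ρ f a)
    (hg : X.Share ρ g b) (hb : b ≠ 0) : Tendsto (fun r => f r / g r) atTop (𝓝 (a / b)) := by
  have hne : ∀ᶠ r in atTop, count ρ (X.cls .Br0) r ≠ 0 := by
    filter_upwards [hβ.eq_zero_imp, eventually_gt_atTop 0] with r h1 h2 h3
    exact (pow_pos h2 2).ne' (h1 h3)
  have key : ∀ {f : ℝ → ℝ} {a : ℝ}, X.Share ρ f a →
      Tendsto (fun r => f r / count ρ (X.cls .Br0) r) atTop (𝓝 a) := by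
    intro f a hf
    have h1 := (hf.trans_isBigO hβ).tendsto_div_nhds_zero.add_const a
    rw [zero_add] at h1
    refine h1.congr' ?_
    filter_upwards [hne] with r hr
    field_simp
    ring
  refine ((key hf).div (key hg) hb).congr' ?_
  filter_upwards [hne] with r hr
  exact div_div_div_cancel_right₀ hr _ _

namespace Proto
variable {P : Proto} {x : Fin 5 × Bool}

theorem lab_eq_Hr2 : P.lab x = .Hr2 ↔ P ∈ ({.H} : Set Proto) ∧ x = (3, false) := by
  rw [Set.mem_singleton_iff]
  cases P <;> simp only [reduceCtorEq, false_and, true_and] <;> revert x <;> decide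

theorem lab_eq_Br0 : P.lab x = .Br0 ↔ P ∈ ({.B} : Set Proto) ∧ x = (0, true) := by
  rw [Set.mem_singleton_iff]
  cases P <;> simp only [reduceCtorEq, false_and, true_and] <;> revert x <;> decide

theorem lab_eq_Sr : P.lab x = .Sr ↔ (P ∈ ({.S1, .S2} : Set Proto) ∧ x = (0, true)) ∨
    (P ∈ ({.S2} : Set Proto) ∧ x = (2, true)) := by
  rw [Set.mem_insert_iff, Set.mem_singleton_iff]
  cases P <;> simp only [reduceCtorEq, false_and, true_and, or_true, or_false] <;>
    revert x <;> decide

theorem lab_eq_S : (P.lab x = .Sr ∨ P.lab x = .Sg) ↔ P ∈ ({.S0, .S1, .S2} : Set Proto) ∧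
    (((((x = (0, true)) ∨ x = (1, true)) ∨ x = (2, true)) ∨ x = (3, true)) ∨ x = (4, true)) := by
  rw [Set.mem_insert_iff, Set.mem_insert_iff, Set.mem_singleton_iff]
  cases P <;> simp only [reduceCtorEq, false_and, true_and, or_true, or_false] <;>
    revert x <;> decide

theorem lab_eq_base : (P.lab x = .Hg0 ∨ P.lab x = .Bg0) ↔
    (P ∈ ({.H} : Set Proto) ∧ x = (0, false)) ∨ (P ∈ ({.B} : Set Proto) ∧ x = (0, false)) := by
  rw [Set.mem_singleton_iff, Set.mem_singleton_iff]
  cases P <;> simp only [reduceCtorEq, false_and, true_and, or_false, false_or] <;>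
    revert x <;> decide

theorem blue_and_size_two (hx : P.gap x.1 ≠ 0) : (P.colour x = .blue ∧ P.size x = 2) ↔
    ((P ∈ ({.H} : Set Proto) ∧ x = (1, true)) ∨ (P ∈ ({.H} : Set Proto) ∧ x = (3, true))) ∨
      (P ∈ ({.B} : Set Proto) ∧ x = (3, true)) := by
  rw [Set.mem_singleton_iff, Set.mem_singleton_iff]
  revert hx
  cases P <;> simp only [reduceCtorEq, false_and, true_and, or_false, false_or] <;>
    revert x <;> decide

theorem colour_eq_red : P.colour x = .red ↔
    ((((P ∈ ({.H} : Set Proto) ∧ x = (0, true)) ∨ (P ∈ ({.H} : Set Proto) ∧ x = (3, false))) ∨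
      (P ∈ ({.B} : Set Proto) ∧ x = (0, true))) ∨ (P ∈ ({.B} : Set Proto) ∧ x = (2, true))) ∨
      P.lab x = .Sr := by
  rw [Set.mem_singleton_iff, Set.mem_singleton_iff]
  cases P <;> simp only [reduceCtorEq, false_and, true_and, or_false, false_or] <;>
    revert x <;> decide

/-- Only in S₂ is a green tip enclosed by two red ones. In a star `skip^[4]` is the step backwards.
-/
theorem lab_between : (P.lab x = .Sg ∧ P.lab (P.skip^[4] x) = .Sr ∧ P.lab (P.skip x) = .Sr) ↔
    P ∈ ({.S2} : Set Proto) ∧ x = (1, true) := by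
  rw [Set.mem_singleton_iff]
  cases P <;> simp only [reduceCtorEq, false_and, true_and] <;> revert x <;> decide

end Proto

namespace StarTiling
variable {ι : Type*} (T : StarTiling ι)

theorem cls_Hr2 : T.starMap.cls .Hr2 = T.cornersAt {.H} (3, false) :=
  Set.ext fun _ => Proto.lab_eq_Hr2

theorem cls_Br0 : T.starMap.cls .Br0 = T.cornersAt {.B} (0, true) :=
  Set.ext fun _ => Proto.lab_eq_Br0

theorem cls_Sr : T.starMap.cls .Sr = T.cornersAt {.S1, .S2} (0, true) ∪ T.cornersAt {.S2} (2, true) :=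
  Set.ext fun _ => Proto.lab_eq_Sr

theorem cls_S : T.starMap.cls .Sr ∪ T.starMap.cls .Sg =
    T.cornersAt {.S0, .S1, .S2} (0, true) ∪ T.cornersAt {.S0, .S1, .S2} (1, true) ∪
    T.cornersAt {.S0, .S1, .S2} (2, true) ∪ T.cornersAt {.S0, .S1, .S2} (3, true) ∪
    T.cornersAt {.S0, .S1, .S2} (4, true) := by
  ext d
  refine Proto.lab_eq_S.trans ?_
  simp only [Set.mem_union, cornersAt, Set.mem_ofPred_eq, ← and_or_left]

theorem betweenRed_eq : T.starMap.betweenRed = T.cornersAt {.S2} (1, true) := by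
  ext d
  refine Iff.trans ?_ Proto.lab_between
  have hskip : ∀ n : ℕ, (Dart.skip^[n] d).1 = (d.1.1, (T.proto d.1.1).skip^[n] d.1.2) := by
    intro n
    induction n with
    | zero => rfl
    | succ n ih =>
      rw [Function.iterate_succ_apply', Dart.skip_val, ih, Function.iterate_succ_apply']
  have hS : d.lab = .Sg → T.starMap.prev d = Dart.skip^[4] d := by
    intro hd
    have h5 : Dart.skip^[5] d = d := T.starMap.next_BS d (by simp [starMap, hd])
    -- `prev` is `next^[19]`, and 19 = 4 + 15 with period 5 on a star.
    change Dart.skip^[4 + (5 + (5 + 5))] d = _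
    rw [Function.iterate_add_apply, Function.iterate_add_apply, Function.iterate_add_apply, h5, h5, h5]
  change (d.lab = .Sg ∧ (T.starMap.prev d).lab = .Sr ∧ d.skip.lab = .Sr) ↔ _
  rw [Dart.lab_skip]
  refine and_congr_right fun hd => ?_
  rw [hS hd, Dart.lab, hskip]

variable {T} in
theorem share_of_cornersAt {K : Set Proto} {k : Fin 5 × Bool} (hk : ∀ P ∈ K, P.gap k.1 ≠ 0) {x : ℂ}
    {a : ℝ} (h : T.starMap.Share (fun d => dist d.pos x)
      (count (fun d => dist d.pos x) (T.cornersAt K k)) a) :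
    T.starMap.Share (fun d => dist d.pos x) (fun r => (T.tileCount K x r : ℝ)) a :=
  h.congr (T.count_cornersAt hk x)

variable {T} in
theorem share_cornersAt {K : Set Proto} {k : Fin 5 × Bool} (hk : ∀ P ∈ K, P.gap k.1 ≠ 0) {x : ℂ}
    {a : ℝ} (h : T.starMap.Share (fun d => dist d.pos x) (fun r => (T.tileCount K x r : ℝ)) a) :
    T.starMap.Share (fun d => dist d.pos x)
      (count (fun d => dist d.pos x) (T.cornersAt K k)) a :=
  h.congr ((T.count_cornersAt hk x).neg_left.congr_left fun r => by simp)

section shares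
variable (x : ℂ)

/-- The asymptotic number of tiles of class `K` per boat is `a`. -/
abbrev TileShare (K : Set Proto) (a : ℝ) : Prop :=
  T.starMap.Share (fun d => dist d.pos x) (fun r => (T.tileCount K x r : ℝ)) a

theorem tileShare_H : T.TileShare x {.H} φ := by
  refine share_of_cornersAt (k := (3, false)) (by simp [Proto.gap]) ?_
  rw [← cls_Hr2]
  exact T.starMap.share_Hr2 (T.planar x) (bddMove_next x) (bddMove_rot x)

theorem tileShare_B : T.TileShare x {.B} 1 := by
  refine share_of_cornersAt (k := (0, true)) (by simp [Proto.gap]) ?_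
  rw [← cls_Br0]
  exact T.starMap.share_Br0

theorem tileShare_S2 : T.TileShare x {.S2} (2 * φ - 3) := by
  refine share_of_cornersAt (k := (1, true)) (by simp [Proto.gap]) ?_
  rw [← betweenRed_eq]
  exact T.starMap.share_betweenRed (T.planar x) (bddMove_next x) (bddMove_rot x)

theorem gap_of_mem_S {k : Fin 5 × Bool} :
    ∀ P ∈ ({.S0, .S1, .S2} : Set Proto), P.gap k.1 ≠ 0 := by
  rintro P (rfl | rfl | rfl) <;> obtain ⟨k, -⟩ := k <;> fin_cases k <;> simp [Proto.gap]

/-- S₂ has two red tips and S₁ one, so S₁ and S₂ together are counted by the red tips minus the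
number of S₂. -/
theorem tileShare_S12 : T.TileShare x {.S1, .S2} (2 - φ) := by
  have h1 := T.starMap.share_Sr (T.planar x) (bddMove_next x) (bddMove_rot x)
  rw [cls_Sr, (T.planar x).count_union (T.disjoint_cornersAt (by decide))] at h1
  have h2 := share_cornersAt (k := (2, true)) (by simp [Proto.gap]) (T.tileShare_S2 x)
  refine share_of_cornersAt (k := (0, true)) (by simp [Proto.gap]) ?_
  have h3 := h1.sub h2
  rw [add_sub_cancel_right] at h3
  convert h3 using 1
  ring

theorem tileShare_S : T.TileShare x {.S0, .S1, .S2} ((2 * φ - 1) / 5) := by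
  have hρ := T.planar x
  have h1 := T.starMap.share_S hρ (bddMove_next x) (bddMove_rot x)
  rw [← hρ.count_union (T.starMap.disjoint_cls (by simp)), cls_S, hρ.count_union, hρ.count_union,
    hρ.count_union, hρ.count_union] at h1
  · have hk : ∀ k k' : Fin 5, (count (fun d : T.Dart => dist d.pos x)
        (T.cornersAt {.S0, .S1, .S2} (k', true)) - count (fun d : T.Dart => dist d.pos x)
        (T.cornersAt {.S0, .S1, .S2} (k, true))) =O[atTop] fun r : ℝ => r := fun k k' =>
      ((T.count_cornersAt (k := (k', true)) gap_of_mem_S x).sub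
        (T.count_cornersAt (k := (k, true)) gap_of_mem_S x)).congr_left fun r => by simp
    -- The five kinds of tips are equally numerous up to O(r), so the stars are a fifth of the star
    -- tips.
    refine share_of_cornersAt (k := (0, true)) gap_of_mem_S ?_
    have h2 := (h1.congr (g := (5 : ℝ) • count (fun d : T.Dart => dist d.pos x)
      (T.cornersAt {.S0, .S1, .S2} (0, true))) (((((hk 0 1).add (hk 0 2)).add (hk 0 3)).add
        (hk 0 4)).congr_left fun r => by
          simp only [Pi.sub_apply, Pi.add_apply, Pi.smul_apply, smul_eq_mul]; ring)).smul (5⁻¹)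
    rw [smul_smul, inv_mul_cancel₀ (by norm_num), one_smul] at h2
    convert h2 using 1
    ring
  all_goals
    repeat' first
      | exact T.disjoint_cornersAt (by decide)
      | refine Set.disjoint_union_left.2 ⟨?_, ?_⟩

theorem tileShare_S1 : T.TileShare x {.S1} (5 - 3 * φ) := by
  have h := (T.tileShare_S12 x).sub (T.tileShare_S2 x)
  convert h using 1
  · ext r
    have := T.tileCount_union (K := {.S1}) (K' := {.S2}) (by simp) x r
    rw [Set.singleton_union] at this
    simp [this]
  · ring

theorem tileShare_S0 : T.TileShare x {.S0} ((7 * φ - 11) / 5) := by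
  have h := (T.tileShare_S x).sub (T.tileShare_S12 x)
  convert h using 1
  · ext r
    have := T.tileCount_union (K := {.S0}) (K' := {.S1, .S2}) (by simp) x r
    rw [Set.singleton_union] at this
    simp [this]
  · ring

theorem tileShare_univ : T.TileShare x Set.univ ((7 * φ + 4) / 5) := by
  have h := ((T.tileShare_H x).add (T.tileShare_B x)).add (T.tileShare_S x)
  convert h using 1
  · ext r
    have h1 := T.tileCount_union (K := {.H}) (K' := {.B}) (by simp) x r
    have h2 := T.tileCount_union (K := {.H} ∪ {.B}) (K' := {.S0, .S1, .S2}) (by simp) x r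
    have h3 : ({.H} ∪ {.B} ∪ {.S0, .S1, .S2} : Set Proto) = Set.univ := by
      ext P; cases P <;> simp
    rw [h3, h1] at h2
    simp [h2]
  · ring

theorem sq_isBigO : (fun r : ℝ => r ^ 2) =O[atTop]
    count (fun d : T.Dart => dist d.pos x) (T.starMap.cls .Br0) := by
  have h1 : (fun r : ℝ => r ^ 2) =O[atTop] fun r => (T.tileCount Set.univ x r : ℝ) := by
    refine .of_bound 64 ?_
    filter_upwards [eventually_ge_atTop 16] with r hr
    have h2 := T.le_tileCount x (show 8 ≤ r by linarith)
    rw [Real.norm_of_nonneg (sq_nonneg r), Real.norm_of_nonneg (Nat.cast_nonneg _)]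
    nlinarith
  -- The error o(r²) is negligible against the number of all tiles, which is therefore O of the
  -- number of boats. So boats have positive density and can serve as denominator.
  have h2 := (T.tileShare_univ x).trans_isBigO h1
  have h3 := h2.right_isBigO_sub
  simp only [sub_sub_cancel] at h3
  exact (h1.trans h3).trans (Asymptotics.isBigO_const_mul_self _ _ _)

/-- One base per green vertex, and one base per hexagon and per boat. -/
theorem vertexShare_green : T.starMap.Share (fun d => dist d.pos x)
    (fun r => (T.vertexCount .green x r : ℝ)) (φ + 1) := by
  have h1 : {d : T.Dart | d.lab = .Hg0 ∨ d.lab = .Bg0} =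
      T.cornersAt {.H} (0, false) ∪ T.cornersAt {.B} (0, false) := Set.ext fun _ => Proto.lab_eq_base
  have h2 := (share_cornersAt (k := (0, false)) (by simp [Proto.gap]) (T.tileShare_H x)).add
    (share_cornersAt (k := (0, false)) (by simp [Proto.gap]) (T.tileShare_B x))
  rw [← (T.planar x).count_union (T.disjoint_cornersAt' (by simp)), ← h1] at h2
  exact (funext (T.vertexCount_eq T.bijOn_green x)) ▸ h2

/-- One corner of size 2 per blue vertex: two in each hexagon, one in each boat, none in a star. -/
theorem vertexShare_blue : T.starMap.Share (fun d => dist d.pos x)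
    (fun r => (T.vertexCount .blue x r : ℝ)) (2 * φ + 1) := by
  have h1 : {d : T.Dart | d.colour = .blue ∧ d.size = 2} =
      T.cornersAt {.H} (1, true) ∪ T.cornersAt {.H} (3, true) ∪ T.cornersAt {.B} (3, true) :=
    Set.ext fun d => Proto.blue_and_size_two d.2
  have h2 := ((share_cornersAt (k := (1, true)) (by simp [Proto.gap]) (T.tileShare_H x)).add
    (share_cornersAt (k := (3, true)) (by simp [Proto.gap]) (T.tileShare_H x))).add
    (share_cornersAt (k := (3, true)) (by simp [Proto.gap]) (T.tileShare_B x))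
  rw [← (T.planar x).count_union (T.disjoint_cornersAt (by decide)),
    ← (T.planar x).count_union (Set.disjoint_union_left.2 ⟨T.disjoint_cornersAt' (by simp),
      T.disjoint_cornersAt' (by simp)⟩), ← h1, ← two_mul] at h2
  exact (funext (T.vertexCount_eq T.bijOn_blue x)) ▸ h2

/-- Each red vertex has five corners: two from each hexagon and boat, and the red star tips. -/
theorem vertexShare_red : T.starMap.Share (fun d => dist d.pos x)
    (fun r => (T.vertexCount .red x r : ℝ)) ((3 * φ + 1) / 5) := by
  have hρ := T.planar x
  have h1 : {d : T.Dart | d.colour = .red} = T.cornersAt {.H} (0, true) ∪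
      T.cornersAt {.H} (3, false) ∪ T.cornersAt {.B} (0, true) ∪ T.cornersAt {.B} (2, true) ∪
      T.starMap.cls .Sr := Set.ext fun d => Proto.colour_eq_red
  have h2 := ((((share_cornersAt (k := (0, true)) (by simp [Proto.gap]) (T.tileShare_H x)).add
    (share_cornersAt (k := (3, false)) (by simp [Proto.gap]) (T.tileShare_H x))).add
    (share_cornersAt (k := (0, true)) (by simp [Proto.gap]) (T.tileShare_B x))).add
    (share_cornersAt (k := (2, true)) (by simp [Proto.gap]) (T.tileShare_B x))).add
    (T.starMap.share_Sr hρ (bddMove_next x) (bddMove_rot x))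
  rw [← hρ.count_union, ← hρ.count_union, ← hρ.count_union, ← hρ.count_union, ← h1] at h2
  · have h3 := h2.smul 5⁻¹
    convert h3 using 1
    · ext r
      rw [Pi.smul_apply, ← T.five_mul_vertexCount_red x r, smul_eq_mul]; ring
    · ring
  all_goals
    try rw [cls_Sr]
    repeat' first
      | exact T.disjoint_cornersAt (by decide)
      | exact T.disjoint_cornersAt' (by simp)
      | refine Set.disjoint_union_left.2 ⟨?_, ?_⟩
      | refine Set.disjoint_union_right.2 ⟨?_, ?_⟩

end shares

theorem hasFrequency {K : Set Proto} {a f : ℝ} (h : ∀ x, T.TileShare x K a)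
    (hf : a * 5 = f * (7 * φ + 4)) : T.HasFrequency K f := by
  intro x
  have hφ := Real.goldenRatio_pos
  have h1 := StarMap.Share.tendsto_div (T.sq_isBigO x) (h x) (T.tileShare_univ x) (by positivity)
  convert h1 using 2
  rw [eq_div_iff (by positivity)]
  linarith

theorem hasVertexRatio {c c' : Colour} {a b f : ℝ}
    (h : ∀ x, T.starMap.Share (fun d => dist d.pos x) (fun r => (T.vertexCount c x r : ℝ)) a)
    (h' : ∀ x, T.starMap.Share (fun d => dist d.pos x) (fun r => (T.vertexCount c' x r : ℝ)) b)
    (hb : b ≠ 0) (hf : a = f * b) : T.HasVertexRatio c c' f := by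
  intro x
  have h1 := StarMap.Share.tendsto_div (T.sq_isBigO x) (h x) (h' x) hb
  rwa [hf, mul_div_cancel_right₀ _ hb] at h1

end StarTiling
end StarTileset

theorem mainTheorem1 {ι : Type*} [Countable ι] (T : StarTileset.StarTiling ι) :
    T.HasFrequency {.H} (√5 * φ ^ (-3 : ℤ)) ∧
    T.HasFrequency {.B} (√5 * φ ^ (-4 : ℤ)) ∧
    T.HasFrequency {.S2} (√5 * φ ^ (-7 : ℤ)) ∧
    T.HasFrequency {.S1} (√5 * φ ^ (-8 : ℤ)) ∧
    T.HasFrequency {.S0} (φ ^ (-8 : ℤ)) ∧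
    T.HasFrequency {.S0, .S1, .S2} (φ ^ (-4 : ℤ)) ∧
    T.HasVertexRatio .blue .red (√5 * φ) ∧
    T.HasVertexRatio .green .red √5 ∧
    T.HasVertexRatio .blue .green φ := by
  have hsq := Real.goldenRatio_sq
  have hpos := Real.goldenRatio_pos
  have hinv : ∀ n : ℕ, φ ^ (-n : ℤ) = (φ - 1) ^ n := fun n => by
    rw [zpow_neg, zpow_natCast, ← inv_pow, StarTileset.StarMap.inv_goldenRatio_eq]
  have h3 := hinv 3
  have h4 := hinv 4
  have h7 := hinv 7
  have h8 := hinv 8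
  have e2 : (φ - 1) ^ 2 = 2 - φ := by linear_combination hsq
  have e3 : (φ - 1) ^ 3 = 2 * φ - 3 := by linear_combination (φ - 1) * e2 - hsq
  have e4 : (φ - 1) ^ 4 = 5 - 3 * φ := by linear_combination (φ - 1) * e3 + 2 * hsq
  have e7 : (φ - 1) ^ 7 = 13 * φ - 21 := by
    rw [show (φ - 1) ^ 7 = (φ - 1) ^ 4 * (φ - 1) ^ 3 by ring, e3, e4]; linear_combination -6 * hsq
  have e8 : (φ - 1) ^ 8 = 34 - 21 * φ := by
    rw [show (φ - 1) ^ 8 = (φ - 1) ^ 4 * (φ - 1) ^ 4 by ring, e4]; linear_combination 9 * hsq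
  push_cast at h3 h4 h7 h8
  rw [h3, h4, h7, h8, e3, e4, e7, e8, StarTileset.StarMap.sqrt_five_eq]
  have hb : (3 * φ + 1) / 5 ≠ 0 := by positivity
  refine ⟨T.hasFrequency T.tileShare_H ?_, T.hasFrequency T.tileShare_B ?_,
    T.hasFrequency T.tileShare_S2 ?_, T.hasFrequency T.tileShare_S1 ?_,
    T.hasFrequency T.tileShare_S0 ?_, T.hasFrequency T.tileShare_S ?_,
    T.hasVertexRatio T.vertexShare_blue T.vertexShare_red hb ?_,
    T.hasVertexRatio T.vertexShare_green T.vertexShare_red hb ?_,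
    T.hasVertexRatio T.vertexShare_blue T.vertexShare_green (by positivity) ?_⟩
  -- Each goal is now a polynomial identity modulo φ² = φ + 1.
  all_goals
    generalize φ = t at *
    grind
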